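/- Let $Q^n\subset P^{n+1}$ be the oval hyperquadric $(x,x)=0$ of a quadratic form of signature $(n+1,1)$, $n\ge 1$. The de Sitter space $S^{n+1}_1$ is the exterior domain $(x,x)>0$, and the points of $Q^n$ are the points of the conformal space $C^n$. The hyperspheres of $C^n$ are the sections of $Q^n$ by the polar hyperplanes of points of $S^{n+1}_1$. Let $U^n$ be a smooth immersed lightlike hypersurface of $S^{n+1}_1$. This means that its tangent hyperplane at each point $x$ touches $Q^n$, at a point $y=y(x)$. Suppose that $U^n$ has maximal rank, i.e. the tangent hyperplanes depend on $n-1$ parameters; equivalently, $y$ describes a hypersurface $V^{n-1}$ of $C^n=Q^n$. The generator through $x$ is the whole isotropic line $xy$, and $U^n$ is understood as extended along its generators. Locally write $x=A_n$ with $(A_n,A_n)=1$ and $y=A_0$, and choose $A_1,\dots,A_{n-1}$ orthogonal to $A_n$ that together with $A_0$ span $T_{A_0}V^{n-1}$. Put $g_{ij}=(A_i,A_j)$. Modulo $A_0$ we have $dA_0\equiv\omega_0^iA_i$ and $dA_n\equiv\omega_n^iA_i$, and the matrix $(\lambda_{ij})$ is defined by $-g_{ij}\omega_n^j=\lambda_{ij}\omega_0^j$.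 A point $A_n+sA_0$ of a generator has multiplicity $m$ if $s$ is an $m$-fold root of $\det(\lambda_{ij}-s\,g_{ij})=0$. A point of a generator is singular (a focus) if the tangent subspace at it of the hypersurface formed by the generators has dimension less than $n$. 1. Each generator carries $n-1$ real singular points, counted with multiplicity, and all of them lie in $S^{n+1}_1$. 2. Every simple focus belongs to a local continuous field of simple foci. Let $B$ be a continuous field of simple foci over an open set $O\subset U^n$. At every point of $O$, $B$ is smooth and either it is a fold (the focal submanifold described by $B$ has dimension $n-1$ there, and its tangent subspace contains the generator) or it is conic (the focal submanifold has dimension $n-2$ there, and its tangent subspace is spacelike). The set of folds is open. If $B$ is a fold at all points of $O$, then $O$ is foliated into an $(n-2)$-parameter family of torses: the generators belonging to a leaf are the tangent lines of a curve described by $B$. If $B$ is conic at all points of $O$, then $O$ is foliated into an $(n-2)$-parameter family of two-dimensional second-order cones circumscribed about $Q^n$, whose vertices $B$ describe an $(n-2)$-dimensional spacelike submanifold. In the conic case the part of $V^{n-1}$ corresponding to $O$ is a canal hypersurface as in 3, with $m=1$. 3. Let $m\ge2$, and let $B$ be a continuous field of foci of constant multiplicity $m$ over an open set $O\subset U^n$.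 Then $B$ is smooth and conic at all points of $O$: it describes an $(n-m-1)$-dimensional spacelike submanifold of $S^{n+1}_1$. The set $O$ is foliated into an $(n-m-1)$-parameter family of $(m+1)$-dimensional second-order cones circumscribed about $Q^n$, with vertices $B$. The corresponding part of $V^{n-1}\subset C^n$ is an $m$-canal hypersurface: it envelops the $(n-m-1)$-parameter family of hyperspheres that correspond to the points $B$, and it is foliated into $m$-dimensional spherical generators. That is, it is foliated into $m$-dimensional pieces of $m$-spheres, along each of which it touches one hypersphere of the family. -/

import Mathlib

open scoped Manifold ContDiff LinearAlgebra.Projectivization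

noncomputable section

namespace DeSitter

/-- The parameter space `ℝᵈ`. -/
abbrev E (d : ℕ) : Type := EuclideanSpace ℝ (Fin d)

/-- The vector space `ℝⁿ⁺²` of homogeneous coordinates of the projective space `Pⁿ⁺¹`. -/
abbrev V (n : ℕ) : Type := EuclideanSpace ℝ (Fin (n + 2))

/-- The scalar product of signature `(n + 1, 1)` on `ℝⁿ⁺²`. -/
def lor (n : ℕ) : LinearMap.BilinForm ℝ (V n) :=
  LinearMap.mk₂ ℝ
    (fun v w => (∑ i : Fin (n + 1), v i.castSucc * w i.castSucc)
      - v (Fin.last (n + 1)) * w (Fin.last (n + 1)))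
    (by intros; simp [add_mul, Finset.sum_add_distrib]; ring)
    (by intros; simp [Finset.mul_sum, mul_sub, mul_assoc])
    (by intros; simp [mul_add, Finset.sum_add_distrib]; ring)
    (by intros; simp [Finset.mul_sum, mul_sub, mul_left_comm])

variable {n : ℕ}

/-- The absolute: the oval hyperquadric `Qⁿ`, on which the conformal space `Cⁿ` is realized. -/
def absolute (n : ℕ) : Set (ℙ ℝ (V n)) := {z | ∀ v ∈ z.submodule, lor n v v = 0}

/-- The de Sitter space: the domain of `Pⁿ⁺¹` exterior to the absolute. -/
def deSitter (n : ℕ) : Set (ℙ ℝ (V n)) := {z | ∀ v ∈ z.submodule, v ≠ 0 → 0 < lor n v v}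

/-- The hyperplane that is polar-conjugate to a point with respect to the absolute. -/
def polar (z : ℙ ℝ (V n)) : Submodule ℝ (V n) := (lor n).orthogonal z.submodule

/-- A subspace is spacelike if the scalar product is positive definite on it, so that
it has no common point with the absolute. -/
def IsSpacelike (T : Submodule ℝ (V n)) : Prop := ∀ v ∈ T, v ≠ 0 → 0 < lor n v v

/-- A subspace is Lorentzian if the scalar product is nondegenerate on it and it contains
null directions. If it has dimension `m + 2`, it cuts the absolute in an `m`-dimensional sphere. -/
def IsLorentzian (L : Submodule ℝ (V n)) : Prop :=
  L ⊓ (lor n).orthogonal L = ⊥ ∧ ∃ l ∈ L, l ≠ 0 ∧ lor n l l = 0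

/-- `C` is (in homogeneous coordinates) a `d`-dimensional second-order cone with vertex `z`,
circumscribed about the absolute: the join of `z` with the nondegenerate `(d - 1)`-dimensional
quadric which a `d`-dimensional projective subspace `L` of the hyperplane polar-conjugate to `z`
cuts out of the absolute. -/
def IsSecondOrderCone (d : ℕ) (z : ℙ ℝ (V n)) (C : Set (V n)) : Prop :=
  z ∈ deSitter n ∧ ∃ L : Submodule ℝ (V n),
    L ≤ polar z ∧ Module.finrank ℝ L = d + 1 ∧ IsLorentzian L ∧
    C = {w | ∃ u ∈ z.submodule, ∃ l ∈ L, lor n l l = 0 ∧ w = u + l}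

variable {N : Type*} [TopologicalSpace N] [ChartedSpace (E n) N]

/-- The differential at `q` of a vector-valued function on a manifold. -/
abbrev dif (X : N → V n) (q : N) : TangentSpace 𝓘(ℝ, E n) q →L[ℝ] V n :=
  mfderiv 𝓘(ℝ, E n) 𝓘(ℝ, V n) X q

/-- `X` is a smooth choice, on the open set `W`, of homogeneous coordinates of the points `f q`. -/
def IsLift (f : N → ℙ ℝ (V n)) (W : Set N) (X : N → V n) : Prop :=
  IsOpen W ∧ ContMDiffOn 𝓘(ℝ, E n) 𝓘(ℝ, V n) ∞ X W ∧
    ∀ q ∈ W, ∃ h : X q ≠ 0, f q = Projectivization.mk ℝ (X q) h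

/-- A map to the projective space is smooth at (that is, near) `q`. -/
def SmoothAt (f : N → ℙ ℝ (V n)) (q : N) : Prop :=
  ∃ (W : Set N) (X : N → V n), q ∈ W ∧ IsLift f W X

/-- The projective subspace spanned by the point `f q` and by its displacements in the directions
of `D`. All choices `X` of homogeneous coordinates give the same subspace. -/
def tangentAlong (f : N → ℙ ℝ (V n)) (q : N)
    (D : Submodule ℝ (TangentSpace 𝓘(ℝ, E n) q)) : Submodule ℝ (V n) :=
  ⨆ (W : Set N) (X : N → V n) (_ : q ∈ W ∧ IsLift f W X),
    Submodule.span ℝ {X q} ⊔ D.map (dif X q : TangentSpace 𝓘(ℝ, E n) q →ₗ[ℝ] V n)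

/-- The projective tangent subspace at `f q` of the submanifold described by the point `f q`.
That submanifold has dimension `r` when this subspace has vector space dimension `r + 1`. -/
def tangentSubspace (f : N → ℙ ℝ (V n)) (q : N) : Submodule ℝ (V n) := tangentAlong f q ⊤

/-- `x` is an immersed hypersurface of the de Sitter space, and its tangent hyperplane at `x q`
touches the absolute at the point `y q`. -/
structure IsLightlikeHypersurface (x y : N → ℙ ℝ (V n)) : Prop where
  smooth : ∀ q, SmoothAt x q
  exterior : ∀ q, x q ∈ deSitter n
  hypersurface : ∀ q, Module.finrank ℝ (tangentSubspace x q) = n + 1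
  contact_mem : ∀ q, y q ∈ absolute n
  tangent_eq : ∀ q, tangentSubspace x q = polar (y q)

/-- The tangent hyperplanes, that is, the hyperplanes polar-conjugate to the points `y q`, depend
on `n - 1` parameters. -/
def HasMaximalRank (y : N → ℙ ℝ (V n)) : Prop :=
  ∀ q, SmoothAt y q ∧ Module.finrank ℝ (tangentSubspace y q) = n

/-- The rectilinear generator through `x q`: the isotropic line joining `x q` and `y q`. -/
def generator (x y : N → ℙ ℝ (V n)) (q : N) : Submodule ℝ (V n) :=
  (x q).submodule ⊔ (y q).submodule

/-- Vertices `A_n = X` and `A_0 = Y` of a moving frame, with `(A_n, A_n) = 1`. -/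
def IsFrame (x y : N → ℙ ℝ (V n)) (W : Set N) (X Y : N → V n) : Prop :=
  IsLift x W X ∧ IsLift y W Y ∧ ∀ q ∈ W, lor n (X q) (X q) = 1

/-- The point `z = α A_n + β A_0` of the generator through `x q` is singular: the tangent subspace
there of the hypersurface formed by the generators has dimension less than `n`. -/
def IsSingularPoint (x y : N → ℙ ℝ (V n)) (q : N) (z : ℙ ℝ (V n)) : Prop :=
  ∃ (W : Set N) (X Y : N → V n) (α β : ℝ), q ∈ W ∧ IsFrame x y W X Y ∧
    z.submodule = Submodule.span ℝ {α • X q + β • Y q} ∧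
    Module.finrank ℝ ↥(Submodule.span ℝ {X q, Y q} ⊔
      LinearMap.range (α • dif X q + β • dif Y q :
        TangentSpace 𝓘(ℝ, E n) q →ₗ[ℝ] V n)) < n + 1

/-- The matrices `g = (g_ij)` and `lam = (λ_ij)` at `q` with respect to frame points `A_i`
(`i = 1, …, n - 1`) that together with `A_0 = Y` span the tangent subspace of the submanifold
described by `A_0`. They are given by `g_ij = (A_i, A_j)`, `dA_0 = ω_0^0 A_0 + ω_0^i A_i`,
`dA_n = ω_n^0 A_0 + ω_n^i A_i` and `ω_i^n = λ_ij ω_0^j`, where `ω_i^n = - g_ij ω_n^j`. -/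
def IsFundamentalPair (X Y : N → V n) (q : N) (g lam : Matrix (Fin (n - 1)) (Fin (n - 1)) ℝ) :
    Prop :=
  ∃ (A : Fin (n - 1) → V n) (ω₀ ωₙ : Fin (n - 1) → TangentSpace 𝓘(ℝ, E n) q →ₗ[ℝ] ℝ),
    (∀ i, lor n (A i) (X q) = 0) ∧
    Submodule.span ℝ {Y q} ⊔ Submodule.span ℝ (Set.range A) =
      Submodule.span ℝ {Y q} ⊔
        LinearMap.range (dif Y q : TangentSpace 𝓘(ℝ, E n) q →ₗ[ℝ] V n) ∧
    (∀ v, dif Y q v - ∑ i, ω₀ i v • A i ∈ Submodule.span ℝ {Y q}) ∧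
    (∀ v, dif X q v - ∑ i, ωₙ i v • A i ∈ Submodule.span ℝ {Y q}) ∧
    (∀ i j, g i j = lor n (A i) (A j)) ∧
    (∀ i v, -∑ j, g i j * ωₙ j v = ∑ j, lam i j * ω₀ j v)

/-- The polynomial `det (λ_ij - s g_ij)` in `s`. -/
def charPolynomial (g lam : Matrix (Fin (n - 1)) (Fin (n - 1)) ℝ) : Polynomial ℝ :=
  (lam.map Polynomial.C - (Polynomial.X : Polynomial ℝ) • g.map Polynomial.C).det

/-- The point `z = A_n + s A_0` of the generator through `x q`, where `s` is a root of multiplicity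
`m` of the characteristic equation `det (λ_ij - s g_ij) = 0`. -/
def HasMultiplicity (x y : N → ℙ ℝ (V n)) (q : N) (z : ℙ ℝ (V n)) (m : ℕ) : Prop :=
  ∃ (W : Set N) (X Y : N → V n) (s : ℝ) (g lam : Matrix (Fin (n - 1)) (Fin (n - 1)) ℝ),
    q ∈ W ∧ IsFrame x y W X Y ∧ IsFundamentalPair X Y q g lam ∧
    z.submodule = Submodule.span ℝ {X q + s • Y q} ∧
    (charPolynomial g lam).rootMultiplicity s = m

/-- `b` is a continuous field of foci of constant multiplicity `m` over the open set `O`. -/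
def IsFocalField (x y : N → ℙ ℝ (V n)) (O : Set N) (b : N → ℙ ℝ (V n)) (m : ℕ) : Prop :=
  IsOpen O ∧ (∀ q ∈ O, HasMultiplicity x y q (b q) m) ∧
    ∀ p ∈ O, ∃ (W : Set N) (X Y : N → V n) (s : N → ℝ), p ∈ W ∧ W ⊆ O ∧ IsFrame x y W X Y ∧
      ContinuousOn s W ∧ ∀ q ∈ W, (b q).submodule = Submodule.span ℝ {X q + s q • Y q}

/-- The focus `b q` is a fold: the focal submanifold has dimension `n - 1` there and is tangent to
the generator. -/
def IsFold (x y b : N → ℙ ℝ (V n)) (q : N) : Prop :=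
  SmoothAt b q ∧ Module.finrank ℝ (tangentSubspace b q) = n ∧ generator x y q ≤ tangentSubspace b q

/-- The focus `b q` of multiplicity `m` is conic: the focal submanifold has dimension `n - m - 1`
there and is spacelike. -/
def IsConic (b : N → ℙ ℝ (V n)) (m : ℕ) (q : N) : Prop :=
  SmoothAt b q ∧ Module.finrank ℝ (tangentSubspace b q) = n - m ∧ IsSpacelike (tangentSubspace b q)

/-- The open set `O` is foliated into a `k`-parameter family of `d`-dimensional leaves whose local
pieces (plaques) have the property `P`. Here `D` is the field of tangent spaces of the leaves;
that it is the same for all foliated charts makes their plaques fit together. -/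
def IsFoliated (O : Set N) (d k : ℕ)
    (P : ((q : N) → Submodule ℝ (TangentSpace 𝓘(ℝ, E n) q)) → Set N → Prop) : Prop :=
  ∃ D : (q : N) → Submodule ℝ (TangentSpace 𝓘(ℝ, E n) q),
    ∀ p ∈ O, ∃ φ : OpenPartialHomeomorph N (E d × E k), p ∈ φ.source ∧ φ.source ⊆ O ∧
      ContMDiffOn 𝓘(ℝ, E n) 𝓘(ℝ, E d × E k) ∞ φ φ.source ∧
      ContMDiffOn 𝓘(ℝ, E d × E k) 𝓘(ℝ, E n) ∞ φ.symm φ.target ∧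
      (∃ (A : Set (E d)) (B : Set (E k)), IsPreconnected A ∧ IsPreconnected B ∧
        φ.target = A ×ˢ B) ∧
      (∀ q ∈ φ.source, D q = (mfderiv 𝓘(ℝ, E n) 𝓘(ℝ, E k) (fun r => (φ r).2) q).ker) ∧
      ∀ q ∈ φ.source, P D {r | r ∈ φ.source ∧ (φ r).2 = (φ q).2}

/-- The generators through the points of `S` form a torse: they are the tangent lines of a regular
curve `γ` (the edge of regression), and they touch it at the points `b q`. -/
def IsTorse (x y b : N → ℙ ℝ (V n)) (S : Set N) : Prop :=
  ∃ (γ : ℝ → V n) (J : Set ℝ) (τ : N → ℝ), IsOpen J ∧ J.OrdConnected ∧ ContDiffOn ℝ ∞ γ J ∧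
    (∀ t ∈ J, LinearIndependent ℝ ![γ t, deriv γ t]) ∧
    ContinuousOn τ S ∧ τ '' S = J ∧
    ∀ q ∈ S, (b q).submodule = Submodule.span ℝ {γ (τ q)} ∧
      generator x y q = Submodule.span ℝ {γ (τ q), deriv γ (τ q)}

/-- The generators through the points of `S` lie on one `d`-dimensional second-order cone, whose
vertex is the common value of `b` on `S`. -/
def IsConePiece (x y b : N → ℙ ℝ (V n)) (d : ℕ) (S : Set N) : Prop :=
  ∃ (z : ℙ ℝ (V n)) (C : Set (V n)), IsSecondOrderCone d z C ∧
    ∀ q ∈ S, b q = z ∧ (generator x y q : Set (V n)) ⊆ C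

/-- The submanifold of `Cⁿ = Qⁿ` described by the points `y q`, `q ∈ O`, is an `m`-canal
hypersurface: it envelops the `(n - m - 1)`-parameter family of the hyperspheres
`Qⁿ ∩ polar (c q)`, and it carries a family, depending on the same parameters, of `m`-dimensional
spherical generators, along each of which it touches one hypersphere of the family. -/
def IsCanal (y c : N → ℙ ℝ (V n)) (O : Set N) (m : ℕ) : Prop :=
  (∀ q ∈ O, SmoothAt c q ∧ c q ∈ deSitter n ∧
    Module.finrank ℝ (tangentSubspace c q) = n - m) ∧
  (∀ q ∈ O, tangentSubspace y q ≤ polar (c q)) ∧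
  IsFoliated O (m + 1) (n - m - 1) (fun D S =>
    (∃ (z : ℙ ℝ (V n)) (L : Submodule ℝ (V n)), L ≤ polar z ∧ Module.finrank ℝ L = m + 2 ∧
      IsLorentzian L ∧ ∀ q ∈ S, c q = z ∧ (y q).submodule ≤ L) ∧
    ∀ q ∈ S, Module.finrank ℝ (tangentAlong y q (D q)) = m + 1)

end DeSitter

end

noncomputable section

set_option linter.unusedSectionVars false

namespace DeSitter

/-! ### The form of signature (n + 1, 1) and its null vectors. -/

section Lorentz

variable {n : ℕ}

/-! Pointwise part. At a point put x = A_n, y = A_0 and let P, Q be their differentials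
(`IsFramePoint`). The form is positive semidefinite on the polar hyperplane of y, and its null
vectors there are multiples of y. P is an isomorphism of the tangent space onto {x, y}^⊥. Q is onto
the same space modulo y, and it maps exactly one direction into the line of y: the direction e of
the generator, with P e = y. Differentiating (dx, y) = 0 shows that (P v, Q w) is symmetric in v and
w. So the pencil λ - s g is symmetric with g positive definite, and it is diagonalized
simultaneously: it has n - 1 real roots, with equal algebraic and geometric multiplicities. In
invariant terms, x + s y has multiplicity m iff K = {v : P v + s Q v is a multiple of y}
(`focalKer`) has dimension m + 1, and it is singular iff dim K ≥ 2. Moreover (x + s y, x + s y) = 1,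
so every focus lies in the de Sitter space.

Fields of foci. A root of constant multiplicity m is a simple root of the derivative of order m - 1
of the characteristic polynomial, so a continuous field is smooth by the implicit function theorem.
Write B = x + s y for the focus. Modulo y its differential is P + s Q, so dB maps K into the line of
y. Either dB vanishes on K, and then B is conic: its kernel is K, its rank is n - m - 1, and no null
vector is tangent to it. Or y lies in the range of dB, the rank is n - m, and for m = 1 this is a
fold (`IsFocalFrame.conic_or`). Since the rank is lower semicontinuous, being non-conic is an open
condition.

Multiple foci (`IsFocalFrame.isConic`). If B is not conic at a point, its rank is n - m nearby and
its fibres have dimension m. Along a fibre the tangent subspace of the focal submanifold does not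
change; it contains only one isotropic direction, that of y. So y is fixed along the fibre. But y is
fixed in only one direction, so m ≤ 1.

Foliations. In the conic case the leaves are the fibres of B. On a leaf both B and the tangent
subspace T of the focal submanifold are constant, and y stays in the Lorentzian subspace T^⊥ of
dimension m + 2. This gives at once the cone with vertex B and the spherical generator of the canal
hypersurface. In the fold case the isotropic direction of y descends to a nowhere zero vector field
on the focal submanifold. Its integral curves have the generators as tangent lines, and a flow box
turns them into a foliation by torses (`exists_torse_chart`). The analysis rests on the constant
rank theorem (`exists_constant_rank_chart`) and on smooth local flows (`exists_smooth_local_flow`);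
the latter come from the inverse function theorem in a space of curves. -/

theorem lor_apply (v w : V n) :
    lor n v w = (∑ i : Fin (n + 1), v i.castSucc * w i.castSucc)
      - v (Fin.last (n + 1)) * w (Fin.last (n + 1)) := rfl

theorem lor_comm (v w : V n) : lor n v w = lor n w v := by
  simp only [lor_apply, mul_comm]

theorem lor_isRefl : (lor n).IsRefl := fun v w h => by rw [lor_comm, h]

theorem eq_zero_of_lor_eq_zero {v : V n} (h : ∀ w, lor n v w = 0) : v = 0 := by
  ext i
  refine Fin.lastCases ?_ (fun j => ?_) i
  · have := h (EuclideanSpace.single (Fin.last (n + 1)) 1)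
    simpa [lor_apply, Fin.castSucc_ne_last] using this
  · have := h (EuclideanSpace.single j.castSucc 1)
    simpa [lor_apply, Fin.castSucc_ne_last, (Fin.castSucc_ne_last j).symm] using this

theorem lor_nondegenerate : (lor n).Nondegenerate :=
  ⟨fun _ h => eq_zero_of_lor_eq_zero h,
    fun _ h => eq_zero_of_lor_eq_zero fun w => (lor_comm _ _).trans (h w)⟩

theorem finrank_V : Module.finrank ℝ (V n) = n + 2 := by simp

theorem finrank_lor_orthogonal (S : Submodule ℝ (V n)) :
    Module.finrank ℝ ((lor n).orthogonal S) + Module.finrank ℝ S = n + 2 := by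
  have h1 := LinearMap.BilinForm.finrank_orthogonal lor_nondegenerate S
  have h2 := Submodule.finrank_le S
  rw [finrank_V] at h1 h2
  omega

/-- If the last coordinate vanished, the square of Y would be a sum of squares equal to zero. -/
theorem lor_last_ne_zero {Y : V n} (hY : lor n Y Y = 0) (h0 : Y ≠ 0) :
    Y (Fin.last (n + 1)) ≠ 0 := by
  intro h
  apply h0
  rw [lor_apply, h, mul_zero, sub_zero,
    Finset.sum_eq_zero_iff_of_nonneg fun i _ => mul_self_nonneg _] at hY
  ext i
  refine Fin.lastCases h (fun j => ?_) i
  simpa using hY j (Finset.mem_univ j)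

/-- Inside the polar hyperplane of a null vector, adding multiples of that vector is invisible to
the form. This freedom is used to remove the last coordinate. -/
theorem lor_smul_add (c : ℝ) {Y w : V n} (hY : lor n Y Y = 0) (hw : lor n Y w = 0) :
    lor n (w + c • Y) (w + c • Y) = lor n w w := by
  simp [hY, hw, lor_comm w Y]

/-- The scalar product is nonnegative on the polar hyperplane of a point of the absolute. -/
theorem lor_self_nonneg {Y w : V n} (hY : lor n Y Y = 0) (h0 : Y ≠ 0) (hw : lor n Y w = 0) :
    0 ≤ lor n w w := by
  have hl := lor_last_ne_zero hY h0
  -- The multiple of Y is the one that cancels the last coordinate of w, which leaves a sum of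
  -- squares.
  rw [← lor_smul_add (-(w (Fin.last (n + 1)) / Y (Fin.last (n + 1)))) hY hw, lor_apply]
  have : (w + (-(w (Fin.last (n + 1)) / Y (Fin.last (n + 1)))) • Y) (Fin.last (n + 1)) = 0 := by
    simp [hl]
  rw [this, mul_zero, sub_zero]
  exact Finset.sum_nonneg fun i _ => mul_self_nonneg _

/-- A null vector of the polar hyperplane of a point of the absolute is a multiple of it. -/
theorem mem_span_of_lor_self_eq_zero {Y w : V n} (hY : lor n Y Y = 0) (h0 : Y ≠ 0)
    (hw : lor n Y w = 0) (hww : lor n w w = 0) : w ∈ Submodule.span ℝ {Y} := by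
  have hl := lor_last_ne_zero hY h0
  set c := -(w (Fin.last (n + 1)) / Y (Fin.last (n + 1))) with hc
  have h1 : lor n (w + c • Y) (w + c • Y) = 0 := by rw [lor_smul_add c hY hw, hww]
  have h2 : (w + c • Y) (Fin.last (n + 1)) = 0 := by simp [hc, hl]
  have h3 : w + c • Y = 0 := by
    by_contra h
    exact lor_last_ne_zero h1 h h2
  rw [Submodule.mem_span_singleton]
  exact ⟨-c, by rw [neg_smul]; exact (eq_neg_of_add_eq_zero_left h3).symm⟩

theorem lor_eq_zero_of_mem_span {Y w v : V n} (hw : w ∈ Submodule.span ℝ {Y})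
    (hv : lor n v Y = 0) : lor n v w = 0 := by
  obtain ⟨c, rfl⟩ := Submodule.mem_span_singleton.1 hw
  simp [hv]

end Lorentz

/-! ### Dimension counts for joins and ranges. -/

section LinearAlgebra

variable {T F : Type*} [AddCommGroup T] [Module ℝ T] [FiniteDimensional ℝ T]
  [AddCommGroup F] [Module ℝ F] [FiniteDimensional ℝ F]

/-- The dimension of the join of a subspace and the range of a linear map. -/
theorem finrank_sup_range (S : Submodule ℝ F) (L : T →ₗ[ℝ] F) :
    Module.finrank ℝ ↥(S ⊔ LinearMap.range L) + Module.finrank ℝ (S.comap L) =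
      Module.finrank ℝ S + Module.finrank ℝ T := by
  have h1 := LinearMap.finrank_range_add_finrank_ker (S.mkQ ∘ₗ L)
  have h2 := LinearMap.finrank_range_add_finrank_ker
    (S.mkQ ∘ₗ (S ⊔ LinearMap.range L).subtype)
  rw [LinearMap.ker_comp, Submodule.ker_mkQ] at h1 h2
  have h3 : LinearMap.range (S.mkQ ∘ₗ (S ⊔ LinearMap.range L).subtype) =
      LinearMap.range (S.mkQ ∘ₗ L) := by
    rw [LinearMap.range_comp, LinearMap.range_comp, Submodule.range_subtype, Submodule.map_sup]
    simp
  have h4 : Module.finrank ℝ (S.comap (S ⊔ LinearMap.range L).subtype) = Module.finrank ℝ S :=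
    (Submodule.comapSubtypeEquivOfLe (p := S) le_sup_left).finrank_eq
  rw [h3, h4] at h2
  omega

theorem finrank_sup_map (S : Submodule ℝ F) (L : T →ₗ[ℝ] F) (D : Submodule ℝ T) :
    Module.finrank ℝ ↥(S ⊔ D.map L) + Module.finrank ℝ ↥(D ⊓ S.comap L) =
      Module.finrank ℝ S + Module.finrank ℝ D := by
  have h := finrank_sup_range S (L ∘ₗ D.subtype)
  rw [LinearMap.range_comp, Submodule.range_subtype] at h
  have h1 : D ⊓ S.comap L = (S.comap (L ∘ₗ D.subtype)).map D.subtype := by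
    rw [Submodule.comap_comp, Submodule.map_comap_subtype]
  rw [h1, Submodule.finrank_map_subtype_eq]
  exact h

theorem finrank_span_pair {v w : F} (h : LinearIndependent ℝ ![v, w]) :
    Module.finrank ℝ (Submodule.span ℝ {v, w}) = 2 := by
  have := finrank_span_eq_card h
  rwa [Matrix.range_cons, Matrix.range_cons, Matrix.range_empty, Set.union_empty,
    Set.singleton_union] at this

/-- A linear map to `ℝᵏ` that is injective on a `k`-dimensional subspace. -/
theorem exists_injOn_subspace {k : ℕ} (R : Submodule ℝ F) (hR : Module.finrank ℝ R = k) :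
    ∃ π : F →ₗ[ℝ] E k, ∀ r ∈ R, π r = 0 → r = 0 := by
  obtain ⟨π, hπ⟩ := R.subtype.exists_leftInverse_of_injective R.ker_subtype
  have e : R ≃ₗ[ℝ] E k := LinearEquiv.ofFinrankEq _ _ (by simpa using hR)
  refine ⟨e.toLinearMap ∘ₗ π, fun r hr h => ?_⟩
  have h1 : π r = ⟨r, hr⟩ := LinearMap.congr_fun hπ ⟨r, hr⟩
  have h2 : π r = 0 := e.map_eq_zero_iff.1 h
  exact congrArg Subtype.val (h1.symm.trans h2)

end LinearAlgebra

/-! ### Linear algebra of a frame at one point. -/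

section PointData

variable {n : ℕ} {T : Type*} [AddCommGroup T] [Module ℝ T]

/-- The vertices `x = A_n`, `y = A_0` of a moving frame at a point, and their differentials. -/
structure IsFramePoint (x y : V n) (P Q : T →ₗ[ℝ] V n) : Prop where
  finrank_eq : Module.finrank ℝ T = n
  xx : lor n x x = 1
  yy : lor n y y = 0
  y_ne : y ≠ 0
  xy : lor n x y = 0
  xP : ∀ v, lor n x (P v) = 0
  yP : ∀ v, lor n y (P v) = 0
  xQ : ∀ v, lor n x (Q v) = 0
  yQ : ∀ v, lor n y (Q v) = 0
  symm : ∀ v w, lor n (P v) (Q w) = lor n (P w) (Q v)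
  injP : Function.Injective P
  finrank_Q : Module.finrank ℝ ↥(Submodule.span ℝ {y} ⊔ LinearMap.range Q) = n

/-- The directions in which the point `x + s y` is displaced along the generator. -/
def focalKer (y : V n) (P Q : T →ₗ[ℝ] V n) (s : ℝ) : Submodule ℝ T :=
  (Submodule.span ℝ {y}).comap (P + s • Q)

theorem mem_focalKer {y : V n} {P Q : T →ₗ[ℝ] V n} {s : ℝ} {v : T} :
    v ∈ focalKer y P Q s ↔ P v + s • Q v ∈ Submodule.span ℝ {y} := Iff.rfl

namespace IsFramePoint

variable {x y : V n} {P Q : T →ₗ[ℝ] V n} [FiniteDimensional ℝ T]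

theorem linearIndependent (h : IsFramePoint x y P Q) : LinearIndependent ℝ ![x, y] := by
  rw [LinearIndependent.pair_iff]
  intro a b hab
  have h1 := congrArg (lor n x) hab
  have ha : a = 0 := by simpa [h.xx, h.xy] using h1
  subst ha
  simpa [h.y_ne] using hab

theorem mem_span_y_of_mem_span_pair (h : IsFramePoint x y P Q) {w : V n}
    (hw : w ∈ Submodule.span ℝ {x, y}) (hx : lor n x w = 0) : w ∈ Submodule.span ℝ {y} := by
  obtain ⟨a, b, rfl⟩ := Submodule.mem_span_pair.1 hw
  have ha : a = 0 := by simpa [h.xx, h.xy] using hx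
  subst ha
  simpa using Submodule.smul_mem _ b (Submodule.mem_span_singleton_self y)

theorem mem_span_pair_iff (h : IsFramePoint x y P Q) {w : V n} (hx : lor n x w = 0) :
    w ∈ Submodule.span ℝ {x, y} ↔ w ∈ Submodule.span ℝ {y} :=
  ⟨fun hw => h.mem_span_y_of_mem_span_pair hw hx,
    fun hw => Submodule.span_mono (by simp) hw⟩

theorem finrank_orthogonal (h : IsFramePoint x y P Q) :
    Module.finrank ℝ ((lor n).orthogonal (Submodule.span ℝ {x, y})) = n := by
  have := finrank_lor_orthogonal (Submodule.span ℝ {x, y})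
  rw [finrank_span_pair h.linearIndependent] at this
  omega

theorem mem_orthogonal_pair {w : V n} :
    w ∈ (lor n).orthogonal (Submodule.span ℝ {x, y}) ↔ lor n x w = 0 ∧ lor n y w = 0 := by
  constructor
  · intro hw
    exact ⟨hw x (Submodule.subset_span (by simp)), hw y (Submodule.subset_span (by simp))⟩
  · rintro ⟨h1, h2⟩ v hv
    obtain ⟨a, b, rfl⟩ := Submodule.mem_span_pair.1 hv
    change lor n (a • x + b • y) w = 0
    simp [h1, h2]

/-- P is injective on an n-dimensional space with values in the n-dimensional space {x, y}^⊥, so it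
fills that space. -/
theorem exists_P_eq (h : IsFramePoint x y P Q) {w : V n} (h1 : lor n x w = 0)
    (h2 : lor n y w = 0) : ∃ v, P v = w := by
  have hle : LinearMap.range P ≤ (lor n).orthogonal (Submodule.span ℝ {x, y}) := by
    rintro _ ⟨v, rfl⟩
    exact mem_orthogonal_pair.2 ⟨h.xP v, h.yP v⟩
  have heq := Submodule.eq_of_le_of_finrank_eq hle (by
    rw [LinearMap.finrank_range_of_inj h.injP, h.finrank_eq, h.finrank_orthogonal])
  have : w ∈ LinearMap.range P := heq ▸ mem_orthogonal_pair.2 ⟨h1, h2⟩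
  exact this

/-- Maximal rank makes the tangent subspace of the locus of y n-dimensional, hence equal to {x,
y}^⊥. -/
theorem mem_sup_range_Q (h : IsFramePoint x y P Q) {w : V n} (h1 : lor n x w = 0)
    (h2 : lor n y w = 0) : w ∈ Submodule.span ℝ {y} ⊔ LinearMap.range Q := by
  have hle : Submodule.span ℝ {y} ⊔ LinearMap.range Q ≤
      (lor n).orthogonal (Submodule.span ℝ {x, y}) := by
    refine sup_le ?_ ?_
    · rw [Submodule.span_singleton_le_iff_mem]
      exact mem_orthogonal_pair.2 ⟨h.xy, h.yy⟩
    rintro _ ⟨v, rfl⟩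
    exact mem_orthogonal_pair.2 ⟨h.xQ v, h.yQ v⟩
  have heq := Submodule.eq_of_le_of_finrank_eq hle (by rw [h.finrank_Q, h.finrank_orthogonal])
  exact heq ▸ mem_orthogonal_pair.2 ⟨h1, h2⟩

theorem mem_span_of_null (h : IsFramePoint x y P Q) {w : V n} (h2 : lor n y w = 0)
    (hw : lor n w w = 0) : w ∈ Submodule.span ℝ {y} :=
  mem_span_of_lor_self_eq_zero h.yy h.y_ne h2 hw

/-- The contact point depends on n - 1 parameters, so exactly one direction leaves it fixed. -/
theorem finrank_comap_Q (h : IsFramePoint x y P Q) :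
    Module.finrank ℝ ((Submodule.span ℝ {y}).comap Q) = 1 := by
  have := finrank_sup_range (Submodule.span ℝ {y}) Q
  rw [h.finrank_Q, finrank_span_singleton h.y_ne, h.finrank_eq] at this
  omega

/-- The direction of the generator. -/
theorem exists_generatorDir (h : IsFramePoint x y P Q) :
    ∃ e : T, e ≠ 0 ∧ P e = y ∧ Q e ∈ Submodule.span ℝ {y} ∧
      (Submodule.span ℝ {y}).comap Q = Submodule.span ℝ {e} := by
  obtain ⟨e, he⟩ := h.exists_P_eq h.xy h.yy
  have he0 : e ≠ 0 := by
    rintro rfl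
    exact h.y_ne (by rw [← he, map_zero])
  -- Write Q e = P u. By symmetry (Q e, Q e) = (P u, Q e) = (P e, Q u) = (y, Q u) = 0, and a null
  -- vector orthogonal to y is a multiple of y.
  have hQe : Q e ∈ Submodule.span ℝ {y} := by
    obtain ⟨u, hu⟩ := h.exists_P_eq (h.xQ e) (h.yQ e)
    refine h.mem_span_of_null (h.yQ e) ?_
    nth_rewrite 1 [← hu]
    rw [h.symm, he, h.yQ]
  refine ⟨e, he0, he, hQe, (Submodule.eq_of_le_of_finrank_eq ?_ ?_).symm⟩
  · rw [Submodule.span_singleton_le_iff_mem]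
    exact hQe
  · rw [finrank_span_singleton he0, h.finrank_comap_Q]

/-- The generator direction displaces every point x + s y along the generator. This is the extra
dimension in dim K = m + 1. -/
theorem comap_Q_le_focalKer (h : IsFramePoint x y P Q) (s : ℝ) :
    (Submodule.span ℝ {y}).comap Q ≤ focalKer y P Q s := by
  obtain ⟨e, -, he, hQe, heq⟩ := h.exists_generatorDir
  rw [heq, Submodule.span_singleton_le_iff_mem, mem_focalKer, he]
  exact add_mem (Submodule.mem_span_singleton_self y) (Submodule.smul_mem _ _ hQe)

theorem comap_span_pair (h : IsFramePoint x y P Q) {L : T →ₗ[ℝ] V n} (hL : ∀ v, lor n x (L v) = 0) :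
    (Submodule.span ℝ {x, y}).comap L = (Submodule.span ℝ {y}).comap L := by
  ext v
  exact h.mem_span_pair_iff (hL v)

/-- Turns the definition of a focus into a condition on K: the tangent subspace drops below n + 1
exactly when dim K ≥ 2. -/
theorem finrank_singular (h : IsFramePoint x y P Q) (s : ℝ) :
    Module.finrank ℝ ↥(Submodule.span ℝ {x, y} ⊔ LinearMap.range (P + s • Q)) +
      Module.finrank ℝ (focalKer y P Q s) = n + 2 := by
  have := finrank_sup_range (Submodule.span ℝ {x, y}) (P + s • Q)
  rw [h.comap_span_pair (fun v => by simp [h.xP, h.xQ]), finrank_span_pair h.linearIndependent,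
    h.finrank_eq] at this
  rw [focalKer]
  omega

/-- The contact point y itself is never a focus; this is the case α = 0 in the definition of a
singular point. -/
theorem finrank_nonsingular_Q (h : IsFramePoint x y P Q) {β : ℝ} (hβ : β ≠ 0) :
    Module.finrank ℝ ↥(Submodule.span ℝ {x, y} ⊔ LinearMap.range (β • Q)) = n + 1 := by
  have := finrank_sup_range (Submodule.span ℝ {x, y}) Q
  rw [h.comap_span_pair h.xQ, finrank_span_pair h.linearIndependent, h.finrank_comap_Q,
    h.finrank_eq] at this
  rw [LinearMap.range_smul _ _ hβ]
  omega

/-- y moves along K with one dimension lost to the generator direction, and its own line restores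
that dimension. Applied to the leaves of a canal hypersurface. -/
theorem finrank_tangent_y (h : IsFramePoint x y P Q) {K : Submodule ℝ T}
    (hK : (Submodule.span ℝ {y}).comap Q ≤ K) :
    Module.finrank ℝ ↥(Submodule.span ℝ {y} ⊔ K.map Q) = Module.finrank ℝ K := by
  have := finrank_sup_map (Submodule.span ℝ {y}) Q K
  rw [inf_eq_right.2 hK, h.finrank_comap_Q, finrank_span_singleton h.y_ne] at this
  omega

/-! ### The differential L of a focus, known only modulo y. -/

section Focus

variable {s : ℝ} {L : T →ₗ[ℝ] V n}

/-- The directions in which the differential `L` of the point `x + s y` moves it along `y`. -/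
theorem comap_span_y (hL : ∀ v, L v - (P v + s • Q v) ∈ Submodule.span ℝ {y}) :
    (Submodule.span ℝ {y}).comap L = focalKer y P Q s := by
  ext v
  rw [Submodule.mem_comap, mem_focalKer]
  constructor
  · intro hv
    simpa using sub_mem hv (hL v)
  · intro hv
    simpa using add_mem hv (hL v)

theorem x_focus (h : IsFramePoint x y P Q)
    (hL : ∀ v, L v - (P v + s • Q v) ∈ Submodule.span ℝ {y}) (v : T) : lor n x (L v) = 0 := by
  have := lor_eq_zero_of_mem_span (hL v) h.xy
  simpa [h.xP, h.xQ] using this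

theorem y_focus (h : IsFramePoint x y P Q)
    (hL : ∀ v, L v - (P v + s • Q v) ∈ Submodule.span ℝ {y}) (v : T) : lor n y (L v) = 0 := by
  have := lor_eq_zero_of_mem_span (hL v) h.yy
  simpa [h.yP, h.yQ] using this

theorem comap_span_pair_focus (h : IsFramePoint x y P Q)
    (hL : ∀ v, L v - (P v + s • Q v) ∈ Submodule.span ℝ {y}) :
    (Submodule.span ℝ {x, y}).comap L = focalKer y P Q s := by
  rw [h.comap_span_pair (h.x_focus hL), comap_span_y hL]

theorem lor_focus (h : IsFramePoint x y P Q) :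
    lor n (x + s • y) (x + s • y) = 1 := by
  simp [h.xx, h.xy, h.yy, lor_comm y x]

theorem focus_ne_zero (h : IsFramePoint x y P Q) : x + s • y ≠ 0 := by
  intro h0
  have := h.lor_focus (s := s)
  simp [h0] at this

theorem linearIndependent_focus (h : IsFramePoint x y P Q) :
    LinearIndependent ℝ ![x + s • y, y] := by
  rw [LinearIndependent.pair_iff]
  intro a b hab
  have h1 : a • x + (a * s + b) • y = 0 := by
    rw [← hab]
    module
  obtain ⟨ha, hb⟩ := LinearIndependent.pair_iff.1 h.linearIndependent _ _ h1
  subst ha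
  simpa using hb

theorem lor_focus_range (h : IsFramePoint x y P Q)
    (hL : ∀ v, L v - (P v + s • Q v) ∈ Submodule.span ℝ {y}) (v : T) :
    lor n (x + s • y) (L v) = 0 := by
  simp [h.x_focus hL, h.y_focus hL]

/-- The values of L are orthogonal to the unit vector x + s y, so the join is direct. -/
theorem finrank_tangent_focus (h : IsFramePoint x y P Q)
    (hL : ∀ v, L v - (P v + s • Q v) ∈ Submodule.span ℝ {y}) :
    Module.finrank ℝ ↥(Submodule.span ℝ {x + s • y} ⊔ LinearMap.range L) =
      1 + Module.finrank ℝ (LinearMap.range L) := by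
  have h1 := finrank_sup_range (Submodule.span ℝ {x + s • y}) L
  have h2 := LinearMap.finrank_range_add_finrank_ker L
  have h3 : (Submodule.span ℝ {x + s • y}).comap L = LinearMap.ker L := by
    ext v
    rw [Submodule.mem_comap, LinearMap.mem_ker]
    constructor
    · intro hv
      obtain ⟨c, hc⟩ := Submodule.mem_span_singleton.1 hv
      have h4 := h.lor_focus_range hL v
      rw [← hc, map_smul, h.lor_focus] at h4
      simp only [smul_eq_mul, mul_one] at h4
      rw [← hc, h4, zero_smul]
    · intro hv
      rw [hv]
      exact zero_mem _
  rw [h3, finrank_span_singleton h.focus_ne_zero] at h1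
  omega

theorem ker_eq_of_conic
    (hL : ∀ v, L v - (P v + s • Q v) ∈ Submodule.span ℝ {y})
    (hK : ∀ v ∈ focalKer y P Q s, L v = 0) : LinearMap.ker L = focalKer y P Q s := by
  apply le_antisymm
  · intro v hv
    rw [← comap_span_y hL, Submodule.mem_comap, LinearMap.mem_ker.1 hv]
    exact zero_mem _
  · exact hK

theorem finrank_range_of_conic (h : IsFramePoint x y P Q)
    (hL : ∀ v, L v - (P v + s • Q v) ∈ Submodule.span ℝ {y})
    (hK : ∀ v ∈ focalKer y P Q s, L v = 0) :
    Module.finrank ℝ (LinearMap.range L) + Module.finrank ℝ (focalKer y P Q s) = n := by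
  rw [← ker_eq_of_conic hL hK, LinearMap.finrank_range_add_finrank_ker, h.finrank_eq]

/-- The range of L lies in the polar hyperplane of y, where the form is semidefinite. A null value L
v is a multiple of y, so v is in K and L v = 0; the orthogonal unit vector x + s y adds a positive
square. -/
theorem isSpacelike_of_conic (h : IsFramePoint x y P Q)
    (hL : ∀ v, L v - (P v + s • Q v) ∈ Submodule.span ℝ {y})
    (hK : ∀ v ∈ focalKer y P Q s, L v = 0) :
    IsSpacelike (Submodule.span ℝ {x + s • y} ⊔ LinearMap.range L) := by
  intro w hw h0
  obtain ⟨b, hb, _, ⟨v, rfl⟩, rfl⟩ := Submodule.mem_sup.1 hw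
  obtain ⟨a, rfl⟩ := Submodule.mem_span_singleton.1 hb
  have h1 : lor n (a • (x + s • y) + L v) (a • (x + s • y) + L v) =
      a ^ 2 + lor n (L v) (L v) := by
    have e1 := h.lor_focus (s := s)
    have e2 := h.lor_focus_range hL v
    have e3 := lor_comm (L v) (x + s • y)
    generalize x + s • y = b at *
    simp only [map_add, map_smul, LinearMap.add_apply, LinearMap.smul_apply, e1, e2, e3,
      smul_eq_mul]
    ring
  have h2 := lor_self_nonneg h.yy h.y_ne (h.y_focus hL v)
  rw [h1]
  rcases h2.lt_or_eq with h3 | h3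
  · positivity
  · have h4 := h.mem_span_of_null (h.y_focus hL v) h3.symm
    have h5 : L v = 0 := hK v (by rw [← comap_span_y hL]; exact h4)
    have ha : a ≠ 0 := by
      rintro rfl
      simp [h5] at h0
    rw [← h3]
    positivity

/-- L maps K into the line of y, so a single nonzero value there already reaches y. -/
theorem y_mem_range_of_not_conic (hL : ∀ v, L v - (P v + s • Q v) ∈ Submodule.span ℝ {y})
    {v : T} (hv : v ∈ focalKer y P Q s) (h0 : L v ≠ 0) : y ∈ LinearMap.range L := by
  rw [← comap_span_y hL] at hv
  obtain ⟨c, hc⟩ := Submodule.mem_span_singleton.1 hv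
  have hc0 : c ≠ 0 := by
    rintro rfl
    exact h0 (by simpa using hc.symm)
  exact ⟨c⁻¹ • v, by rw [map_smul, ← hc, smul_smul, inv_mul_cancel₀ hc0, one_smul]⟩

/-- Modulo y the rank of L is n - dim K; when y lies in the range, it contributes one more. -/
theorem finrank_range_of_y_mem (h : IsFramePoint x y P Q)
    (hL : ∀ v, L v - (P v + s • Q v) ∈ Submodule.span ℝ {y}) (hy : y ∈ LinearMap.range L) :
    Module.finrank ℝ (LinearMap.range L) + Module.finrank ℝ (focalKer y P Q s) = n + 1 := by
  have h1 := finrank_sup_range (Submodule.span ℝ {y}) L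
  rw [comap_span_y hL, finrank_span_singleton h.y_ne, h.finrank_eq,
    sup_eq_right.2 (by rwa [Submodule.span_singleton_le_iff_mem])] at h1
  omega

end Focus

end IsFramePoint

end PointData

/-! ### Simultaneous diagonalization of two quadratic forms. -/

section Pencil

open Matrix

variable {ι : Type*} [Fintype ι] [DecidableEq ι]

theorem exists_orthogonal_diagonalization {M : Matrix ι ι ℝ} (hM : M.IsSymm) :
    ∃ (U : Matrix ι ι ℝ) (d : ι → ℝ), Uᵀ * U = 1 ∧ M = Uᵀ * diagonal d * U := by
  have hH : M.IsHermitian := by rwa [IsHermitian, conjTranspose_eq_transpose_of_trivial]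
  refine ⟨(hH.eigenvectorUnitary : Matrix ι ι ℝ)ᵀ, hH.eigenvalues, ?_, ?_⟩
  · rw [transpose_transpose]
    have := Unitary.coe_mul_star_self hH.eigenvectorUnitary
    simpa [star_eq_conjTranspose, conjTranspose_eq_transpose_of_trivial] using this
  · have := hH.spectral_theorem
    rw [Unitary.conjStarAlgAut_apply] at this
    simpa [star_eq_conjTranspose, conjTranspose_eq_transpose_of_trivial] using this

/-- Testing positivity on the eigenvectors Uᵀeᵢ shows that all eigenvalues are positive; then B = √D
U. -/
theorem exists_posDef_factorization {g : Matrix ι ι ℝ} (hg : g.IsSymm)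
    (hpos : ∀ u : ι → ℝ, u ≠ 0 → 0 < u ⬝ᵥ g *ᵥ u) :
    ∃ B : Matrix ι ι ℝ, IsUnit B.det ∧ g = Bᵀ * B := by
  obtain ⟨U, d, hU, hd⟩ := exists_orthogonal_diagonalization hg
  have hU' : U * Uᵀ = 1 := mul_eq_one_comm.1 hU
  have hdpos : ∀ i, 0 < d i := by
    intro i
    have h1 : Uᵀ *ᵥ Pi.single i 1 ≠ 0 := by
      intro h
      have h2 := congrArg (U *ᵥ ·) h
      simp only [mulVec_mulVec, hU', one_mulVec, mulVec_zero] at h2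
      simpa using congrFun h2 i
    have h2 := hpos _ h1
    have h3 : U *ᵥ Uᵀ *ᵥ Pi.single i 1 = Pi.single i (1 : ℝ) := by
      rw [mulVec_mulVec, hU', one_mulVec]
    rw [hd, ← mulVec_mulVec, h3, ← mulVec_mulVec, dotProduct_mulVec, vecMul_transpose, h3] at h2
    simpa [mulVec_diagonal] using h2
  refine ⟨diagonal (fun i => Real.sqrt (d i)) * U, ?_, ?_⟩
  · rw [det_mul, det_diagonal]
    refine IsUnit.mul ?_ ?_
    · exact (Finset.prod_ne_zero_iff.2 fun i _ => (Real.sqrt_pos.2 (hdpos i)).ne').isUnit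
    · exact (Matrix.isUnit_iff_isUnit_det U).1 (IsUnit.of_mul_eq_one _ hU')
  · rw [transpose_mul, diagonal_transpose, Matrix.mul_assoc, ← Matrix.mul_assoc (diagonal _),
      diagonal_mul_diagonal, hd, Matrix.mul_assoc]
    congr 3
    ext i
    simp [Real.mul_self_sqrt (hdpos i).le]

/-- With g = BᵀB, change coordinates by B⁻¹ so that g becomes the identity, then rotate by an
orthogonal matrix that diagonalizes the transformed λ. -/
theorem exists_simultaneous_diagonalization {g lam : Matrix ι ι ℝ} (hg : g.IsSymm)
    (hpos : ∀ u : ι → ℝ, u ≠ 0 → 0 < u ⬝ᵥ g *ᵥ u) (hl : lam.IsSymm) :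
    ∃ (R : Matrix ι ι ℝ) (d : ι → ℝ), IsUnit R.det ∧ g = Rᵀ * R ∧ lam = Rᵀ * diagonal d * R := by
  obtain ⟨B, hB, rfl⟩ := exists_posDef_factorization hg hpos
  have hM : (B⁻¹ᵀ * lam * B⁻¹).IsSymm := by
    rw [IsSymm, transpose_mul, transpose_mul, transpose_transpose, hl.eq, Matrix.mul_assoc]
  obtain ⟨U, d, hU, hd⟩ := exists_orthogonal_diagonalization hM
  have hBt : IsUnit Bᵀ.det := by rwa [det_transpose]
  refine ⟨U * B, d, ?_, ?_, ?_⟩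
  · rw [det_mul]
    exact ((Matrix.isUnit_iff_isUnit_det U).1 (IsUnit.of_mul_eq_one_right _ hU)).mul hB
  · rw [transpose_mul, Matrix.mul_assoc, ← Matrix.mul_assoc Uᵀ, hU, Matrix.one_mul]
  · have : lam = Bᵀ * (B⁻¹ᵀ * lam * B⁻¹) * B := by
      rw [transpose_nonsing_inv, Matrix.mul_assoc, Matrix.mul_assoc, Matrix.mul_assoc,
        nonsing_inv_mul B hB, Matrix.mul_one, mul_nonsing_inv_cancel_left _ _ hBt]
    rw [this, hd, transpose_mul]
    simp only [Matrix.mul_assoc]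

end Pencil

/-! ### The characteristic polynomial of the pencil. -/

section CharPolynomial

open Matrix

variable {n : ℕ} {g lam : Matrix (Fin (n - 1)) (Fin (n - 1)) ℝ}

/-- Congruence by R pulls (det R)² out of the determinant and leaves a diagonal matrix with entries
dᵢ - s. -/
theorem charPolynomial_eq_prod {R : Matrix (Fin (n - 1)) (Fin (n - 1)) ℝ} {d : Fin (n - 1) → ℝ}
    (hg : g = Rᵀ * R) (hl : lam = Rᵀ * diagonal d * R) :
    charPolynomial g lam = Polynomial.C (R.det ^ 2) *
      ∏ i, (Polynomial.C (d i) - Polynomial.X) := by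
  have h1 : lam.map Polynomial.C - (Polynomial.X : Polynomial ℝ) • g.map Polynomial.C =
      (Rᵀ.map Polynomial.C) * diagonal (fun i => Polynomial.C (d i) - Polynomial.X) *
        R.map Polynomial.C := by
    have h2 : diagonal (fun i => Polynomial.C (d i) - Polynomial.X) =
        (diagonal d).map Polynomial.C -
          (Polynomial.X : Polynomial ℝ) • (1 : Matrix (Fin (n - 1)) (Fin (n - 1)) _) := by
      rw [diagonal_map (map_zero _), ← diagonal_one, ← diagonal_smul, diagonal_sub]
      congr 1
      ext i
      simp
    rw [h2, hg, hl, Matrix.mul_sub, Matrix.sub_mul, Matrix.map_mul, Matrix.map_mul,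
      Matrix.map_mul, Matrix.mul_smul, Matrix.mul_one, Matrix.smul_mul]
  rw [charPolynomial, h1, det_mul, det_mul, det_diagonal, ← RingHom.mapMatrix_apply,
    ← RingHom.mapMatrix_apply, ← RingHom.map_det, ← RingHom.map_det, det_transpose, map_pow]
  ring

theorem rootMultiplicity_prod_C_sub_X {ι : Type*} [Fintype ι] (d : ι → ℝ) (s : ℝ) :
    (∏ i, (Polynomial.C (d i) - Polynomial.X)).rootMultiplicity s =
      Fintype.card {i // d i = s} := by
  classical
  have h1 : ∀ i, Polynomial.C (d i) - Polynomial.X ≠ 0 := fun i => by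
    rw [← neg_sub, neg_ne_zero]
    exact Polynomial.X_sub_C_ne_zero _
  rw [← Polynomial.count_roots, Polynomial.roots_prod _ _ (Finset.prod_ne_zero_iff.2 fun i _ => h1 i)]
  have h2 : ∀ i, (Polynomial.C (d i) - Polynomial.X).roots = {d i} := fun i => by
    rw [← neg_sub, Polynomial.roots_neg, Polynomial.roots_X_sub_C]
  simp only [h2, Multiset.bind_singleton]
  rw [Multiset.count_map, Fintype.card_subtype]
  simp only [eq_comm (a := s)]
  rfl

/-- For a symmetric pencil with positive definite `g`, the algebraic and geometric multiplicities
coincide, and there are `n - 1` real roots. -/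
theorem charPolynomial_ne_zero (hg : g.IsSymm)
    (hpos : ∀ u : Fin (n - 1) → ℝ, u ≠ 0 → 0 < u ⬝ᵥ g *ᵥ u) (hl : lam.IsSymm) :
    charPolynomial g lam ≠ 0 := by
  obtain ⟨R, d, hR, h1, h2⟩ := exists_simultaneous_diagonalization hg hpos hl
  rw [charPolynomial_eq_prod h1 h2]
  refine mul_ne_zero ?_ (Finset.prod_ne_zero_iff.2 fun i _ => ?_)
  · simpa using hR.ne_zero
  · rw [← neg_sub, neg_ne_zero]
    exact Polynomial.X_sub_C_ne_zero _

theorem card_roots_charPolynomial (hg : g.IsSymm)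
    (hpos : ∀ u : Fin (n - 1) → ℝ, u ≠ 0 → 0 < u ⬝ᵥ g *ᵥ u) (hl : lam.IsSymm) :
    (charPolynomial g lam).roots.card = n - 1 := by
  obtain ⟨R, d, hR, h1, h2⟩ := exists_simultaneous_diagonalization hg hpos hl
  have h0 : ∀ i, Polynomial.C (d i) - Polynomial.X ≠ 0 := fun i => by
    rw [← neg_sub, neg_ne_zero]
    exact Polynomial.X_sub_C_ne_zero _
  have h3 : ∀ i, (Polynomial.C (d i) - Polynomial.X).roots = {d i} := fun i => by
    rw [← neg_sub, Polynomial.roots_neg, Polynomial.roots_X_sub_C]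
  rw [charPolynomial_eq_prod h1 h2, Polynomial.roots_C_mul _ (pow_ne_zero 2 hR.ne_zero),
    Polynomial.roots_prod _ _ (Finset.prod_ne_zero_iff.2 fun i _ => h0 i)]
  simp [h3]

/-- Both sides count the indices with dᵢ = s: one as a root of the product, the other as the corank
of a diagonal matrix. -/
theorem rootMultiplicity_charPolynomial (hg : g.IsSymm)
    (hpos : ∀ u : Fin (n - 1) → ℝ, u ≠ 0 → 0 < u ⬝ᵥ g *ᵥ u) (hl : lam.IsSymm) (s : ℝ) :
    (charPolynomial g lam).rootMultiplicity s =
      Module.finrank ℝ (LinearMap.ker (lam - s • g).mulVecLin) := by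
  obtain ⟨R, d, hR, h1, h2⟩ := exists_simultaneous_diagonalization hg hpos hl
  have h3 : lam - s • g = Rᵀ * diagonal (fun i => d i - s) * R := by
    have : diagonal (fun i => d i - s) =
        diagonal d - s • (1 : Matrix (Fin (n - 1)) (Fin (n - 1)) ℝ) := by
      rw [← diagonal_one, ← diagonal_smul, diagonal_sub]
      congr 1
      ext i
      simp
    rw [this, h1, h2, Matrix.mul_sub, Matrix.sub_mul, Matrix.mul_smul, Matrix.mul_one,
      Matrix.smul_mul]
  have h4 : (lam - s • g).rank = Fintype.card {i // d i - s ≠ 0} := by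
    rw [h3, rank_mul_eq_left_of_isUnit_det _ _ hR,
      rank_mul_eq_right_of_isUnit_det _ _ (by rwa [det_transpose]), rank_diagonal]
  have h5 := LinearMap.finrank_range_add_finrank_ker (lam - s • g).mulVecLin
  have h6 : Fintype.card {i // d i = s} + Fintype.card {i // d i - s ≠ 0} = n - 1 := by
    have := Fintype.card_subtype_compl (fun i => d i = s)
    have h7 := Fintype.card_subtype_le (fun i => d i = s)
    simp only [Fintype.card_fin] at this h7
    simp only [sub_ne_zero]
    have h8 : Fintype.card {i // d i ≠ s} = n - 1 - Fintype.card {i // d i = s} := by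
      rw [← this]
    omega
  rw [rank] at h4
  have h7 : Module.finrank ℝ (Fin (n - 1) → ℝ) = n - 1 := by simp
  rw [h7] at h5
  have h8 : Polynomial.C (R.det ^ 2) * ∏ i, (Polynomial.C (d i) - Polynomial.X) ≠ 0 := by
    rw [← charPolynomial_eq_prod h1 h2]
    exact charPolynomial_ne_zero hg hpos hl
  rw [charPolynomial_eq_prod h1 h2, Polynomial.rootMultiplicity_mul h8,
    Polynomial.rootMultiplicity_C, zero_add, rootMultiplicity_prod_C_sub_X]
  omega

end CharPolynomial

/-! ### Inverse function theorem and restriction of charts. -/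

section InverseFunction

variable {A B : Type*} [NormedAddCommGroup A] [NormedSpace ℝ A] [CompleteSpace A]
  [NormedAddCommGroup B] [NormedSpace ℝ B]

/-- The inverse function theorem, with an inverse that is smooth on its whole domain. -/
theorem exists_smooth_inverse {f : A → B} {U : Set A} {a : A} (hU : IsOpen U) (ha : a ∈ U)
    (hf : ContDiffOn ℝ ∞ f U) {f' : A ≃L[ℝ] B} (hf' : HasFDerivAt f (f' : A →L[ℝ] B) a) :
    ∃ φ : OpenPartialHomeomorph A B, a ∈ φ.source ∧ φ.source ⊆ U ∧ (∀ x, φ x = f x) ∧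
      ContDiffOn ℝ ∞ φ.symm φ.target ∧
      ∀ x ∈ φ.source, ∃ e : A ≃L[ℝ] B, HasFDerivAt f (e : A →L[ℝ] B) x := by
  have hfa : ContDiffAt ℝ ∞ f a := hf.contDiffAt (hU.mem_nhds ha)
  let φ₀ := hfa.toOpenPartialHomeomorph f hf' (by simp)
  -- Invertibility of the derivative is an open condition. Restricting to it makes the inverse
  -- smooth at every point of its domain, not only at the image of a.
  let S : Set A := U ∩ fderiv ℝ f ⁻¹' Set.range ((↑) : (A ≃L[ℝ] B) → A →L[ℝ] B)
  have hS : IsOpen S :=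
    (hf.continuousOn_fderiv_of_isOpen hU (by simp)).isOpen_inter_preimage hU
      ContinuousLinearEquiv.isOpen
  have haS : a ∈ S := ⟨ha, f', hf'.fderiv.symm⟩
  have hd : ∀ x ∈ S, ∃ e : A ≃L[ℝ] B, HasFDerivAt f (e : A →L[ℝ] B) x := by
    rintro x ⟨hx, e, he⟩
    refine ⟨e, ?_⟩
    rw [he]
    exact ((hf.contDiffAt (hU.mem_nhds hx)).differentiableAt (by simp)).hasFDerivAt
  refine ⟨φ₀.restrOpen S hS, ?_, ?_, fun x => rfl, ?_, ?_⟩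
  · rw [OpenPartialHomeomorph.restrOpen_source]
    exact ⟨hfa.mem_toOpenPartialHomeomorph_source hf' (by simp), haS⟩
  · rw [OpenPartialHomeomorph.restrOpen_source]
    exact fun x hx => hx.2.1
  · intro w hw
    have hsrc := (φ₀.restrOpen S hS).map_target hw
    rw [OpenPartialHomeomorph.restrOpen_source] at hsrc
    obtain ⟨e, he⟩ := hd _ hsrc.2
    exact ((φ₀.restrOpen S hS).contDiffAt_symm hw he
      (hf.contDiffAt (hU.mem_nhds hsrc.2.1))).contDiffWithinAt
  · intro x hx
    rw [OpenPartialHomeomorph.restrOpen_source] at hx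
    exact hd x hx.2

/-- A local homeomorphism can be restricted so that its target becomes a given open set. -/
theorem exists_restr_target {X Y : Type*} [TopologicalSpace X] [TopologicalSpace Y]
    (φ : OpenPartialHomeomorph X Y) {S : Set Y} (hS : IsOpen S) (hsub : S ⊆ φ.target) :
    ∃ ψ : OpenPartialHomeomorph X Y, ψ.target = S ∧ ψ.source = φ.source ∩ φ ⁻¹' S ∧
      (∀ x, ψ x = φ x) ∧ ∀ y, ψ.symm y = φ.symm y := by
  refine ⟨(φ.symm.restrOpen S hS).symm, ?_, ?_, fun x => rfl, fun y => rfl⟩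
  · change (φ.symm.restrOpen S hS).source = S
    rw [OpenPartialHomeomorph.restrOpen_source]
    exact Set.inter_eq_right.2 hsub
  · ext x
    simp

end InverseFunction

/-! ### The constant rank theorem. -/

section ConstantRank

variable {F : Type*} [NormedAddCommGroup F] [NormedSpace ℝ F] [FiniteDimensional ℝ F]

/-- The constant rank theorem. -/
theorem exists_constant_rank_chart {n d k : ℕ} (hdk : d + k = n) {B : E n → F} {U : Set (E n)}
    (hU : IsOpen U) (hB : ContDiffOn ℝ ∞ B U)
    (hr : ∀ u ∈ U, Module.finrank ℝ (LinearMap.range (fderiv ℝ B u : E n →ₗ[ℝ] F)) = k)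
    {p : E n} (hp : p ∈ U) :
    ∃ (φ : OpenPartialHomeomorph (E n) (E d × E k)) (r : ℝ) (G : E k → F), 0 < r ∧
      p ∈ φ.source ∧ φ.source ⊆ U ∧ ContDiffOn ℝ ∞ φ φ.source ∧
      ContDiffOn ℝ ∞ φ.symm φ.target ∧
      φ.target = Metric.ball (φ p).1 r ×ˢ Metric.ball (φ p).2 r ∧
      ContDiffOn ℝ ∞ G (Metric.ball (φ p).2 r) ∧ (∀ u ∈ φ.source, B u = G (φ u).2) ∧
      (∃ π : F →L[ℝ] E k, ∀ u, (φ u).2 = π (B u)) ∧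
      ∀ u ∈ φ.source, Function.Surjective (fderiv ℝ (fun v => (φ v).2) u) ∧
        fderiv ℝ B u = (fderiv ℝ G (φ u).2).comp (fderiv ℝ (fun v => (φ v).2) u) ∧
        Function.Injective (fderiv ℝ G (φ u).2) := by
  have hn : Module.finrank ℝ (E n) = n := by simp
  have hBd : ∀ u ∈ U, HasFDerivAt B (fderiv ℝ B u) u := fun u hu =>
    ((hB.contDiffAt (hU.mem_nhds hu)).differentiableAt (by simp)).hasFDerivAt
  have hker : ∀ u ∈ U,
      Module.finrank ℝ (LinearMap.ker (fderiv ℝ B u : E n →ₗ[ℝ] F)) = d := by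
    intro u hu
    have h1 := LinearMap.finrank_range_add_finrank_ker (fderiv ℝ B u : E n →ₗ[ℝ] F)
    rw [hr u hu, hn] at h1
    omega
  -- π sees the range of dB at p and ρ sees its kernel, so (ρ, π ∘ B) is a local diffeomorphism at
  -- p.
  obtain ⟨π, hπ⟩ := exists_injOn_subspace _ (hr p hp)
  obtain ⟨ρ, hρ⟩ := exists_injOn_subspace _ (hker p hp)
  let πc : F →L[ℝ] E k := LinearMap.toContinuousLinearMap π
  let ρc : E n →L[ℝ] E d := LinearMap.toContinuousLinearMap ρ
  let f : E n → E d × E k := fun u => (ρc u, πc (B u))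
  have hf : ContDiffOn ℝ ∞ f U := ρc.contDiff.contDiffOn.prodMk (πc.contDiff.comp_contDiffOn hB)
  have hfd : ∀ u ∈ U, HasFDerivAt f (ρc.prod (πc.comp (fderiv ℝ B u))) u := fun u hu =>
    ρc.hasFDerivAt.prodMk (πc.hasFDerivAt.comp u (hBd u hu))
  have hinj : Function.Injective (ρc.prod (πc.comp (fderiv ℝ B p)) : E n →ₗ[ℝ] E d × E k) := by
    rw [← LinearMap.ker_eq_bot, LinearMap.ker_eq_bot']
    intro v hv
    have h1 : ρ v = 0 := congrArg Prod.fst hv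
    have h2 : π (fderiv ℝ B p v) = 0 := congrArg Prod.snd hv
    exact hρ v (hπ _ ⟨v, rfl⟩ h2) h1
  let e : E n ≃L[ℝ] E d × E k := (LinearEquiv.ofInjectiveOfFinrankEq _ hinj
    (by simp [hdk])).toContinuousLinearEquiv
  have he : (e : E n →L[ℝ] E d × E k) = ρc.prod (πc.comp (fderiv ℝ B p)) := by
    ext v <;> rfl
  obtain ⟨φ₀, hp₀, hsub₀, hφ₀, hsymm₀, hder₀⟩ :=
    exists_smooth_inverse hU hp hf (f' := e) (by rw [he]; exact hfd p hp)
  -- The target is shrunk to a product of balls, so that the slices, along which B will be constant,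
  -- are connected.
  obtain ⟨r, hr0, hball⟩ := Metric.isOpen_iff.1 φ₀.open_target (φ₀ p) (φ₀.map_source hp₀)
  rw [← Prod.mk.eta (p := φ₀ p), ← ball_prod_same] at hball
  obtain ⟨φ, htar, hsrc, hφ, hφsymm⟩ := exists_restr_target φ₀
    (Metric.isOpen_ball.prod Metric.isOpen_ball) hball
  have hφp : φ p = φ₀ p := hφ p
  have hφf : ∀ u, φ u = f u := fun u => (hφ u).trans (hφ₀ u)
  have hsubU : φ.source ⊆ U := fun u hu => hsub₀ (hsrc ▸ hu).1
  have hsymm : ContDiffOn ℝ ∞ φ.symm φ.target := by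
    refine (hsymm₀.mono (htar ▸ hball)).congr fun w _ => hφsymm w
  have hφ2 : (fun v => (φ v).2) = fun v => πc (B v) := by
    funext v
    rw [hφf]
  have hφ2d : ∀ u ∈ φ.source, fderiv ℝ (fun v => (φ v).2) u = πc.comp (fderiv ℝ B u) := by
    intro u hu
    rw [hφ2]
    exact (πc.hasFDerivAt.comp u (hBd u (hsubU hu))).fderiv
  have hequiv : ∀ u ∈ φ.source, ∃ e : E n ≃L[ℝ] E d × E k,
      (e : E n →L[ℝ] E d × E k) = ρc.prod (πc.comp (fderiv ℝ B u)) := by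
    intro u hu
    obtain ⟨e, he⟩ := hder₀ u (hsrc ▸ hu).1
    exact ⟨e, he.unique (hfd u (hsubU hu))⟩
  have hsurj : ∀ u ∈ φ.source, Function.Surjective (πc.comp (fderiv ℝ B u)) := by
    intro u hu c
    obtain ⟨e, he⟩ := hequiv u hu
    obtain ⟨v, hv⟩ := e.surjective (0, c)
    refine ⟨v, ?_⟩
    have := congrArg (fun L : E n →L[ℝ] E d × E k => (L v).2) he
    simp only [ContinuousLinearEquiv.coe_coe, hv] at this
    exact this.symm
  -- Here the constancy of the rank enters: ker dB is contained in ker(π ∘ dB), and both have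
  -- dimension d = n - k.
  have hkereq : ∀ u ∈ φ.source, ∀ v, πc (fderiv ℝ B u v) = 0 → fderiv ℝ B u v = 0 := by
    intro u hu
    have h1 := LinearMap.finrank_range_add_finrank_ker
      (πc.comp (fderiv ℝ B u) : E n →ₗ[ℝ] E k)
    rw [LinearMap.range_eq_top.2 (hsurj u hu), finrank_top, hn] at h1
    have h2 : LinearMap.ker (fderiv ℝ B u : E n →ₗ[ℝ] F) ≤
        LinearMap.ker (πc.comp (fderiv ℝ B u) : E n →ₗ[ℝ] E k) := by
      intro v hv
      have hv' : fderiv ℝ B u v = 0 := hv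
      change πc (fderiv ℝ B u v) = 0
      rw [hv', map_zero]
    have h3 := Submodule.eq_of_le_of_finrank_eq h2 (by
      rw [hker u (hsubU hu)]
      have : Module.finrank ℝ (E k) = k := by simp
      omega)
    intro v hv
    have : v ∈ LinearMap.ker (fderiv ℝ B u : E n →ₗ[ℝ] F) := h3 ▸ hv
    exact this
  let a₀ := (φ p).1
  let c₀ := (φ p).2
  have htar' : φ.target = Metric.ball a₀ r ×ˢ Metric.ball c₀ r := by
    rw [htar]
    simp only [a₀, c₀, hφp]
  let G : E k → F := fun c => B (φ.symm (a₀, c))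
  have hBsymm : ContDiffOn ℝ ∞ (fun w => B (φ.symm w)) φ.target :=
    hB.comp hsymm fun w hw => hsubU (φ.map_target hw)
  -- A displacement (v, 0) in the chart does not change the second coordinate π ∘ B, so it is killed
  -- by π ∘ dB, hence by dB. So B is constant on each slice.
  have hconst : ∀ a ∈ Metric.ball a₀ r, ∀ c ∈ Metric.ball c₀ r, B (φ.symm (a, c)) = G c := by
    intro a ha c hc
    have hder : ∀ a ∈ Metric.ball a₀ r, HasFDerivAt (fun a => B (φ.symm (a, c)))
        (0 : E d →L[ℝ] F) a := by
      intro a ha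
      have hw : (a, c) ∈ φ.target := htar' ▸ ⟨ha, hc⟩
      have hu := φ.map_target hw
      have hsd : HasFDerivAt φ.symm (fderiv ℝ φ.symm (a, c)) (a, c) :=
        ((hsymm.contDiffAt (φ.open_target.mem_nhds hw)).differentiableAt (by simp)).hasFDerivAt
      have hid : (ρc.prod (πc.comp (fderiv ℝ B (φ.symm (a, c))))).comp (fderiv ℝ φ.symm (a, c)) =
          ContinuousLinearMap.id ℝ _ := by
        have h1 := (hfd _ (hsubU hu)).comp (a, c) hsd
        have h2 : HasFDerivAt (f ∘ φ.symm) (ContinuousLinearMap.id ℝ (E d × E k)) (a, c) := by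
          refine (hasFDerivAt_id _).congr_of_eventuallyEq ?_
          filter_upwards [φ.open_target.mem_nhds hw] with w hw
          rw [Function.comp_apply, ← hφf, φ.right_inv hw, id]
        exact h1.unique h2
      have h3 := HasFDerivAt.comp (𝕜 := ℝ) a ((hBd _ (hsubU hu)).comp (a, c) hsd)
        (hasFDerivAt_prodMk_left a c)
      convert! h3 using 1
      ext1 v
      have h4 := congrArg (fun L : E d × E k →L[ℝ] E d × E k => (L (v, 0)).2) hid
      exact (hkereq _ hu _ h4).symm
    refine Metric.isOpen_ball.is_const_of_fderiv_eq_zero (𝕜 := ℝ)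
      (f := fun a => B (φ.symm (a, c)))
      (convex_ball a₀ r).isPreconnected ?_ ?_ ha (Metric.mem_ball_self hr0)
    · exact fun a ha => (hder a ha).differentiableAt.differentiableWithinAt
    · exact fun a ha => (hder a ha).fderiv
  have hG : ContDiffOn ℝ ∞ G (Metric.ball c₀ r) :=
    hBsymm.comp (contDiff_prodMk_right a₀).contDiffOn fun c hc =>
      htar' ▸ ⟨Metric.mem_ball_self hr0, hc⟩
  have hBG : ∀ u ∈ φ.source, B u = G (φ u).2 := by
    intro u hu
    have hw := φ.map_source hu
    rw [htar'] at hw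
    have := hconst (φ u).1 hw.1 (φ u).2 hw.2
    rwa [Prod.mk.eta, φ.left_inv hu] at this
  refine ⟨φ, r, G, hr0, ?_, hsubU, ?_, hsymm, htar', hG, hBG,
    ⟨πc, fun u => congrFun hφ2 u⟩, fun u hu => ?_⟩
  · rw [hsrc]
    exact ⟨hp₀, Metric.mem_ball_self hr0, Metric.mem_ball_self hr0⟩
  · exact (hf.mono hsubU).congr fun u _ => hφf u
  · have hw := φ.map_source hu
    rw [htar'] at hw
    have hGd : HasFDerivAt G (fderiv ℝ G (φ u).2) (φ u).2 :=
      ((hG.contDiffAt (Metric.isOpen_ball.mem_nhds hw.2)).differentiableAt (by simp)).hasFDerivAt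
    have hφd : HasFDerivAt (fun v => (φ v).2) (fderiv ℝ (fun v => (φ v).2) u) u := by
      rw [hφ2d u hu, hφ2]
      exact πc.hasFDerivAt.comp u (hBd u (hsubU hu))
    have hcomp : fderiv ℝ B u =
        (fderiv ℝ G (φ u).2).comp (fderiv ℝ (fun v => (φ v).2) u) := by
      refine (hBd u (hsubU hu)).unique ((hGd.comp u hφd).congr_of_eventuallyEq ?_)
      filter_upwards [φ.open_source.mem_nhds hu] with v hv
      exact hBG v hv
    have hs : Function.Surjective (fderiv ℝ (fun v => (φ v).2) u) := by
      rw [hφ2d u hu]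
      exact hsurj u hu
    refine ⟨hs, hcomp, ?_⟩
    have h1 := hr u (hsubU hu)
    have h2 : LinearMap.range (fderiv ℝ B u : E n →ₗ[ℝ] F) =
        LinearMap.range (fderiv ℝ G (φ u).2 : E k →ₗ[ℝ] F) := by
      rw [hcomp]
      exact LinearMap.range_comp_of_range_eq_top
        (f := (fderiv ℝ (fun v => (φ v).2) u : E n →ₗ[ℝ] E k))
        (fderiv ℝ G (φ u).2 : E k →ₗ[ℝ] F) (LinearMap.range_eq_top.2 hs)
    rw [h2] at h1
    have h3 := LinearMap.finrank_range_add_finrank_ker (fderiv ℝ G (φ u).2 : E k →ₗ[ℝ] F)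
    have h4 : Module.finrank ℝ (E k) = k := by simp
    exact LinearMap.ker_eq_bot.1 (Submodule.finrank_eq_zero.1 (by omega))

end ConstantRank

/-! ### Smoothness of the superposition operator on spaces of continuous maps. -/

section Superposition

universe u

variable {K : Type*} [TopologicalSpace K] [CompactSpace K]
  {A : Type u} [NormedAddCommGroup A] [NormedSpace ℝ A]

/-- Pointwise application of a family of linear maps, as a bilinear map. -/
def pointwiseApply (K : Type*) [TopologicalSpace K] [CompactSpace K] (A B : Type u)
    [NormedAddCommGroup A] [NormedSpace ℝ A] [NormedAddCommGroup B] [NormedSpace ℝ B] :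
    C(K, A →L[ℝ] B) →L[ℝ] C(K, A) →L[ℝ] C(K, B) :=
  LinearMap.mkContinuous₂
    (LinearMap.mk₂ ℝ (fun (l : C(K, A →L[ℝ] B)) (α : C(K, A)) =>
        (⟨fun t => l t (α t), by fun_prop⟩ : C(K, B)))
      (by intros; ext; simp) (by intros; ext; simp) (by intros; ext; simp) (by intros; ext; simp))
    1 (by
      intro l α
      rw [one_mul]
      refine (ContinuousMap.norm_le _ (by positivity)).2 fun t => ?_
      exact ((l t).le_opNorm _).trans
        (mul_le_mul (l.norm_coe_le_norm t) (α.norm_coe_le_norm t) (norm_nonneg (α t)) (norm_nonneg l)))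

/-- Sup-norm continuity of composition with v' gives one δ that serves all t at once; the mean value
inequality at each t then bounds the remainder uniformly. -/
theorem hasFDerivAt_superposition {B : Type u} [NormedAddCommGroup B] [NormedSpace ℝ B]
    (v : C(A, B)) (v' : C(A, A →L[ℝ] B)) (hv : ∀ a, HasFDerivAt v (v' a) a) (α : C(K, A)) :
    HasFDerivAt (fun α : C(K, A) => v.comp α) (pointwiseApply K A B (v'.comp α)) α := by
  rw [hasFDerivAt_iff_isLittleO_nhds_zero, Asymptotics.isLittleO_iff]
  intro ε hε
  have hcont : Continuous fun α : C(K, A) => v'.comp α := v'.continuous_postcomp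
  obtain ⟨δ, hδ, hball⟩ := Metric.continuous_iff (α := C(K, A)) (β := C(K, A →L[ℝ] B)).1 hcont α ε hε
  filter_upwards [Metric.ball_mem_nhds (0 : C(K, A)) hδ] with β hβ
  rw [mem_ball_zero_iff] at hβ
  refine (ContinuousMap.norm_le _ (by positivity)).2 fun t => ?_
  have hclose : ∀ a ∈ Metric.ball (α t) δ, ‖v' a - v' (α t)‖ ≤ ε := by
    intro a ha
    -- Translating the whole map α by the constant a - α(t) keeps it δ-close and makes its value at
    -- t equal to a.
    have h1 := hball (α + ContinuousMap.const K (a - α t)) (by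
      rw [dist_eq_norm, add_sub_cancel_left]
      refine (ContinuousMap.norm_lt_iff _ hδ).2 fun s => ?_
      simpa [dist_eq_norm] using ha)
    have h2 := (ContinuousMap.dist_apply_le_dist (f := v'.comp (α + ContinuousMap.const K (a - α t)))
      (g := v'.comp α) t).trans h1.le
    simpa [dist_eq_norm] using h2
  have h1 := (convex_ball (α t) δ).norm_image_sub_le_of_norm_hasFDerivWithin_le'
    (f := v) (f' := v') (φ := v' (α t)) (fun a _ => (hv a).hasFDerivWithinAt) hclose
    (x := α t) (y := α t + β t) (Metric.mem_ball_self hδ) (by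
      rw [mem_ball_iff_norm, add_sub_cancel_left]
      exact (β.norm_coe_le_norm t).trans_lt hβ)
  rw [add_sub_cancel_left] at h1
  exact h1.trans (mul_le_mul_of_nonneg_left (β.norm_coe_le_norm t) hε.le)

/-- The superposition operator defined by a smooth function is smooth. -/
theorem contDiff_superposition {B : Type u} [NormedAddCommGroup B] [NormedSpace ℝ B]
    (v : C(A, B)) (hv : ContDiff ℝ ∞ v) : ContDiff ℝ ∞ fun α : C(K, A) => v.comp α := by
  rw [contDiff_infty]
  intro k
  -- The derivative is governed by the superposition operator of `fderiv ℝ v`, whose values lie in A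
  -- →L[ℝ] B. So the target varies in the induction, and A and B share a universe.
  induction k generalizing B with
  | zero =>
    rw [Nat.cast_zero, contDiff_zero]
    exact v.continuous_postcomp
  | succ k ih =>
    have hv' : ContDiff ℝ ∞ (fderiv ℝ v) := hv.fderiv_right (by simp)
    rw [Nat.cast_succ, contDiff_succ_iff_hasFDerivAt]
    refine ⟨fun α => pointwiseApply K A B
      ((⟨fderiv ℝ v, hv'.continuous⟩ : C(A, A →L[ℝ] B)).comp α), ?_, fun α => ?_⟩
    · exact (pointwiseApply K A B).contDiff.comp (ih ⟨fderiv ℝ v, hv'.continuous⟩ hv')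
    · exact hasFDerivAt_superposition v ⟨fderiv ℝ v, hv'.continuous⟩
        (fun a => (hv.differentiable (by simp) a).hasFDerivAt) α

end Superposition

/-! ### Smooth local flows by the inverse function theorem. -/

section Flow

variable {A : Type*} [NormedAddCommGroup A] [NormedSpace ℝ A] [CompleteSpace A]

/-- Indefinite integration of curves defined on the unit interval. -/
def primitiveL (A : Type*) [NormedAddCommGroup A] [NormedSpace ℝ A] [CompleteSpace A] :
    C(unitInterval, A) →L[ℝ] C(unitInterval, A) :=
  LinearMap.mkContinuous
    { toFun := fun α => ⟨fun t => ∫ r in (0 : ℝ)..t, α (Set.projIcc 0 1 zero_le_one r), by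
        have hc : Continuous fun r : ℝ => α (Set.projIcc 0 1 zero_le_one r) :=
          α.continuous.comp continuous_projIcc
        exact (intervalIntegral.continuous_primitive
          (fun a b => hc.intervalIntegrable a b) 0).comp continuous_subtype_val⟩
      map_add' := by
        intro α β
        ext t
        have hα : Continuous fun r : ℝ => α (Set.projIcc 0 1 zero_le_one r) :=
          α.continuous.comp continuous_projIcc
        have hβ : Continuous fun r : ℝ => β (Set.projIcc 0 1 zero_le_one r) :=
          β.continuous.comp continuous_projIcc
        exact intervalIntegral.integral_add (hα.intervalIntegrable _ _) (hβ.intervalIntegrable _ _)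
      map_smul' := by
        intro c α
        ext t
        exact intervalIntegral.integral_smul _ _ }
    1 (by
      intro α
      rw [one_mul]
      refine (ContinuousMap.norm_le _ (norm_nonneg _)).2 fun t => ?_
      refine (intervalIntegral.norm_integral_le_of_norm_le_const
        fun r _ => α.norm_coe_le_norm _).trans ?_
      rw [sub_zero, abs_of_nonneg t.2.1]
      exact mul_le_of_le_one_right (norm_nonneg _) t.2.2)

theorem primitiveL_apply (α : C(unitInterval, A)) (t : unitInterval) :
    primitiveL A α t = ∫ r in (0 : ℝ)..t, α (Set.projIcc 0 1 zero_le_one r) := rfl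

/-- The constant curves. -/
def constL (A : Type*) [NormedAddCommGroup A] [NormedSpace ℝ A] : A →L[ℝ] C(unitInterval, A) :=
  LinearMap.mkContinuous
    { toFun := fun a => ContinuousMap.const _ a
      map_add' := fun _ _ => rfl
      map_smul' := fun _ _ => rfl } 1 (by
      intro a
      rw [one_mul]
      exact (ContinuousMap.norm_le _ (norm_nonneg _)).2 fun t => le_rfl)

/-- The curve `r ↦ α (t r)`. -/
def rescale (t : unitInterval) (α : C(unitInterval, A)) : C(unitInterval, A) :=
  α.comp ⟨fun r => t * r, by fun_prop⟩

theorem rescale_apply (t : unitInterval) (α : C(unitInterval, A)) (r : unitInterval) :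
    rescale t α r = α (t * r) := rfl

/-- Substitution u ↦ t u in the integral. -/
theorem primitiveL_rescale (t : unitInterval) (α : C(unitInterval, A)) (r : unitInterval) :
    (t : ℝ) • primitiveL A (rescale t α) r = primitiveL A α (t * r) := by
  rw [primitiveL_apply, primitiveL_apply]
  have h1 : ∫ u in (0 : ℝ)..r, rescale t α (Set.projIcc 0 1 zero_le_one u) =
      ∫ u in (0 : ℝ)..r, α (Set.projIcc 0 1 zero_le_one ((t : ℝ) * u)) := by
    refine intervalIntegral.integral_congr fun u hu => ?_
    rw [Set.uIcc_of_le r.2.1] at hu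
    have hu' : u ∈ Set.Icc (0 : ℝ) 1 := ⟨hu.1, hu.2.trans r.2.2⟩
    have htu : (t : ℝ) * u ∈ Set.Icc (0 : ℝ) 1 :=
      ⟨mul_nonneg t.2.1 hu'.1, mul_le_one₀ t.2.2 hu'.1 hu'.2⟩
    change α (t * Set.projIcc 0 1 zero_le_one u) = α (Set.projIcc 0 1 zero_le_one ((t : ℝ) * u))
    rw [Set.projIcc_of_mem _ hu', Set.projIcc_of_mem _ htu]
    rfl
  rw [h1, intervalIntegral.smul_integral_comp_mul_left
    (fun u => α (Set.projIcc 0 1 zero_le_one u)) (t : ℝ), mul_zero]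
  rfl

/-- A smooth vector field has a smooth local flow. -/
theorem exists_smooth_local_flow {ξ : A → A} (hξ : ContDiff ℝ ∞ ξ) (p : A) :
    ∃ (G : ℝ × A → A) (O : Set (ℝ × A)), IsOpen O ∧ (0, p) ∈ O ∧ ContDiffOn ℝ ∞ G O ∧
      (∀ c, (0, c) ∈ O → G (0, c) = c) ∧
      ∀ w ∈ O, HasDerivAt (fun t => G (t, w.2)) (ξ (G w)) w.1 := by
  let N : C(unitInterval, A) → C(unitInterval, A) :=
    fun α => (⟨ξ, hξ.continuous⟩ : C(A, A)).comp α
  have hN : ContDiff ℝ ∞ N := contDiff_superposition ⟨ξ, hξ.continuous⟩ hξ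
  -- The trajectory of duration τ from c, rescaled to the unit interval, is a curve with α(r) = c +
  -- τ∫₀ʳ ξ(α). The last component of Ψ is the defect in this equation, so solutions are preimages
  -- of (τ, c, 0).
  let Ψ : (ℝ × A) × C(unitInterval, A) → (ℝ × A) × C(unitInterval, A) :=
    fun z => (z.1, z.2 - constL A z.1.2 - z.1.1 • primitiveL A (N z.2))
  have hΨ : ContDiff ℝ ∞ Ψ := by
    refine contDiff_fst.prodMk ?_
    refine (contDiff_snd.sub ((constL A).contDiff.comp (contDiff_snd.comp contDiff_fst))).sub ?_
    exact (contDiff_fst.comp contDiff_fst).smul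
      ((primitiveL A).contDiff.comp (hN.comp contDiff_snd))
  let a₀ : (ℝ × A) × C(unitInterval, A) := ((0, p), constL A p)
  let κ : ℝ × A →L[ℝ] C(unitInterval, A) :=
    (constL A).comp (ContinuousLinearMap.snd ℝ ℝ A) +
      (ContinuousLinearMap.fst ℝ ℝ A).smulRight (primitiveL A (N (constL A p)))
  -- At τ = 0 the derivative of N drops out. What is left is unipotent triangular, inverted by
  -- changing the sign of κ.
  let e : ((ℝ × A) × C(unitInterval, A)) ≃L[ℝ] (ℝ × A) × C(unitInterval, A) :=
    ContinuousLinearEquiv.equivOfInverse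
      ((ContinuousLinearMap.fst ℝ _ _).prod (ContinuousLinearMap.snd ℝ _ _ -
        κ.comp (ContinuousLinearMap.fst ℝ _ _)))
      ((ContinuousLinearMap.fst ℝ _ _).prod (ContinuousLinearMap.snd ℝ _ _ +
        κ.comp (ContinuousLinearMap.fst ℝ _ _)))
      (fun z => by simp) (fun z => by simp)
  have hder : HasFDerivAt Ψ (e : _ →L[ℝ] _) a₀ := by
    have h1 : HasFDerivAt (fun z : (ℝ × A) × C(unitInterval, A) => z.1.1)
        ((ContinuousLinearMap.fst ℝ ℝ A).comp (ContinuousLinearMap.fst ℝ _ _)) a₀ :=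
      HasFDerivAt.comp (𝕜 := ℝ) a₀ hasFDerivAt_fst hasFDerivAt_fst
    have h2 : DifferentiableAt ℝ
        (fun z : (ℝ × A) × C(unitInterval, A) => primitiveL A (N z.2)) a₀ :=
      ((primitiveL A).contDiff.comp (hN.comp contDiff_snd)).differentiable (by simp) a₀
    have h3 := h1.smul h2.hasFDerivAt
    have h4 : HasFDerivAt (fun z : (ℝ × A) × C(unitInterval, A) => z.2 - constL A z.1.2)
        (ContinuousLinearMap.snd ℝ _ _ - ((constL A).comp (ContinuousLinearMap.snd ℝ ℝ A)).comp
          (ContinuousLinearMap.fst ℝ _ _)) a₀ :=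
      ContinuousLinearMap.hasFDerivAt (ContinuousLinearMap.snd ℝ _ _ -
        ((constL A).comp (ContinuousLinearMap.snd ℝ ℝ A)).comp (ContinuousLinearMap.fst ℝ _ _))
    have h5 : HasFDerivAt (fun z : (ℝ × A) × C(unitInterval, A) => z.1)
      (ContinuousLinearMap.fst ℝ _ _) a₀ := hasFDerivAt_fst
    refine (h5.prodMk (h4.sub h3)).congr_fderiv ?_
    refine ContinuousLinearMap.ext fun z => Prod.ext ?_ ?_
    · simp [e]
    · simp [e, κ, a₀, sub_sub]
  obtain ⟨φ, hmem, -, hφ, hsymm, -⟩ :=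
    exists_smooth_inverse isOpen_univ (Set.mem_univ a₀) hΨ.contDiffOn hder
  let O₀ : Set (ℝ × A) := (fun w => (w, (0 : C(unitInterval, A)))) ⁻¹' φ.target
  have hO₀ : IsOpen O₀ := φ.open_target.preimage (by fun_prop)
  let α : ℝ × A → C(unitInterval, A) := fun w => (φ.symm (w, 0)).2
  have hα : ContDiffOn ℝ ∞ α O₀ :=
    contDiff_snd.comp_contDiffOn (hsymm.comp (by fun_prop) fun w hw => hw)
  have hΨ0 : Ψ a₀ = ((0, p), 0) := by simp [Ψ, a₀]
  have hmem0 : ((0, p) : ℝ × A) ∈ O₀ := by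
    have := φ.map_source hmem
    rwa [hφ, hΨ0] at this
  have hα0 : α (0, p) = constL A p := by
    have h1 := φ.left_inv hmem
    rw [hφ, hΨ0] at h1
    simp only [α, h1, a₀]
  have heq : ∀ w ∈ O₀, ∀ t, α w t = w.2 + w.1 • primitiveL A (N (α w)) t := by
    intro w hw t
    have h1 := φ.right_inv hw
    rw [hφ] at h1
    have h2 : (φ.symm (w, 0)).1 = w := congrArg Prod.fst h1
    have h3 : α w - constL A (φ.symm (w, 0)).1.2 -
      (φ.symm (w, 0)).1.1 • primitiveL A (N (α w)) = 0 := congrArg Prod.snd h1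
    rw [h2, sub_sub, sub_eq_zero] at h3
    have h4 := congrArg (fun β : C(unitInterval, A) => β t) h3
    exact h4
  have huniq : ∀ z ∈ φ.source, (Ψ z).2 = 0 → z.1 ∈ O₀ ∧ α z.1 = z.2 := by
    intro z hz h0
    have h1 := φ.map_source hz
    have h3 : Ψ z = (z.1, 0) := Prod.ext rfl h0
    have h2 := φ.left_inv hz
    rw [hφ, h3] at h1 h2
    exact ⟨h1, congrArg Prod.snd h2⟩
  obtain ⟨δ, hδ, hball⟩ := Metric.isOpen_iff.1 φ.open_source a₀ hmem
  let O₁ : Set (ℝ × A) := (O₀ ∩ α ⁻¹' Metric.ball (constL A p) δ) ∩ Metric.ball (0, p) δ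
  have hO₁ : IsOpen O₁ := (hα.continuousOn.isOpen_inter_preimage hO₀ Metric.isOpen_ball).inter
    Metric.isOpen_ball
  -- The rescaling of a solution solves the equation for duration t τ; local uniqueness identifies
  -- it with the solution found there. So α(τ, c) traces the trajectory t ↦ G(t τ, c).
  have hscale : ∀ w ∈ O₁, ∀ t : unitInterval, ((t * w.1, w.2) : ℝ × A) ∈ O₀ ∧
      α (t * w.1, w.2) = rescale t (α w) := by
    intro w hw t
    refine huniq ((t * w.1, w.2), rescale t (α w)) (hball ?_) ?_
    · rw [Metric.mem_ball, Prod.dist_eq, max_lt_iff]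
      constructor
      · have h1 := hw.2
        change dist ((t * w.1, w.2) : ℝ × A) (0, p) < δ
        rw [Metric.mem_ball, Prod.dist_eq, max_lt_iff] at h1
        rw [Prod.dist_eq, max_lt_iff]
        refine ⟨lt_of_le_of_lt ?_ h1.1, h1.2⟩
        simp only [dist_zero_right, norm_mul, Real.norm_eq_abs]
        rw [abs_of_nonneg t.2.1]
        exact mul_le_of_le_one_left (abs_nonneg _) t.2.2
      · refine lt_of_le_of_lt ?_ hw.1.2
        refine (ContinuousMap.dist_le dist_nonneg).2 fun r => ?_
        exact ContinuousMap.dist_apply_le_dist (f := α w) (g := constL A p) (t * r)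
    · change rescale t (α w) - constL A w.2 - ((t : ℝ) * w.1) • primitiveL A (N (rescale t (α w))) = 0
      rw [sub_sub, sub_eq_zero]
      ext r
      have h1 := heq w hw.1.1 (t * r)
      rw [← primitiveL_rescale, smul_smul, mul_comm w.1] at h1
      exact h1
  let G : ℝ × A → A := fun w => α w 1
  have hGα : ∀ w ∈ O₁, ∀ t : unitInterval, G (t * w.1, w.2) = α w t := by
    intro w hw t
    change α (t * w.1, w.2) 1 = _
    rw [(hscale w hw t).2, rescale_apply, mul_one]
  have hG : ContDiffOn ℝ ∞ G O₀ :=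
    (ContinuousMap.evalCLM (M := A) ℝ (1 : unitInterval)).contDiff.comp_contDiffOn hα
  -- Doubled times are required to lie in O₁: time τ is then the interior parameter 1/2 of the curve
  -- of duration 2τ, where the integral has a two-sided derivative.
  let O : Set (ℝ × A) := O₀ ∩ (fun w : ℝ × A => (2 * w.1, w.2)) ⁻¹' O₁
  have hO : IsOpen O := hO₀.inter (hO₁.preimage (by fun_prop))
  have hne : ∀ w ∈ O, w.1 ≠ 0 → HasDerivAt (fun t => G (t, w.2)) (ξ (G w)) w.1 := by
    intro w hw hw0
    have hw2 : ((2 * w.1, w.2) : ℝ × A) ∈ O₁ := hw.2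
    set W : ℝ × A := (2 * w.1, w.2) with hW
    let β : ℝ → A := fun r => ξ (α W (Set.projIcc 0 1 zero_le_one r))
    have hβ : Continuous β := by
      exact hξ.continuous.comp ((α W).continuous.comp continuous_projIcc)
    have h1 : HasDerivAt (fun t : ℝ => w.2 + (2 * w.1) • ∫ r in (0 : ℝ)..t, β r)
        ((2 * w.1) • β (1 / 2)) (1 / 2) :=
      ((intervalIntegral.integral_hasDerivAt_right (hβ.intervalIntegrable _ _)
        (hβ.stronglyMeasurableAtFilter _ _) hβ.continuousAt).const_smul _).const_add _
    have hval : β (1 / 2) = ξ (G w) := by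
      have h2 : ((1 / 2 : ℝ)) ∈ Set.Icc (0 : ℝ) 1 := by norm_num
      have h3 := hGα W hw2 ⟨1 / 2, h2⟩
      simp only [β]
      rw [Set.projIcc_of_mem _ h2, ← h3]
      congr 2
      ext1
      · simp [hW]
      · rfl
    rw [hval] at h1
    have h2 : HasDerivAt (fun t : ℝ => G (t * (2 * w.1), w.2)) ((2 * w.1) • ξ (G w)) (1 / 2) := by
      refine h1.congr_of_eventuallyEq ?_
      filter_upwards [Ioo_mem_nhds (show (0 : ℝ) < 1 / 2 by norm_num)
        (show (1 / 2 : ℝ) < 1 by norm_num)] with t ht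
      have h3 := hGα W hw2 ⟨t, ht.1.le, ht.2.le⟩
      rw [heq W hw2.1.1] at h3
      exact h3
    have h3 : HasDerivAt (fun r : ℝ => r * (2 * w.1)⁻¹) (2 * w.1)⁻¹ w.1 := by
      simpa using (hasDerivAt_id w.1).mul_const (2 * w.1)⁻¹
    have hhalf : w.1 * (2 * w.1)⁻¹ = 1 / 2 := by field_simp
    have h4 := HasDerivAt.scomp (𝕜 := ℝ) w.1 (hhalf.symm ▸ h2) h3
    have h5 : ((fun t : ℝ => G (t * (2 * w.1), w.2)) ∘ fun r : ℝ => r * (2 * w.1)⁻¹) =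
        fun t => G (t, w.2) := by
      funext r
      have : r * (2 * w.1)⁻¹ * (2 * w.1) = r := by field_simp
      simp only [Function.comp_apply, this]
    rw [h5, smul_smul, inv_mul_cancel₀ (by simpa using hw0), one_smul] at h4
    exact h4
  refine ⟨G, O, hO, ⟨hmem0, ?_⟩, hG.mono Set.inter_subset_left, ?_, ?_⟩
  · change ((2 * 0, p) : ℝ × A) ∈ O₁
    rw [mul_zero]
    refine ⟨⟨hmem0, ?_⟩, Metric.mem_ball_self hδ⟩
    rw [Set.mem_preimage, hα0]
    exact Metric.mem_ball_self hδ
  · intro c hc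
    have := heq (0, c) hc.1 1
    simpa using this
  · rintro ⟨τ, c⟩ hw
    -- The rescaling divides by τ and fails at τ = 0. There the equation follows by letting τ tend
    -- to 0, since both sides are continuous.
    rcases eq_or_ne τ 0 with rfl | hτ
    · let g : ℝ → A := fun t => G (t, c)
      let O' : Set ℝ := (fun t => (t, c)) ⁻¹' O
      have hO' : IsOpen O' := hO.preimage (by fun_prop)
      have hg : ContDiffOn ℝ ∞ g O' :=
        (hG.mono Set.inter_subset_left).comp (by fun_prop) fun t ht => ht
      have h0 : (0 : ℝ) ∈ O' := hw
      have hd : HasDerivAt g (deriv g 0) 0 :=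
        ((hg.contDiffAt (hO'.mem_nhds h0)).differentiableAt (by simp)).hasDerivAt
      have h1 : ContinuousAt (deriv g) 0 :=
        (hg.continuousOn_deriv_of_isOpen hO' (by simp)).continuousAt (hO'.mem_nhds h0)
      have h2 : ContinuousAt (fun t => ξ (g t)) 0 :=
        hξ.continuous.continuousAt.comp (hg.continuousOn.continuousAt (hO'.mem_nhds h0))
      have h3 : deriv g =ᶠ[nhdsWithin 0 {0}ᶜ] fun t => ξ (g t) := by
        filter_upwards [self_mem_nhdsWithin, mem_nhdsWithin_of_mem_nhds (hO'.mem_nhds h0)]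
          with t ht htO
        exact (hne (t, c) htO ht).deriv
      have h4 : deriv g 0 = ξ (g 0) :=
        tendsto_nhds_unique (h1.mono_left nhdsWithin_le_nhds |>.congr' h3)
          (h2.mono_left nhdsWithin_le_nhds)
      rw [h4] at hd
      exact hd
    · exact hne (τ, c) hw hτ

end Flow

/-! ### Straightening a vector field. -/

section FlowBox

/-- A bump function extends the field to the whole space, as the local flow is built for globally
smooth fields. -/
theorem exists_contDiff_eq_near {F : Type*} [NormedAddCommGroup F] [NormedSpace ℝ F] {k : ℕ}
    {ξ : E k → F} {U : Set (E k)} (hU : IsOpen U) (hξ : ContDiffOn ℝ ∞ ξ U) {p : E k}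
    (hp : p ∈ U) :
    ∃ η : E k → F, ContDiff ℝ ∞ η ∧ ∃ r > 0, Metric.ball p r ⊆ U ∧
      ∀ c ∈ Metric.ball p r, η c = ξ c := by
  obtain ⟨R, hR, hball⟩ := Metric.isOpen_iff.1 hU p hp
  let f : ContDiffBump p := ⟨R / 4, R / 2, by positivity, by linarith⟩
  refine ⟨fun c => f c • ξ c, ?_, R / 4, by positivity,
    (Metric.ball_subset_ball (by linarith)).trans hball, fun c hc => ?_⟩
  · rw [contDiff_iff_contDiffAt]
    intro c
    by_cases hc : c ∈ Metric.ball p R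
    · exact f.contDiff.contDiffAt.smul (hξ.contDiffAt (hU.mem_nhds (hball hc)))
    · have h1 : ∀ᶠ c' in nhds c, f c' • ξ c' = 0 := by
        have h2 : c ∈ (Metric.closedBall p (R / 2))ᶜ := by
          simp only [Metric.mem_ball, not_lt, Set.mem_compl_iff, Metric.mem_closedBall,
            not_le] at hc ⊢
          linarith
        filter_upwards [Metric.isClosed_closedBall.isOpen_compl.mem_nhds h2] with c' hc'
        have h3 : f c' = 0 := f.zero_of_le_dist (by
          simp only [Set.mem_compl_iff, Metric.mem_closedBall, not_le] at hc'
          exact hc'.le)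
        rw [h3, zero_smul]
      exact contDiffAt_const.congr_of_eventuallyEq (f := fun _ => (0 : F)) h1
  · have : f c = 1 := f.one_of_mem_closedBall (Metric.ball_subset_closedBall hc)
    simp only [this, one_smul]

/-- The straightening of a smooth vector field near a point where it does not vanish. -/
theorem exists_flow_box {m k : ℕ} (hk : m + 1 = k) {ξ : E k → E k} {U : Set (E k)}
    (hU : IsOpen U) (hξ : ContDiffOn ℝ ∞ ξ U) {p : E k} (hp : p ∈ U) (h0 : ξ p ≠ 0) :
    ∃ (H : ℝ × E m → E k) (O : Set (ℝ × E m)), IsOpen O ∧ 0 ∈ O ∧ ContDiffOn ℝ ∞ H O ∧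
      H 0 = p ∧ Set.MapsTo H O U ∧
      (∀ w ∈ O, HasDerivAt (fun t => H (t, w.2)) (ξ (H w)) w.1) ∧
      Function.Injective (fderiv ℝ H 0) := by
  obtain ⟨η, hη, r, hr, hrU, hηξ⟩ := exists_contDiff_eq_near hU hξ hp
  obtain ⟨G, Q, hQ, hpQ, hG, hG0, hGd⟩ := exists_smooth_local_flow hη p
  -- The flow starts from the affine slice p + R. The derivative at 0 sends the time direction to
  -- ξ(p) and is the inclusion of R on the slice, hence injective.
  obtain ⟨R, hR⟩ := (Submodule.span ℝ {ξ p}).exists_isCompl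
  have hRfin : Module.finrank ℝ R = m := by
    have := Submodule.finrank_add_eq_of_isCompl hR
    rw [finrank_span_singleton h0] at this
    have h2 : Module.finrank ℝ (E k) = k := by simp
    omega
  let ι₀ : E m ≃ₗ[ℝ] R := LinearEquiv.ofFinrankEq _ _ (by simp [hRfin])
  let ι : E m →L[ℝ] E k := LinearMap.toContinuousLinearMap (R.subtype ∘ₗ ι₀.toLinearMap)
  have hιmem : ∀ c, ι c ∈ R := fun c => (ι₀ c).2
  have hιinj : ∀ c, ι c = 0 → c = 0 := fun c hc => ι₀.map_eq_zero_iff.1 (Subtype.ext hc)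
  let J : ℝ × E m → ℝ × E k := fun w => (w.1, p + ι w.2)
  have hJ : ContDiff ℝ ∞ J := contDiff_fst.prodMk (contDiff_const.add (ι.contDiff.comp contDiff_snd))
  have hJ0 : J 0 = (0, p) := by simp [J]
  have hO₁ : IsOpen (J ⁻¹' Q) := hQ.preimage hJ.continuous
  let H : ℝ × E m → E k := fun w => G (J w)
  have hH : ContDiffOn ℝ ∞ H (J ⁻¹' Q) := hG.comp hJ.contDiffOn fun w hw => hw
  have hH0 : H 0 = p := by
    simp only [H, hJ0]
    exact hG0 p hpQ
  let O : Set (ℝ × E m) := J ⁻¹' Q ∩ H ⁻¹' Metric.ball p r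
  have hO : IsOpen O := hH.continuousOn.isOpen_inter_preimage hO₁ Metric.isOpen_ball
  have h0O : (0 : ℝ × E m) ∈ O := by
    refine ⟨?_, ?_⟩
    · rw [Set.mem_preimage, hJ0]
      exact hpQ
    · rw [Set.mem_preimage, hH0]
      exact Metric.mem_ball_self hr
  have hHd : ∀ w ∈ O, HasDerivAt (fun t => H (t, w.2)) (ξ (H w)) w.1 := by
    intro w hw
    rw [← hηξ _ hw.2]
    exact hGd (J w) hw.1
  refine ⟨H, O, hO, h0O, hH.mono Set.inter_subset_left, hH0, fun w hw => hrU hw.2, hHd, ?_⟩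
  have hd : HasFDerivAt H (fderiv ℝ H 0) 0 :=
    ((hH.contDiffAt (hO₁.mem_nhds h0O.1)).differentiableAt (by simp)).hasFDerivAt
  have h1 : ∀ t, fderiv ℝ H 0 (t, 0) = t • ξ p := by
    have h2 : HasDerivAt (fun t : ℝ => H (t, 0)) (fderiv ℝ H 0 (1, 0)) 0 := by
      have h3 := HasFDerivAt.comp_hasDerivAt (0 : ℝ) (f := fun t : ℝ => (t, (0 : E m))) hd
        ((hasDerivAt_id 0).prodMk (hasDerivAt_const 0 0))
      exact h3
    have h4 := h2.unique (hHd 0 h0O)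
    intro t
    have h5 : ((t, 0) : ℝ × E m) = t • (1, 0) := by simp
    rw [h5, map_smul, h4, hH0]
  have h2 : ∀ c, fderiv ℝ H 0 (0, c) = ι c := by
    have h3 := HasFDerivAt.comp (𝕜 := ℝ) (0 : E m) (f := fun c : E m => ((0 : ℝ), c)) hd
      (hasFDerivAt_prodMk_right 0 0)
    have h4 : HasFDerivAt (fun c : E m => p + ι c) ι 0 := ι.hasFDerivAt.const_add p
    have h5 : HasFDerivAt (H ∘ fun c : E m => ((0 : ℝ), c)) ι 0 := by
      refine h4.congr_of_eventuallyEq ?_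
      have h6 : (fun c : E m => ((0 : ℝ), c)) ⁻¹' O ∈ nhds (0 : E m) :=
        (hO.preimage (by fun_prop)).mem_nhds h0O
      filter_upwards [h6] with c hc
      exact hG0 _ hc.1
    intro c
    exact congrArg (fun L : E m →L[ℝ] E k => L c) (h3.unique h5)
  rw [← ContinuousLinearMap.coe_coe, ← LinearMap.ker_eq_bot, LinearMap.ker_eq_bot']
  rintro ⟨t, c⟩ htc
  have h3 : t • ξ p + ι c = 0 := by
    rw [← h1, ← h2, ← map_add]
    simpa using htc
  have h4 : ι c = 0 := by
    have h5 : ι c ∈ Submodule.span ℝ {ξ p} := by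
      rw [← neg_eq_of_add_eq_zero_right h3]
      exact neg_mem (Submodule.smul_mem _ _ (Submodule.mem_span_singleton_self _))
    have := Submodule.disjoint_def.1 hR.disjoint _ h5 (hιmem c)
    exact this
  rw [h4, add_zero] at h3
  rw [hιinj c h4, (smul_eq_zero.1 h3).resolve_right h0]
  rfl

end FlowBox

/-! ### Passing from the manifold to coordinates. -/

section Chart

variable {n : ℕ} {N : Type*} [TopologicalSpace N] [ChartedSpace (E n) N]
  [IsManifold 𝓘(ℝ, E n) ∞ N] {F : Type*} [NormedAddCommGroup F] [NormedSpace ℝ F]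

/-- The domain of the coordinate expression of a function defined on `W`. -/
def coordSet (p : N) (W : Set N) : Set (E n) :=
  (chartAt (E n) p).target ∩ (chartAt (E n) p).symm ⁻¹' W

/-- The coordinate expression of a function on a manifold. -/
def coord (p : N) (f : N → F) : E n → F := fun u => f ((chartAt (E n) p).symm u)

theorem isOpen_coordSet {p : N} {W : Set N} (hW : IsOpen W) : IsOpen (coordSet (n := n) p W) :=
  (chartAt (E n) p).isOpen_inter_preimage_symm hW

theorem mem_coordSet {p q : N} {W : Set N} (hq : q ∈ W) (hqp : q ∈ (chartAt (E n) p).source) :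
    chartAt (E n) p q ∈ coordSet (n := n) p W :=
  ⟨(chartAt (E n) p).map_source hqp, by
    rwa [Set.mem_preimage, (chartAt (E n) p).left_inv hqp]⟩

theorem coord_chart {p q : N} (f : N → F) (hqp : q ∈ (chartAt (E n) p).source) :
    coord p f (chartAt (E n) p q) = f q := by
  rw [coord, (chartAt (E n) p).left_inv hqp]

theorem contDiffOn_coord {p : N} {W : Set N} {f : N → F}
    (hf : ContMDiffOn 𝓘(ℝ, E n) 𝓘(ℝ, F) ∞ f W) :
    ContDiffOn ℝ ∞ (coord (n := n) p f) (coordSet p W) := by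
  rw [← contMDiffOn_iff_contDiffOn]
  exact hf.comp ((contMDiffOn_chart_symm (I := 𝓘(ℝ, E n)) (x := p)).mono Set.inter_subset_left)
    fun u hu => hu.2

theorem contMDiffOn_of_coord {p : N} {W : Set N} {f : E n → F} {U : Set (E n)}
    (hf : ContDiffOn ℝ ∞ f U) (hW : W ⊆ (chartAt (E n) p).source)
    (hWU : ∀ q ∈ W, chartAt (E n) p q ∈ U) :
    ContMDiffOn 𝓘(ℝ, E n) 𝓘(ℝ, F) ∞ (fun q => f (chartAt (E n) p q)) W :=
  hf.contMDiffOn.comp ((contMDiffOn_chart (I := 𝓘(ℝ, E n)) (x := p)).mono hW) hWU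

/-- The coordinate isomorphism of the tangent space at `q` with `ℝⁿ`. -/
def chartEquiv (p : N) {q : N} (hq : q ∈ (chartAt (E n) p).source) :
    TangentSpace 𝓘(ℝ, E n) q ≃L[ℝ] E n :=
  haveI : IsManifold 𝓘(ℝ, E n) 1 N := IsManifold.of_le (n := ∞) (by simp)
  (mdifferentiable_chart (I := 𝓘(ℝ, E n)) p).mfderiv hq

theorem mfderiv_eq_coord {p q : N} (hqp : q ∈ (chartAt (E n) p).source) {f : N → F}
    (hf : DifferentiableAt ℝ (coord p f) (chartAt (E n) p q)) (v : TangentSpace 𝓘(ℝ, E n) q) :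
    mfderiv 𝓘(ℝ, E n) 𝓘(ℝ, F) f q v =
      fderiv ℝ (coord p f) (chartAt (E n) p q) (chartEquiv p hqp v) := by
  have : IsManifold 𝓘(ℝ, E n) 1 N := IsManifold.of_le (n := ∞) (by simp)
  have h1 : f =ᶠ[nhds q] coord p f ∘ chartAt (E n) p := by
    filter_upwards [(chartAt (E n) p).open_source.mem_nhds hqp] with r hr
    exact (coord_chart f hr).symm
  rw [h1.mfderiv_eq, mfderiv_comp q hf.mdifferentiableAt
    ((mdifferentiable_chart (I := 𝓘(ℝ, E n)) p).mdifferentiableAt hqp), mfderiv_eq_fderiv]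
  rfl

theorem differentiableAt_coord {p q : N} (hqp : q ∈ (chartAt (E n) p).source) {W : Set N}
    (hW : IsOpen W) (hq : q ∈ W) {f : N → F} (hf : ContMDiffOn 𝓘(ℝ, E n) 𝓘(ℝ, F) ∞ f W) :
    DifferentiableAt ℝ (coord p f) (chartAt (E n) p q) :=
  ((contDiffOn_coord hf).contDiffAt
    ((isOpen_coordSet hW).mem_nhds (mem_coordSet hq hqp))).differentiableAt (by simp)

instance (q : N) : FiniteDimensional ℝ (TangentSpace 𝓘(ℝ, E n) q) :=
  inferInstanceAs (FiniteDimensional ℝ (E n))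

theorem finrank_tangentSpace (q : N) : Module.finrank ℝ (TangentSpace 𝓘(ℝ, E n) q) = n := by
  change Module.finrank ℝ (E n) = n
  simp

end Chart

/-! ### Differentiating scalar products. -/

section Lorentz

variable {n : ℕ}

/-- The scalar product as a continuous bilinear map. -/
def lorL (n : ℕ) : V n →L[ℝ] V n →L[ℝ] ℝ :=
  LinearMap.toContinuousLinearMap
    ((LinearMap.toContinuousLinearMap : (V n →ₗ[ℝ] ℝ) ≃ₗ[ℝ] (V n →L[ℝ] ℝ)).toLinearMap ∘ₗ lor n)

theorem lorL_apply (v w : V n) : lorL n v w = lor n v w := rfl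

variable {A : Type*} [NormedAddCommGroup A] [NormedSpace ℝ A]

theorem contDiffOn_lor {f g : A → V n} {U : Set A} {k : WithTop ℕ∞}
    (hf : ContDiffOn ℝ k f U) (hg : ContDiffOn ℝ k g U) :
    ContDiffOn ℝ k (fun u => lor n (f u) (g u)) U :=
  ((lorL n).contDiff.comp_contDiffOn hf).clm_apply hg

/-- Leibniz rule for a constant scalar product; it yields the orthogonality relations between frame
vectors and their differentials. -/
theorem lor_fderiv_eq {f g : A → V n} {U : Set A} {u : A} (hU : IsOpen U) (hu : u ∈ U)
    (hf : DifferentiableAt ℝ f u) (hg : DifferentiableAt ℝ g u) {c : ℝ}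
    (h : ∀ u ∈ U, lor n (f u) (g u) = c) (v : A) :
    lor n (fderiv ℝ f u v) (g u) + lor n (f u) (fderiv ℝ g u v) = 0 := by
  have h1 : HasFDerivAt (fun u => lorL n (f u) (g u)) (0 : A →L[ℝ] ℝ) u := by
    refine (hasFDerivAt_const c u).congr_of_eventuallyEq ?_
    filter_upwards [hU.mem_nhds hu] with u hu
    exact h u hu
  have h2 := (((lorL n).hasFDerivAt.comp u hf.hasFDerivAt).clm_apply hg.hasFDerivAt).unique h1
  have h3 := congrArg (fun L : A →L[ℝ] ℝ => L v) h2
  simp only [add_apply, ContinuousLinearMap.comp_apply,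
    ContinuousLinearMap.flip_apply, zero_apply, Function.comp_apply,
    lorL_apply] at h3
  rw [add_comm]
  exact h3

/-- The polarity between the points of a lightlike hypersurface and their contact points makes
the second fundamental form symmetric. -/
theorem lor_fderiv_symm {X Y : A → V n} {U : Set A} (hU : IsOpen U) (hX : ContDiffOn ℝ ∞ X U)
    (hY : ContDiffOn ℝ ∞ Y U) (h : ∀ u ∈ U, ∀ v, lor n (fderiv ℝ X u v) (Y u) = 0) {u : A}
    (hu : u ∈ U) (v w : A) :
    lor n (fderiv ℝ X u v) (fderiv ℝ Y u w) = lor n (fderiv ℝ X u w) (fderiv ℝ Y u v) := by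
  have hXu := hX.contDiffAt (hU.mem_nhds hu)
  have hYd := (hY.contDiffAt (hU.mem_nhds hu)).differentiableAt (by simp)
  have hX' : DifferentiableAt ℝ (fderiv ℝ X) u :=
    (hXu.fderiv_right (m := ∞) (by simp)).differentiableAt (by simp)
  have hsym : IsSymmSndFDerivAt ℝ X u := hXu.isSymmSndFDerivAt (by
    rw [minSmoothness_of_isRCLikeNormedField]
    exact ENat.LEInfty.out)
  -- Differentiating (dX(v), Y) = 0 in direction w expresses the pairing through the second
  -- derivative of X, which is symmetric.
  have key : ∀ v w, lor n (fderiv ℝ X u v) (fderiv ℝ Y u w) =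
      - lor n (fderiv ℝ (fderiv ℝ X) u w v) (Y u) := by
    intro v w
    have hXv : HasFDerivAt (fun u => fderiv ℝ X u v)
        ((ContinuousLinearMap.apply ℝ (V n) v).comp (fderiv ℝ (fderiv ℝ X) u)) u :=
      (ContinuousLinearMap.apply ℝ (V n) v).hasFDerivAt.comp u hX'.hasFDerivAt
    have h1 := lor_fderiv_eq hU hu hXv.differentiableAt hYd (fun u hu => h u hu v) w
    rw [hXv.fderiv] at h1
    exact eq_neg_of_add_eq_zero_right h1
  rw [key, key, hsym.eq]

end Lorentz

/-! ### Independence of the choice of homogeneous coordinates. -/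

section Lift

variable {n : ℕ} {N : Type*} [TopologicalSpace N] [ChartedSpace (E n) N]
  [IsManifold 𝓘(ℝ, E n) ∞ N]

theorem dif_eq_coord {W : Set N} {X : N → V n} (hW : IsOpen W)
    (hX : ContMDiffOn 𝓘(ℝ, E n) 𝓘(ℝ, V n) ∞ X W) {p q : N} (hq : q ∈ W)
    (hqp : q ∈ (chartAt (E n) p).source) (v : TangentSpace 𝓘(ℝ, E n) q) :
    dif X q v = fderiv ℝ (coord p X) (chartAt (E n) p q) (chartEquiv p hqp v) :=
  mfderiv_eq_coord hqp (differentiableAt_coord hqp hW hq hX) v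

variable {f : N → ℙ ℝ (V n)} {W W' : Set N} {X X' : N → V n} {q : N}

namespace IsLift

theorem ne_zero (h : IsLift f W X) (hq : q ∈ W) : X q ≠ 0 := (h.2.2 q hq).1

theorem submodule_eq (h : IsLift f W X) (hq : q ∈ W) :
    (f q).submodule = Submodule.span ℝ {X q} := by
  obtain ⟨h0, h1⟩ := h.2.2 q hq
  rw [h1, Projectivization.submodule_mk]

theorem mem_submodule (h : IsLift f W X) (hq : q ∈ W) : X q ∈ (f q).submodule := by
  rw [h.submodule_eq hq]
  exact Submodule.mem_span_singleton_self _

theorem mono {W₁ : Set N} (h : IsLift f W X) (hW₁ : IsOpen W₁) (hsub : W₁ ⊆ W) :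
    IsLift f W₁ X :=
  ⟨hW₁, h.2.1.mono hsub, fun q hq => h.2.2 q (hsub hq)⟩

/-- Two choices of homogeneous coordinates are proportional to first order. -/
theorem exists_proportional (h : IsLift f W X) (h' : IsLift f W' X') (hq : q ∈ W)
    (hq' : q ∈ W') : ∃ a : ℝ, a ≠ 0 ∧ X' q = a • X q ∧
      ∀ v, dif X' q v - a • dif X q v ∈ Submodule.span ℝ {X q} := by
  have hex : ∀ r ∈ W ∩ W', ∃ a : ℝ, a ≠ 0 ∧ X' r = a • X r := by
    intro r hr
    have h1 := h'.mem_submodule hr.2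
    rw [h.submodule_eq hr.1] at h1
    obtain ⟨a, ha⟩ := Submodule.mem_span_singleton.1 h1
    refine ⟨a, ?_, ha.symm⟩
    rintro rfl
    exact h'.ne_zero hr.2 (by rw [← ha, zero_smul])
  obtain ⟨a, ha0, ha⟩ := hex q ⟨hq, hq'⟩
  refine ⟨a, ha0, ha, fun v => ?_⟩
  have hqp := mem_chart_source (E n) q
  have hd := differentiableAt_coord hqp h.1 hq h.2.1
  have hd' := differentiableAt_coord hqp h'.1 hq' h'.2.1
  rw [dif_eq_coord h.1 h.2.1 hq hqp, dif_eq_coord h'.1 h'.2.1 hq' hqp]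
  set u := chartAt (E n) q q
  set w := chartEquiv q hqp v
  have hX0 : coord q X u = X q := coord_chart X hqp
  -- Quotients of Euclidean inner products recover the factor of proportionality and show that it is
  -- differentiable.
  let k : E n → ℝ := fun u => inner ℝ (coord q X u) (coord q X' u) /
    inner ℝ (coord q X u) (coord q X u)
  have hne0 : inner ℝ (coord q X u) (coord q X u) ≠ 0 := by
    rw [hX0]
    exact inner_self_ne_zero.2 (h.ne_zero hq)
  have hk : DifferentiableAt ℝ k u :=
    (hd.inner ℝ hd').mul ((hd.inner ℝ hd).inv hne0)
  have hkX : coord q X' =ᶠ[nhds u] fun u => k u • coord q X u := by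
    filter_upwards [(isOpen_coordSet (h.1.inter h'.1)).mem_nhds (mem_coordSet ⟨hq, hq'⟩ hqp)]
      with u hu
    obtain ⟨b, -, hb⟩ := hex _ hu.2
    have hb' : coord q X' u = b • coord q X u := hb
    have hne : coord q X u ≠ 0 := h.ne_zero hu.2.1
    simp only [k]
    rw [hb', inner_smul_right, mul_div_assoc, div_self (inner_self_ne_zero.2 hne), mul_one]
  have hka : k u = a := by
    have h1 : coord q X' u = X' q := coord_chart X' hqp
    simp only [k]
    rw [h1, ha, hX0, inner_smul_right, mul_div_assoc,
      div_self (inner_self_ne_zero.2 (h.ne_zero hq)), mul_one]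
  have h1 : HasFDerivAt (fun u => k u • coord q X u) _ u := hk.hasFDerivAt.smul hd.hasFDerivAt
  rw [hkX.fderiv_eq, h1.fderiv]
  simp only [add_apply, smul_apply,
    ContinuousLinearMap.smulRight_apply, hka, hX0, add_sub_cancel_left]
  exact Submodule.smul_mem _ _ (Submodule.mem_span_singleton_self _)

theorem sup_map_le (h : IsLift f W X) (h' : IsLift f W' X') (hq : q ∈ W) (hq' : q ∈ W')
    (D : Submodule ℝ (TangentSpace 𝓘(ℝ, E n) q)) :
    Submodule.span ℝ {X' q} ⊔ D.map (dif X' q : TangentSpace 𝓘(ℝ, E n) q →ₗ[ℝ] V n) ≤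
      Submodule.span ℝ {X q} ⊔ D.map (dif X q : TangentSpace 𝓘(ℝ, E n) q →ₗ[ℝ] V n) := by
  obtain ⟨a, ha0, ha, hd⟩ := h.exists_proportional h' hq hq'
  refine sup_le ?_ ?_
  · rw [Submodule.span_singleton_le_iff_mem, ha]
    exact Submodule.mem_sup_left (Submodule.smul_mem _ _ (Submodule.mem_span_singleton_self _))
  · rintro _ ⟨v, hv, rfl⟩
    have h1 : dif X' q v = (dif X' q v - a • dif X q v) + a • dif X q v := by abel
    change dif X' q v ∈ _
    rw [h1]
    exact add_mem (Submodule.mem_sup_left (hd v))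
      (Submodule.mem_sup_right (Submodule.smul_mem _ _ ⟨v, hv, rfl⟩))

/-- By first-order proportionality all lifts give the same subspace, so the supremum in the
definition is attained at each of them. -/
theorem tangentAlong_eq (h : IsLift f W X) (hq : q ∈ W)
    (D : Submodule ℝ (TangentSpace 𝓘(ℝ, E n) q)) :
    tangentAlong f q D =
      Submodule.span ℝ {X q} ⊔ D.map (dif X q : TangentSpace 𝓘(ℝ, E n) q →ₗ[ℝ] V n) := by
  apply le_antisymm
  · exact iSup_le fun W' => iSup_le fun X' => iSup_le fun h' => h.sup_map_le h'.2 hq h'.1 D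
  · exact le_iSup_of_le W (le_iSup_of_le X (le_iSup_of_le ⟨hq, h⟩ le_rfl))

theorem tangentSubspace_eq (h : IsLift f W X) (hq : q ∈ W) :
    tangentSubspace f q = Submodule.span ℝ {X q} ⊔
      LinearMap.range (dif X q : TangentSpace 𝓘(ℝ, E n) q →ₗ[ℝ] V n) := by
  rw [tangentSubspace, h.tangentAlong_eq hq, Submodule.map_top]

end IsLift

end Lift

/-! ### Normalized frames along the hypersurface. -/

section Frame

variable {n : ℕ} {N : Type*} [TopologicalSpace N] [ChartedSpace (E n) N]
  [IsManifold 𝓘(ℝ, E n) ∞ N] {x y : N → ℙ ℝ (V n)} {W W' : Set N} {X X' Y Y' : N → V n} {q : N}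

theorem IsFrame.mono {W₁ : Set N} (h : IsFrame x y W X Y) (hW₁ : IsOpen W₁) (hsub : W₁ ⊆ W) :
    IsFrame x y W₁ X Y :=
  ⟨h.1.mono hW₁ hsub, h.2.1.mono hW₁ hsub, fun q hq => h.2.2 q (hsub hq)⟩

theorem mem_polar_iff {f : N → ℙ ℝ (V n)} (h : IsLift f W Y) (hq : q ∈ W) {w : V n} :
    w ∈ polar (f q) ↔ lor n (Y q) w = 0 := by
  rw [polar, h.submodule_eq hq]
  constructor
  · intro hw
    exact hw _ (Submodule.mem_span_singleton_self _)
  · intro hw v hv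
    obtain ⟨a, rfl⟩ := Submodule.mem_span_singleton.1 hv
    change lor n (a • Y q) w = 0
    rw [map_smul, LinearMap.smul_apply, hw, smul_zero]

/-- The vertices of a moving frame and their differentials satisfy the structure relations. -/
theorem IsFrame.isFramePoint (hx : IsLightlikeHypersurface x y) (hr : HasMaximalRank y)
    (h : IsFrame x y W X Y) (hq : q ∈ W) :
    IsFramePoint (X q) (Y q) (dif X q : TangentSpace 𝓘(ℝ, E n) q →ₗ[ℝ] V n)
      (dif Y q : TangentSpace 𝓘(ℝ, E n) q →ₗ[ℝ] V n) := by
  obtain ⟨hX, hY, hXX⟩ := h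
  have htan : ∀ r ∈ W, Submodule.span ℝ {X r} ⊔
      LinearMap.range (dif X r : TangentSpace 𝓘(ℝ, E n) r →ₗ[ℝ] V n) = polar (y r) := by
    intro r hr
    rw [← hX.tangentSubspace_eq hr, hx.tangent_eq]
  have hXY : ∀ r ∈ W, lor n (X r) (Y r) = 0 := by
    intro r hr
    rw [lor_comm, ← mem_polar_iff hY hr, ← htan r hr]
    exact Submodule.mem_sup_left (Submodule.mem_span_singleton_self _)
  have hXdY : ∀ r ∈ W, ∀ v, lor n (Y r) (dif X r v) = 0 := by
    intro r hr v
    rw [← mem_polar_iff hY hr, ← htan r hr]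
    exact Submodule.mem_sup_right ⟨v, rfl⟩
  have hYY : ∀ r ∈ W, lor n (Y r) (Y r) = 0 := fun r hr =>
    hx.contact_mem r _ (hY.mem_submodule hr)
  have hqp := mem_chart_source (E n) q
  let u := chartAt (E n) q q
  let U := coordSet (n := n) q W
  have hU : IsOpen U := isOpen_coordSet hX.1
  have hu : u ∈ U := mem_coordSet hq hqp
  have hdX := differentiableAt_coord hqp hX.1 hq hX.2.1
  have hdY := differentiableAt_coord hqp hY.1 hq hY.2.1
  have hcX : coord q X u = X q := coord_chart X hqp
  have hcY : coord q Y u = Y q := coord_chart Y hqp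
  have eX : ∀ v, dif X q v = fderiv ℝ (coord q X) u (chartEquiv q hqp v) :=
    dif_eq_coord hX.1 hX.2.1 hq hqp
  have eY : ∀ v, dif Y q v = fderiv ℝ (coord q Y) u (chartEquiv q hqp v) :=
    dif_eq_coord hY.1 hY.2.1 hq hqp
  have half : ∀ {a : ℝ}, a + a = 0 → a = 0 := fun h => by linarith
  refine ⟨finrank_tangentSpace q, hXX q hq, hYY q hq, hY.ne_zero hq, hXY q hq, fun v => ?_,
    hXdY q hq, fun v => ?_, fun v => ?_, fun v w => ?_, ?_, ?_⟩
  · have h1 := lor_fderiv_eq hU hu hdX hdX (c := 1) (fun u hu => hXX _ hu.2) (chartEquiv q hqp v)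
    rw [lor_comm] at h1
    change lor n (X q) (dif X q v) = 0
    rw [eX, ← hcX]
    exact half h1
  · have h1 := lor_fderiv_eq hU hu hdX hdY (c := 0) (fun u hu => hXY _ hu.2) (chartEquiv q hqp v)
    rw [← eX, ← eY, hcX, hcY, lor_comm, hXdY q hq, zero_add] at h1
    exact h1
  · have h1 := lor_fderiv_eq hU hu hdY hdY (c := 0) (fun u hu => hYY _ hu.2) (chartEquiv q hqp v)
    rw [lor_comm] at h1
    change lor n (Y q) (dif Y q v) = 0
    rw [eY, ← hcY]
    exact half h1
  · change lor n (dif X q v) (dif Y q w) = lor n (dif X q w) (dif Y q v)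
    rw [eX, eX, eY, eY]
    refine lor_fderiv_symm hU (contDiffOn_coord hX.2.1) (contDiffOn_coord hY.2.1) ?_ hu _ _
    intro u' hu' v'
    have hrp : (chartAt (E n) q).symm u' ∈ (chartAt (E n) q).source :=
      (chartAt (E n) q).map_target hu'.1
    have h1 := hXdY _ hu'.2 ((chartEquiv q hrp).symm v')
    rw [dif_eq_coord hX.1 hX.2.1 hu'.2 hrp, ContinuousLinearEquiv.apply_symm_apply,
      (chartAt (E n) q).right_inv hu'.1, lor_comm] at h1
    exact h1
  -- The tangent subspace has dimension n + 1, of which X accounts for at most one; so dX has rank n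
  -- and is injective.
  · have h1 := hx.hypersurface q
    rw [hX.tangentSubspace_eq hq] at h1
    have h2 := Submodule.finrank_add_le_finrank_add_finrank (Submodule.span ℝ {X q})
      (LinearMap.range (dif X q : TangentSpace 𝓘(ℝ, E n) q →ₗ[ℝ] V n))
    rw [finrank_span_singleton (hX.ne_zero hq), h1] at h2
    have h3 := LinearMap.finrank_range_add_finrank_ker
      (dif X q : TangentSpace 𝓘(ℝ, E n) q →ₗ[ℝ] V n)
    rw [finrank_tangentSpace] at h3
    exact LinearMap.ker_eq_bot.1 (Submodule.finrank_eq_zero.1 (by omega))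
  · rw [← hY.tangentSubspace_eq hq]
    exact (hr q).2

theorem exists_isFrame (hx : IsLightlikeHypersurface x y) (hr : HasMaximalRank y) (q : N) :
    ∃ (W : Set N) (X Y : N → V n), q ∈ W ∧ IsFrame x y W X Y := by
  obtain ⟨W₁, X, hq₁, hX⟩ := hx.smooth q
  obtain ⟨W₂, Y, hq₂, hY⟩ := (hr q).1
  have hW := hX.1.inter hY.1
  have hpos : ∀ r ∈ W₁, 0 < lor n (X r) (X r) := fun r hr =>
    hx.exterior r _ (hX.mem_submodule hr) (hX.ne_zero hr)
  let ν : V n → V n := fun v => (Real.sqrt (lor n v v))⁻¹ • v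
  have hν : ContDiffOn ℝ ∞ ν {v | 0 < lor n v v} := by
    have h1 : ContDiffOn ℝ ∞ (fun v => lor n v v) {v | 0 < lor n v v} :=
      contDiffOn_lor contDiffOn_id contDiffOn_id
    exact ((h1.sqrt fun v hv => (ne_of_gt hv)).inv
      fun v hv => (Real.sqrt_pos.2 hv).ne').smul contDiffOn_id
  refine ⟨W₁ ∩ W₂, fun r => ν (X r), Y, ⟨hq₁, hq₂⟩, ⟨hW, ?_, ?_⟩,
    hY.mono hW Set.inter_subset_right, ?_⟩
  · exact hν.contMDiffOn.comp (hX.2.1.mono Set.inter_subset_left) fun r hr => hpos r hr.1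
  · intro r hr
    have hs := (Real.sqrt_pos.2 (hpos r hr.1)).ne'
    obtain ⟨h0, h1⟩ := hX.2.2 r hr.1
    refine ⟨smul_ne_zero (inv_ne_zero hs) h0, ?_⟩
    rw [h1, Projectivization.mk_eq_mk_iff']
    exact ⟨Real.sqrt (lor n (X r) (X r)), by rw [smul_smul, mul_inv_cancel₀ hs, one_smul]⟩
  · intro r hr
    have hs := Real.mul_self_sqrt (hpos r hr.1).le
    have hs0 := (Real.sqrt_pos.2 (hpos r hr.1)).ne'
    change lor n ((Real.sqrt (lor n (X r) (X r)))⁻¹ • X r)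
      ((Real.sqrt (lor n (X r) (X r)))⁻¹ • X r) = 1
    rw [map_smul, map_smul, LinearMap.smul_apply, smul_eq_mul, smul_eq_mul]
    generalize Real.sqrt (lor n (X r) (X r)) = t at *
    rw [← hs]
    field_simp

/-- A change of frame multiplies X and, by the normalization, also dX by the same number a, and it
multiplies Y and, modulo Y, dY by some b. For the same point b s' = a s, so dX + s dY only acquires
the factor a modulo Y. -/
theorem IsFrame.focalKer_eq (hx : IsLightlikeHypersurface x y) (hr : HasMaximalRank y)
    (h : IsFrame x y W X Y) (h' : IsFrame x y W' X' Y') (hq : q ∈ W) (hq' : q ∈ W') {s s' : ℝ}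
    (hs : Submodule.span ℝ {X q + s • Y q} = Submodule.span ℝ {X' q + s' • Y' q}) :
    focalKer (Y q) (dif X q : TangentSpace 𝓘(ℝ, E n) q →ₗ[ℝ] V n) (dif Y q) s =
      focalKer (Y' q) (dif X' q : TangentSpace 𝓘(ℝ, E n) q →ₗ[ℝ] V n) (dif Y' q) s' := by
  have hp := h.isFramePoint hx hr hq
  have hp' := h'.isFramePoint hx hr hq'
  obtain ⟨a, ha0, ha, had⟩ := h.1.exists_proportional h'.1 hq hq'
  obtain ⟨b, hb0, hb, hbd⟩ := h.2.1.exists_proportional h'.2.1 hq hq'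
  have hdX : ∀ v, dif X' q v = a • dif X q v := by
    intro v
    obtain ⟨c, hc⟩ := Submodule.mem_span_singleton.1 (had v)
    have h1 : lor n (X q) (dif X' q v) = 0 := by
      have h2 : lor n (X' q) (dif X' q v) = 0 := hp'.xP v
      rw [ha, map_smul, LinearMap.smul_apply, smul_eq_zero] at h2
      exact h2.resolve_left ha0
    have h2 : lor n (X q) (dif X q v) = 0 := hp.xP v
    have h3 := congrArg (lor n (X q)) hc
    rw [map_smul, hp.xx, map_sub, map_smul, h1, h2, smul_zero, sub_zero, smul_eq_mul,
      mul_one] at h3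
    rw [h3, zero_smul] at hc
    exact sub_eq_zero.1 hc.symm
  have hbs : b * s' = a * s := by
    have h1 : X' q + s' • Y' q ∈ Submodule.span ℝ {X q + s • Y q} := by
      rw [hs]
      exact Submodule.mem_span_singleton_self _
    obtain ⟨c, hc⟩ := Submodule.mem_span_singleton.1 h1
    rw [ha, hb] at hc
    have h2 : (c - a) • X q + (c * s - s' * b) • Y q = 0 := by
      have : (c - a) • X q + (c * s - s' * b) • Y q =
          c • (X q + s • Y q) - (a • X q + s' • b • Y q) := by module
      rw [this, hc, sub_self]
    have h3 := LinearIndependent.pair_iff.1 hp.linearIndependent _ _ h2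
    have h4 : c = a := by linarith [h3.1]
    rw [← h4]
    linarith [h3.2]
  have hspan : Submodule.span ℝ {Y' q} = Submodule.span ℝ {Y q} := by
    rw [hb]
    exact Submodule.span_singleton_smul_eq hb0.isUnit _
  ext v
  rw [mem_focalKer, mem_focalKer, hspan]
  change dif X q v + s • dif Y q v ∈ _ ↔ dif X' q v + s' • dif Y' q v ∈ _
  have h5 : dif X' q v + s' • dif Y' q v = a • (dif X q v + s • dif Y q v) +
      s' • (dif Y' q v - b • dif Y q v) := by
    have : a • (dif X q v + s • dif Y q v) + s' • (dif Y' q v - b • dif Y q v) =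
      a • dif X q v + s' • dif Y' q v + (a * s - b * s') • dif Y q v := by module
    rw [this, hdX, hbs, sub_self, zero_smul, add_zero]
  rw [h5, Submodule.add_mem_iff_left _ (Submodule.smul_mem _ _ (hbd v))]
  exact (Submodule.smul_mem_iff _ ha0).symm

end Frame

/-! ### The matrices g and λ, and multiplicity as a dimension. -/

section FundamentalPair

open Matrix

variable {n : ℕ} {T : Type*} [AddCommGroup T] [Module ℝ T] [FiniteDimensional ℝ T]
  {x y : V n} {P Q : T →ₗ[ℝ] V n}

/-- A linear map that is injective modulo a subspace has a left inverse that vanishes there. -/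
theorem exists_leftInverse_mod {F G : Type*} [AddCommGroup F] [Module ℝ F] [AddCommGroup G]
    [Module ℝ G] (S : Submodule ℝ F) (a : G →ₗ[ℝ] F) (ha : ∀ c, a c ∈ S → c = 0) :
    ∃ L : F →ₗ[ℝ] G, (∀ c, L (a c) = c) ∧ ∀ w ∈ S, L w = 0 := by
  obtain ⟨ℓ, hℓ⟩ := (S.mkQ ∘ₗ a).exists_leftInverse_of_injective (by
    rw [LinearMap.ker_comp, Submodule.ker_mkQ, Submodule.eq_bot_iff]
    exact ha)
  refine ⟨ℓ ∘ₗ S.mkQ, fun c => LinearMap.congr_fun hℓ c, fun w hw => ?_⟩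
  have : S.mkQ w = 0 := by simpa using hw
  rw [LinearMap.comp_apply, this, map_zero]

/-- The pointwise form of `IsFundamentalPair`. -/
def IsPair (x y : V n) (P Q : T →ₗ[ℝ] V n) (g lam : Matrix (Fin (n - 1)) (Fin (n - 1)) ℝ) : Prop :=
  ∃ (A : Fin (n - 1) → V n) (ω₀ ωₙ : Fin (n - 1) → T →ₗ[ℝ] ℝ),
    (∀ i, lor n (A i) x = 0) ∧
    Submodule.span ℝ {y} ⊔ Submodule.span ℝ (Set.range A) =
      Submodule.span ℝ {y} ⊔ LinearMap.range Q ∧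
    (∀ v, Q v - ∑ i, ω₀ i v • A i ∈ Submodule.span ℝ {y}) ∧
    (∀ v, P v - ∑ i, ωₙ i v • A i ∈ Submodule.span ℝ {y}) ∧
    (∀ i j, g i j = lor n (A i) (A j)) ∧
    (∀ i v, -∑ j, g i j * ωₙ j v = ∑ j, lam i j * ω₀ j v)

variable {g lam : Matrix (Fin (n - 1)) (Fin (n - 1)) ℝ}

namespace IsFramePoint

/-- The line of y sits in a space of dimension n. This keeps the truncated subtraction n - 1
meaningful. -/
theorem one_le (h : IsFramePoint x y P Q) : 1 ≤ n := by
  have := finrank_sup_range (Submodule.span ℝ {y}) Q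
  rw [h.finrank_Q, finrank_span_singleton h.y_ne, h.finrank_eq, h.finrank_comap_Q] at this
  have h2 := Submodule.finrank_mono (le_sup_left :
    Submodule.span ℝ {y} ≤ Submodule.span ℝ {y} ⊔ LinearMap.range Q)
  rwa [finrank_span_singleton h.y_ne, h.finrank_Q] at h2

/-- Let Ω₀, Ωₙ be the coordinates of Q, P modulo y. Ω₀ is onto, with the generator direction as
kernel. g is the Gram matrix of a complement of y in {x, y}^⊥, hence positive definite; λ represents
-(P, Q), hence is symmetric. Since (λ - s g)Ω₀ = -g(Ωₙ + sΩ₀), the kernel of the pencil pulls back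
to K, and the summand 1 is ker Ω₀. -/
theorem pair_properties (h : IsFramePoint x y P Q) (hp : IsPair x y P Q g lam) :
    g.IsSymm ∧ (∀ u : Fin (n - 1) → ℝ, u ≠ 0 → 0 < u ⬝ᵥ g *ᵥ u) ∧ lam.IsSymm ∧
      ∀ s, Module.finrank ℝ (LinearMap.ker (lam - s • g).mulVecLin) + 1 =
        Module.finrank ℝ (focalKer y P Q s) := by
  obtain ⟨A, ω₀, ωₙ, -, hspan, h₀, hₙ, hg, hlam⟩ := hp
  have h1n := h.one_le
  let a : (Fin (n - 1) → ℝ) →ₗ[ℝ] V n := Fintype.linearCombination ℝ A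
  have ha : ∀ c, a c = ∑ i, c i • A i := fun c => rfl
  have hra : LinearMap.range a = Submodule.span ℝ (Set.range A) :=
    Fintype.range_linearCombination ℝ A
  have hinj : ∀ c, a c ∈ Submodule.span ℝ {y} → c = 0 := by
    have h1 := finrank_sup_range (Submodule.span ℝ {y}) a
    rw [hra, hspan, h.finrank_Q, finrank_span_singleton h.y_ne, Module.finrank_fin_fun] at h1
    have h2 : (Submodule.span ℝ {y}).comap a = ⊥ := Submodule.finrank_eq_zero.1 (by omega)
    intro c hc
    have h3 : c ∈ (Submodule.span ℝ {y}).comap a := hc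
    rw [h2] at h3
    exact h3
  let Ω₀ : T →ₗ[ℝ] Fin (n - 1) → ℝ := LinearMap.pi ω₀
  let Ωₙ : T →ₗ[ℝ] Fin (n - 1) → ℝ := LinearMap.pi ωₙ
  have h₀' : ∀ v, Q v - a (Ω₀ v) ∈ Submodule.span ℝ {y} := h₀
  have hₙ' : ∀ v, P v - a (Ωₙ v) ∈ Submodule.span ℝ {y} := hₙ
  have hker : LinearMap.ker Ω₀ = (Submodule.span ℝ {y}).comap Q := by
    ext v
    rw [LinearMap.mem_ker, Submodule.mem_comap]
    constructor
    · intro hv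
      simpa [hv] using h₀' v
    · intro hv
      exact hinj _ (by simpa using sub_mem hv (h₀' v))
  have hrank := LinearMap.finrank_range_add_finrank_ker Ω₀
  rw [hker, h.finrank_comap_Q, h.finrank_eq] at hrank
  have hsurj : Function.Surjective Ω₀ := by
    rw [← LinearMap.range_eq_top]
    refine Submodule.eq_top_of_finrank_eq ?_
    rw [Module.finrank_fin_fun]
    omega
  have hay : ∀ c, lor n y (a c) = 0 := by
    intro c
    obtain ⟨v, rfl⟩ := hsurj c
    have h1 := lor_eq_zero_of_mem_span (h₀' v) h.yy
    rw [map_sub, h.yQ, zero_sub, neg_eq_zero] at h1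
    exact h1
  have hgram : ∀ c c', c ⬝ᵥ g *ᵥ c' = lor n (a c) (a c') := by
    intro c c'
    rw [ha c, map_sum, LinearMap.sum_apply, dotProduct]
    refine Finset.sum_congr rfl fun i _ => ?_
    rw [map_smul, LinearMap.smul_apply, ha c', map_sum, smul_eq_mul, mulVec, dotProduct]
    congr 1
    refine Finset.sum_congr rfl fun j _ => ?_
    rw [map_smul, hg, smul_eq_mul, mul_comm]
  have hgs : g.IsSymm := Matrix.IsSymm.ext fun i j => by rw [hg, hg, lor_comm]
  have hpos : ∀ u : Fin (n - 1) → ℝ, u ≠ 0 → 0 < u ⬝ᵥ g *ᵥ u := by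
    intro u hu
    rw [hgram]
    refine lt_of_le_of_ne (lor_self_nonneg h.yy h.y_ne (hay u)) fun h0 => hu ?_
    exact hinj u (h.mem_span_of_null (hay u) h0.symm)
  have hrel : ∀ v, lam *ᵥ Ω₀ v = -(g *ᵥ Ωₙ v) := by
    intro v
    ext i
    exact (hlam i v).symm
  have hPQ : ∀ v w, lor n (a (Ωₙ v)) (a (Ω₀ w)) = lor n (P v) (Q w) := by
    intro v w
    obtain ⟨b, hb⟩ := Submodule.mem_span_singleton.1 (hₙ' v)
    obtain ⟨c, hc⟩ := Submodule.mem_span_singleton.1 (h₀' w)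
    have e1 : P v = a (Ωₙ v) + b • y := by rw [hb]; abel
    have e2 : Q w = a (Ω₀ w) + c • y := by rw [hc]; abel
    rw [e1, e2]
    simp only [map_add, map_smul, LinearMap.add_apply, LinearMap.smul_apply, hay, h.yy,
      lor_comm (a _) y, smul_zero, add_zero]
  have hls : lam.IsSymm := by
    have h1 : ∀ c c', c ⬝ᵥ lam *ᵥ c' = c' ⬝ᵥ lam *ᵥ c := by
      intro c c'
      obtain ⟨v, rfl⟩ := hsurj c
      obtain ⟨w, rfl⟩ := hsurj c'
      rw [hrel, hrel, dotProduct_neg, dotProduct_neg, hgram, hgram, lor_comm (a (Ω₀ v)),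
        lor_comm (a (Ω₀ w)), hPQ, hPQ, h.symm]
    refine Matrix.IsSymm.ext fun i j => ?_
    have := h1 (Pi.single j 1) (Pi.single i 1)
    simpa using this
  refine ⟨hgs, hpos, hls, fun s => ?_⟩
  have hk : LinearMap.ker ((lam - s • g).mulVecLin ∘ₗ Ω₀) = focalKer y P Q s := by
    ext v
    rw [LinearMap.mem_ker, LinearMap.comp_apply, mulVecLin_apply, sub_mulVec, hrel, smul_mulVec,
      mem_focalKer]
    have e1 : -(g *ᵥ Ωₙ v) - s • g *ᵥ Ω₀ v = -(g *ᵥ (Ωₙ v + s • Ω₀ v)) := by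
      rw [mulVec_add, mulVec_smul]
      abel
    have e2 : P v + s • Q v = a (Ωₙ v + s • Ω₀ v) +
        ((P v - a (Ωₙ v)) + s • (Q v - a (Ω₀ v))) := by
      rw [map_add, map_smul, smul_sub]
      abel
    rw [e1, neg_eq_zero, e2, Submodule.add_mem_iff_left _
      (add_mem (hₙ' v) (Submodule.smul_mem _ _ (h₀' v)))]
    constructor
    · intro h0
      have : Ωₙ v + s • Ω₀ v = 0 := by
        by_contra hne
        have := hpos _ hne
        rw [h0, dotProduct_zero] at this
        exact lt_irrefl _ this
      rw [this, map_zero]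
      exact zero_mem _
    · intro h0
      rw [hinj _ h0, mulVec_zero]
  have e1 := LinearMap.finrank_range_add_finrank_ker ((lam - s • g).mulVecLin ∘ₗ Ω₀)
  have e2 := LinearMap.finrank_range_add_finrank_ker (lam - s • g).mulVecLin
  rw [LinearMap.range_comp_of_range_eq_top _ (LinearMap.range_eq_top.2 hsurj), hk,
    h.finrank_eq] at e1
  rw [Module.finrank_fin_fun] at e2
  omega

theorem multiplicity_eq (h : IsFramePoint x y P Q) (hp : IsPair x y P Q g lam) (s : ℝ) :
    (charPolynomial g lam).rootMultiplicity s + 1 = Module.finrank ℝ (focalKer y P Q s) := by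
  obtain ⟨h1, h2, h3, h4⟩ := h.pair_properties hp
  rw [rootMultiplicity_charPolynomial h1 h2 h3, h4]

/-- The matrices `g` and `λ` for the frame points `A_i = dA_0(v_i)`. -/
theorem isPair_gram (h : IsFramePoint x y P Q) (v : Fin (n - 1) → T)
    (hg : ∀ i j, g i j = lor n (Q (v i)) (Q (v j)))
    (hlam : ∀ i j, lam i j = -lor n (P (v i)) (Q (v j))) (hdet : g.det ≠ 0) :
    IsPair x y P Q g lam := by
  let A : Fin (n - 1) → V n := fun i => Q (v i)
  let a : (Fin (n - 1) → ℝ) →ₗ[ℝ] V n := Fintype.linearCombination ℝ A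
  have ha : ∀ c, a c = ∑ i, c i • A i := fun c => rfl
  have hra : LinearMap.range a = Submodule.span ℝ (Set.range A) :=
    Fintype.range_linearCombination ℝ A
  have hinj : ∀ c, a c ∈ Submodule.span ℝ {y} → c = 0 := by
    intro c hc
    refine Matrix.eq_zero_of_mulVec_eq_zero hdet ?_
    ext i
    have h1 := lor_eq_zero_of_mem_span hc (v := A i) (by rw [lor_comm]; exact h.yQ _)
    rw [ha, map_sum] at h1
    simp only [map_smul, smul_eq_mul] at h1
    simp only [mulVec, dotProduct, hg, Pi.zero_apply]
    rw [← h1]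
    exact Finset.sum_congr rfl fun j _ => mul_comm _ _
  have h1n := h.one_le
  have hcomap : (Submodule.span ℝ {y}).comap a = ⊥ := by
    rw [Submodule.eq_bot_iff]
    exact hinj
  have hsup : Submodule.span ℝ {y} ⊔ Submodule.span ℝ (Set.range A) =
      Submodule.span ℝ {y} ⊔ LinearMap.range Q := by
    refine Submodule.eq_of_le_of_finrank_eq (sup_le_sup_left ?_ _) ?_
    · rw [Submodule.span_le]
      rintro _ ⟨i, rfl⟩
      exact ⟨v i, rfl⟩
    · have h1 := finrank_sup_range (Submodule.span ℝ {y}) a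
      rw [hcomap, finrank_bot, finrank_span_singleton h.y_ne, Module.finrank_fin_fun, hra] at h1
      rw [h.finrank_Q]
      omega
  -- L reads off coordinates with respect to the Aᵢ modulo y; composed with Q and P it gives the
  -- forms ω₀ and ωₙ.
  obtain ⟨L, hLa, hLy⟩ := exists_leftInverse_mod (Submodule.span ℝ {y}) a hinj
  have hdec : ∀ w, lor n x w = 0 → lor n y w = 0 → w - a (L w) ∈ Submodule.span ℝ {y} := by
    intro w h1 h2
    have h3 := h.mem_sup_range_Q h1 h2
    rw [← hsup, ← hra] at h3
    obtain ⟨b, hb, _, ⟨c, rfl⟩, rfl⟩ := Submodule.mem_sup.1 h3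
    rw [map_add, hLy b hb, hLa, zero_add, add_sub_cancel_right]
    exact hb
  have hlor : ∀ u w, lor n y u = 0 → lor n x w = 0 → lor n y w = 0 →
      ∑ j, L w j * lor n u (A j) = lor n u w := by
    intro u w hu h1 h2
    have h3 := lor_eq_zero_of_mem_span (hdec w h1 h2) (v := u) (by rw [lor_comm, hu])
    rw [map_sub, sub_eq_zero, ha, map_sum] at h3
    rw [h3]
    simp only [map_smul, smul_eq_mul]
  let co : (T →ₗ[ℝ] V n) → Fin (n - 1) → T →ₗ[ℝ] ℝ := fun R i => LinearMap.proj i ∘ₗ L ∘ₗ R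
  have h_co : ∀ R i w, co R i w = L (R w) i := fun _ _ _ => rfl
  have hAx : ∀ i, lor n (A i) x = 0 := fun i => by
    rw [lor_comm]
    exact h.xQ (v i)
  have h_coQ : ∀ w, Q w - ∑ i, co Q i w • A i ∈ Submodule.span ℝ {y} := fun w => by
    simp only [h_co]
    rw [← ha]
    exact hdec _ (h.xQ w) (h.yQ w)
  have h_coP : ∀ w, P w - ∑ i, co P i w • A i ∈ Submodule.span ℝ {y} := fun w => by
    simp only [h_co]
    rw [← ha]
    exact hdec _ (h.xP w) (h.yP w)
  refine ⟨A, co Q, co P, hAx, hsup, h_coQ, h_coP, hg, fun i w => ?_⟩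
  simp only [hg, hlam, h_co]
  have e1 := hlor (Q (v i)) (P w) (h.yQ _) (h.xP w) (h.yP w)
  have e2 := hlor (P (v i)) (Q w) (h.yP _) (h.xQ w) (h.yQ w)
  have e3 : ∑ j, lor n (Q (v i)) (Q (v j)) * L (P w) j = lor n (Q (v i)) (P w) := by
    rw [← e1]
    exact Finset.sum_congr rfl fun j _ => mul_comm _ _
  have e4 : ∑ j, -lor n (P (v i)) (Q (v j)) * L (Q w) j = -lor n (P (v i)) (Q w) := by
    rw [← e2, ← Finset.sum_neg_distrib]
    exact Finset.sum_congr rfl fun j _ => by ring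
  rw [e3, e4, lor_comm, h.symm]

/-- Take a basis of a complement of the generator direction. A vector in the kernel of the Gram
matrix would give r in the complement with Q r null, so Q r is a multiple of y and r = 0. -/
theorem exists_gram_det_ne_zero (h : IsFramePoint x y P Q) :
    ∃ v : Fin (n - 1) → T, ∀ g : Matrix (Fin (n - 1)) (Fin (n - 1)) ℝ,
      (∀ i j, g i j = lor n (Q (v i)) (Q (v j))) → g.det ≠ 0 := by
  have h1n := h.one_le
  obtain ⟨R, hR⟩ := ((Submodule.span ℝ {y}).comap Q).exists_isCompl
  have hfin : Module.finrank ℝ R = n - 1 := by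
    have := Submodule.finrank_add_eq_of_isCompl hR
    rw [h.finrank_comap_Q, h.finrank_eq] at this
    omega
  let b := Module.finBasisOfFinrankEq ℝ R hfin
  refine ⟨fun i => b i, fun g hg h0 => ?_⟩
  obtain ⟨c, hc0, hc⟩ := Matrix.exists_mulVec_eq_zero_iff.2 h0
  let r : R := ∑ i, c i • b i
  have hr : (r : T) = ∑ i, c i • (b i : T) := by
    simp only [r, Submodule.coe_sum, Submodule.coe_smul]
  have h1 : lor n (Q r) (Q r) = 0 := by
    have h2 : ∀ i, lor n (Q (b i)) (Q r) = 0 := by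
      intro i
      have h3 := congrFun hc i
      simp only [mulVec, dotProduct, hg, Pi.zero_apply] at h3
      rw [hr, map_sum, map_sum, ← h3]
      refine Finset.sum_congr rfl fun j _ => ?_
      rw [map_smul, map_smul, smul_eq_mul, mul_comm]
    nth_rewrite 1 [hr]
    rw [map_sum, map_sum, LinearMap.sum_apply]
    refine Finset.sum_eq_zero fun i _ => ?_
    rw [map_smul, map_smul, LinearMap.smul_apply, h2, smul_zero]
  have h2 : (r : T) = 0 := Submodule.disjoint_def.1 hR.disjoint _
    (h.mem_span_of_null (h.yQ r) h1) r.2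
  have h3 : r = 0 := Subtype.ext h2
  exact hc0 (funext (Fintype.linearIndependent_iff.1 b.linearIndependent c h3))

theorem exists_isPair (h : IsFramePoint x y P Q) :
    ∃ g lam : Matrix (Fin (n - 1)) (Fin (n - 1)) ℝ, IsPair x y P Q g lam := by
  obtain ⟨v, hv⟩ := h.exists_gram_det_ne_zero
  exact ⟨Matrix.of fun i j => lor n (Q (v i)) (Q (v j)),
    Matrix.of fun i j => -lor n (P (v i)) (Q (v j)),
    h.isPair_gram v (fun _ _ => rfl) (fun _ _ => rfl) (hv _ fun _ _ => rfl)⟩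

end IsFramePoint

end FundamentalPair

/-! ### Singular points and multiplicities in a given frame. -/

section Multiplicity

variable {n : ℕ} {N : Type*} [TopologicalSpace N] [ChartedSpace (E n) N]
  [IsManifold 𝓘(ℝ, E n) ∞ N] {x y : N → ℙ ℝ (V n)} {W W' : Set N} {X X' Y Y' : N → V n} {q : N}
  {z : ℙ ℝ (V n)}

/-- The directions in which the point `X + s Y` is displaced along the generator. -/
abbrev frameKer (X Y : N → V n) (q : N) (s : ℝ) : Submodule ℝ (TangentSpace 𝓘(ℝ, E n) q) :=
  focalKer (Y q) (dif X q : TangentSpace 𝓘(ℝ, E n) q →ₗ[ℝ] V n)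
    (dif Y q : TangentSpace 𝓘(ℝ, E n) q →ₗ[ℝ] V n) s

theorem isFundamentalPair_iff {g lam : Matrix (Fin (n - 1)) (Fin (n - 1)) ℝ} :
    IsFundamentalPair X Y q g lam ↔
      IsPair (X q) (Y q) (dif X q : TangentSpace 𝓘(ℝ, E n) q →ₗ[ℝ] V n)
        (dif Y q : TangentSpace 𝓘(ℝ, E n) q →ₗ[ℝ] V n) g lam := Iff.rfl

theorem IsFrame.exists_param (h : IsFrame x y W X Y)
    (h' : IsFrame x y W' X' Y') (hq : q ∈ W) (hq' : q ∈ W') (s' : ℝ) :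
    ∃ s : ℝ, Submodule.span ℝ {X' q + s' • Y' q} = Submodule.span ℝ {X q + s • Y q} := by
  obtain ⟨a, ha0, ha, -⟩ := h.1.exists_proportional h'.1 hq hq'
  obtain ⟨b, hb0, hb, -⟩ := h.2.1.exists_proportional h'.2.1 hq hq'
  refine ⟨s' * b / a, ?_⟩
  have h1 : X' q + s' • Y' q = a • (X q + (s' * b / a) • Y q) := by
    rw [ha, hb, smul_add, smul_smul, smul_smul]
    congr 2
    field_simp
  rw [h1]
  exact Submodule.span_singleton_smul_eq ha0.isUnit _

theorem IsFramePoint.param_injective {T : Type*} [AddCommGroup T] [Module ℝ T]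
    [FiniteDimensional ℝ T] {x y : V n} {P Q : T →ₗ[ℝ] V n} (h : IsFramePoint x y P Q) {s t : ℝ}
    (hst : Submodule.span ℝ {x + s • y} = Submodule.span ℝ {x + t • y}) : s = t := by
  have h1 : x + s • y ∈ Submodule.span ℝ {x + t • y} := by
    rw [← hst]
    exact Submodule.mem_span_singleton_self _
  obtain ⟨c, hc⟩ := Submodule.mem_span_singleton.1 h1
  have h2 : (c - 1) • x + (c * t - s) • y = 0 := by
    have : (c - 1) • x + (c * t - s) • y = c • (x + t • y) - (x + s • y) := by module
    rw [this, hc, sub_self]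
  have h3 := LinearIndependent.pair_iff.1 h.linearIndependent _ _ h2
  have h4 : c = 1 := by linarith [h3.1]
  rw [h4] at h3
  linarith [h3.2]

/-- The multiplicity of a point of a generator in terms of a given frame. -/
theorem hasMultiplicity_iff (hx : IsLightlikeHypersurface x y) (hr : HasMaximalRank y)
    (h : IsFrame x y W X Y) (hq : q ∈ W) {m : ℕ} :
    HasMultiplicity x y q z m ↔ ∃ s : ℝ, z.submodule = Submodule.span ℝ {X q + s • Y q} ∧
      Module.finrank ℝ (frameKer X Y q s) = m + 1 := by
  constructor
  · rintro ⟨W', X', Y', s', g, lam, hq', h', hp, hz, hm⟩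
    obtain ⟨s, hs⟩ := h.exists_param h' hq hq' s'
    refine ⟨s, by rw [hz, hs], ?_⟩
    rw [frameKer, h.focalKer_eq hx hr h' hq hq' hs.symm,
      ← (h'.isFramePoint hx hr hq').multiplicity_eq (isFundamentalPair_iff.1 hp), hm]
  · rintro ⟨s, hz, hm⟩
    have hf := h.isFramePoint hx hr hq
    obtain ⟨g, lam, hp⟩ := hf.exists_isPair
    have h1 := hf.multiplicity_eq hp s
    exact ⟨W, X, Y, s, g, lam, hq, h, isFundamentalPair_iff.2 hp, hz, by
      rw [hm] at h1
      exact Nat.succ_injective h1⟩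

/-- Together with `hasMultiplicity_iff` this identifies the singular points with the roots of the
characteristic equation. -/
theorem isSingularPoint_iff (hx : IsLightlikeHypersurface x y) (hr : HasMaximalRank y)
    (h : IsFrame x y W X Y) (hq : q ∈ W) :
    IsSingularPoint x y q z ↔ ∃ s : ℝ, z.submodule = Submodule.span ℝ {X q + s • Y q} ∧
      2 ≤ Module.finrank ℝ (frameKer X Y q s) := by
  constructor
  · rintro ⟨W', X', Y', α, β, hq', h', hz, hlt⟩
    have hf := h'.isFramePoint hx hr hq'
    -- α = 0 is the contact point, which is never singular; every other point of the line is X' +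
    -- (β/α) Y'.
    have hα : α ≠ 0 := by
      rintro rfl
      have hβ : β ≠ 0 := by
        rintro rfl
        have h1 := z.finrank_submodule
        rw [hz, zero_smul, zero_smul, add_zero, Submodule.span_zero_singleton, finrank_bot] at h1
        exact zero_ne_one h1
      have h1 := hf.finrank_nonsingular_Q hβ
      rw [zero_smul, zero_add] at hlt
      change Module.finrank ℝ ↥(Submodule.span ℝ {X' q, Y' q} ⊔ LinearMap.range (β •
        (dif Y' q : TangentSpace 𝓘(ℝ, E n) q →ₗ[ℝ] V n))) < n + 1 at hlt
      omega
    have h1 := hf.finrank_singular (β / α)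
    have h2 : LinearMap.range (α • dif X' q + β • dif Y' q :
        TangentSpace 𝓘(ℝ, E n) q →ₗ[ℝ] V n) = LinearMap.range
        ((dif X' q : TangentSpace 𝓘(ℝ, E n) q →ₗ[ℝ] V n) +
          (β / α) • (dif Y' q : TangentSpace 𝓘(ℝ, E n) q →ₗ[ℝ] V n)) := by
      rw [← LinearMap.range_smul ((dif X' q : TangentSpace 𝓘(ℝ, E n) q →ₗ[ℝ] V n) +
        (β / α) • (dif Y' q : TangentSpace 𝓘(ℝ, E n) q →ₗ[ℝ] V n)) α hα, smul_add, smul_smul,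
        mul_div_cancel₀ _ hα]
    have h3 : Submodule.span ℝ {α • X' q + β • Y' q} =
        Submodule.span ℝ {X' q + (β / α) • Y' q} := by
      have : α • X' q + β • Y' q = α • (X' q + (β / α) • Y' q) := by
        rw [smul_add, smul_smul, mul_div_cancel₀ _ hα]
      rw [this]
      exact Submodule.span_singleton_smul_eq hα.isUnit _
    rw [h2] at hlt
    obtain ⟨s, hs⟩ := h.exists_param h' hq hq' (β / α)
    refine ⟨s, by rw [hz, h3, hs], ?_⟩
    rw [frameKer, h.focalKer_eq hx hr h' hq hq' hs.symm]
    omega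
  · rintro ⟨s, hz, hs⟩
    have h1 := (h.isFramePoint hx hr hq).finrank_singular s
    refine ⟨W, X, Y, 1, s, hq, h, by rw [one_smul, hz], ?_⟩
    rw [one_smul]
    have h2 : 2 ≤ Module.finrank ℝ (focalKer (Y q)
      (dif X q : TangentSpace 𝓘(ℝ, E n) q →ₗ[ℝ] V n)
      (dif Y q : TangentSpace 𝓘(ℝ, E n) q →ₗ[ℝ] V n) s) := hs
    change Module.finrank ℝ ↥(Submodule.span ℝ {X q, Y q} ⊔ LinearMap.range
      ((dif X q : TangentSpace 𝓘(ℝ, E n) q →ₗ[ℝ] V n) +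
        s • (dif Y q : TangentSpace 𝓘(ℝ, E n) q →ₗ[ℝ] V n))) < n + 1
    omega

theorem mem_deSitter_of_submodule_eq {v : V n} (hz : z.submodule = Submodule.span ℝ {v})
    (hv : lor n v v = 1) : z ∈ deSitter n := by
  intro w hw h0
  rw [hz] at hw
  obtain ⟨c, rfl⟩ := Submodule.mem_span_singleton.1 hw
  have hc : c ≠ 0 := by
    rintro rfl
    simp at h0
  rw [map_smul, map_smul, LinearMap.smul_apply, hv]
  simp only [smul_eq_mul, mul_one]
  exact mul_self_pos.2 hc

/-- Each generator carries `n - 1` real singular points, counted with multiplicity. -/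
theorem exists_singular_points (hx : IsLightlikeHypersurface x y) (hr : HasMaximalRank y) (q : N) :
    ∃ (S : Finset (ℙ ℝ (V n))) (μ : ℙ ℝ (V n) → ℕ),
      (∀ z, z ∈ S ↔ IsSingularPoint x y q z) ∧
      (∀ z ∈ S, z ∈ deSitter n ∧ HasMultiplicity x y q z (μ z) ∧ 1 ≤ μ z) ∧
      ∑ z ∈ S, μ z = n - 1 := by
  classical
  obtain ⟨W, X, Y, hq, h⟩ := exists_isFrame hx hr q
  have hf := h.isFramePoint hx hr hq
  obtain ⟨g, lam, hp⟩ := hf.exists_isPair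
  obtain ⟨hg, hpos, hl, -⟩ := hf.pair_properties hp
  have hmult := hf.multiplicity_eq hp
  have hne := charPolynomial_ne_zero hg hpos hl
  have hcard := card_roots_charPolynomial hg hpos hl
  let pt : ℝ → ℙ ℝ (V n) := fun s => Projectivization.mk ℝ (X q + s • Y q) hf.focus_ne_zero
  have hpt : ∀ s, (pt s).submodule = Submodule.span ℝ {X q + s • Y q} := fun s =>
    Projectivization.submodule_mk _ _
  have hptinj : Function.Injective pt := fun s t hst =>
    hf.param_injective (by rw [← hpt, ← hpt, hst])
  have hmem : ∀ s, s ∈ (charPolynomial g lam).roots.toFinset ↔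
      2 ≤ Module.finrank ℝ (frameKer X Y q s) := by
    intro s
    rw [Multiset.mem_toFinset, Polynomial.mem_roots hne, ← Polynomial.rootMultiplicity_pos hne,
      frameKer, ← hmult s]
    omega
  -- The multiplicity belongs to the parameter s; as `pt` is injective, s is recovered from the
  -- point.
  let μ : ℙ ℝ (V n) → ℕ := fun z =>
    (charPolynomial g lam).rootMultiplicity (Function.invFun pt z)
  have hμ : ∀ s, μ (pt s) = (charPolynomial g lam).rootMultiplicity s := fun s => by
    simp only [μ, Function.leftInverse_invFun hptinj s]
  refine ⟨(charPolynomial g lam).roots.toFinset.image pt, μ, fun z => ?_, fun z hz => ?_, ?_⟩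
  · rw [isSingularPoint_iff hx hr h hq, Finset.mem_image]
    constructor
    · rintro ⟨s, hs, rfl⟩
      exact ⟨s, hpt s, (hmem s).1 hs⟩
    · rintro ⟨s, hz, hs⟩
      exact ⟨s, (hmem s).2 hs, Projectivization.submodule_injective (by rw [hpt, hz])⟩
  · obtain ⟨s, hs, rfl⟩ := Finset.mem_image.1 hz
    have h1 := (hmem s).1 hs
    have h2 := hmult s
    rw [hμ]
    refine ⟨mem_deSitter_of_submodule_eq (hpt s) hf.lor_focus,
      (hasMultiplicity_iff hx hr h hq).2 ⟨s, hpt s, h2.symm⟩, ?_⟩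
    rw [frameKer] at h1
    omega
  · rw [Finset.sum_image fun s _ t _ hst => hptinj hst]
    simp only [hμ]
    rw [← hcard, ← Multiset.toFinset_sum_count_eq]
    exact Finset.sum_congr rfl fun s _ => (Polynomial.count_roots _).symm

end Multiplicity

/-! ### Roots of a polynomial that depends on parameters. -/

section ImplicitRoot

variable {n : ℕ}

/-- The implicit function theorem for one scalar equation. -/
theorem exists_implicit_root {h : E n × ℝ → ℝ} {Ω : Set (E n × ℝ)} (hΩ : IsOpen Ω)
    (hh : ContDiffOn ℝ ∞ h Ω) {u₀ : E n} {t₀ : ℝ} (hmem : (u₀, t₀) ∈ Ω) (h0 : h (u₀, t₀) = 0)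
    (hd : fderiv ℝ h (u₀, t₀) (0, 1) ≠ 0) :
    ∃ (σ : E n → ℝ) (U : Set (E n)) (O : Set (E n × ℝ)), IsOpen U ∧ u₀ ∈ U ∧ IsOpen O ∧
      (u₀, t₀) ∈ O ∧ O ⊆ Ω ∧ ContDiffOn ℝ ∞ σ U ∧ σ u₀ = t₀ ∧
      (∀ u ∈ U, (u, σ u) ∈ O ∧ h (u, σ u) = 0) ∧
      ∀ u t, (u, t) ∈ O → h (u, t) = 0 → u ∈ U ∧ t = σ u := by
  have hder : HasFDerivAt h (fderiv ℝ h (u₀, t₀)) (u₀, t₀) :=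
    ((hh.contDiffAt (hΩ.mem_nhds hmem)).differentiableAt (by simp)).hasFDerivAt
  -- Under Φ the zero set of h becomes the slice where the second coordinate is 0, which is the
  -- graph of σ read in the inverse chart.
  let Φ : E n × ℝ → E n × ℝ := fun z => (z.1, h z)
  have hΦ : ContDiffOn ℝ ∞ Φ Ω := contDiffOn_fst.prodMk hh
  let L : E n × ℝ →L[ℝ] E n × ℝ :=
    (ContinuousLinearMap.fst ℝ (E n) ℝ).prod (fderiv ℝ h (u₀, t₀))
  have hL : HasFDerivAt Φ L (u₀, t₀) := hasFDerivAt_fst.prodMk hder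
  have hinj : Function.Injective (L : E n × ℝ →ₗ[ℝ] E n × ℝ) := by
    rw [← LinearMap.ker_eq_bot, LinearMap.ker_eq_bot']
    rintro ⟨u, t⟩ hut
    have hu : u = 0 := congrArg Prod.fst hut
    have ht : fderiv ℝ h (u₀, t₀) (u, t) = 0 := congrArg Prod.snd hut
    have e : (u, t) = t • ((0, 1) : E n × ℝ) := by simp [hu]
    rw [e, map_smul, smul_eq_mul, mul_eq_zero] at ht
    rw [hu, ht.resolve_right hd]
    rfl
  let e : (E n × ℝ) ≃L[ℝ] E n × ℝ :=
    (LinearEquiv.ofInjectiveEndo _ hinj).toContinuousLinearEquiv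
  have he : (e : E n × ℝ →L[ℝ] E n × ℝ) = L := rfl
  obtain ⟨φ, hmem', hsub, hφ, hsymm, -⟩ :=
    exists_smooth_inverse hΩ hmem hΦ (f' := e) (by rw [he]; exact hL)
  have hkey : ∀ u, (u, (0 : ℝ)) ∈ φ.target → (φ.symm (u, 0)).1 = u ∧ h (φ.symm (u, 0)) = 0 := by
    intro u hu
    have h1 := φ.right_inv hu
    rw [hφ] at h1
    exact ⟨congrArg Prod.fst h1, congrArg Prod.snd h1⟩
  have huniq : ∀ u t, (u, t) ∈ φ.source → h (u, t) = 0 →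
      (u, (0 : ℝ)) ∈ φ.target ∧ t = (φ.symm (u, 0)).2 := by
    intro u t hut h1
    have h2 := φ.map_source hut
    have h3 := φ.left_inv hut
    have h4 : Φ (u, t) = (u, 0) := Prod.ext rfl h1
    rw [hφ, h4] at h2 h3
    exact ⟨h2, by rw [h3]⟩
  have heta : ∀ u, (u, (0 : ℝ)) ∈ φ.target → (u, (φ.symm (u, 0)).2) = φ.symm (u, 0) :=
    fun u hu => Prod.ext (hkey u hu).1.symm rfl
  refine ⟨fun u => (φ.symm (u, 0)).2, (fun u => (u, (0 : ℝ))) ⁻¹' φ.target, φ.source,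
    φ.open_target.preimage (by fun_prop), (huniq _ _ hmem' h0).1, φ.open_source, hmem', hsub,
    ?_, (huniq _ _ hmem' h0).2.symm, fun u hu => ?_, huniq⟩
  · exact contDiff_snd.comp_contDiffOn (hsymm.comp (by fun_prop) fun u hu => hu)
  · rw [heta u hu]
    exact ⟨φ.map_target hu, (hkey u hu).2⟩

variable {U : Set (E n)}

/-- A polynomial whose values depend smoothly on a parameter has smooth derivatives. -/
theorem contDiffOn_iterate_derivative (hU : IsOpen U) {p : E n → Polynomial ℝ}
    (hp : ContDiffOn ℝ ∞ (fun z : E n × ℝ => (p z.1).eval z.2) (U ×ˢ Set.univ)) (j : ℕ) :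
    ContDiffOn ℝ ∞ (fun z : E n × ℝ => (Polynomial.derivative^[j] (p z.1)).eval z.2)
        (U ×ˢ Set.univ) ∧
      ∀ z ∈ U ×ˢ Set.univ,
        fderiv ℝ (fun z : E n × ℝ => (Polynomial.derivative^[j] (p z.1)).eval z.2) z (0, 1) =
          (Polynomial.derivative^[j + 1] (p z.1)).eval z.2 := by
  have hO : IsOpen (U ×ˢ (Set.univ : Set ℝ)) := hU.prod isOpen_univ
  have hder : ∀ j, ContDiffOn ℝ ∞
      (fun z : E n × ℝ => (Polynomial.derivative^[j] (p z.1)).eval z.2) (U ×ˢ Set.univ) →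
      ∀ z ∈ U ×ˢ Set.univ,
        fderiv ℝ (fun z : E n × ℝ => (Polynomial.derivative^[j] (p z.1)).eval z.2) z (0, 1) =
          (Polynomial.derivative^[j + 1] (p z.1)).eval z.2 := by
    rintro j hj ⟨u, t⟩ hz
    have h1 := ((hj.contDiffAt (hO.mem_nhds hz)).differentiableAt (by simp)).hasFDerivAt
    have h2 : HasDerivAt (fun t : ℝ => (Polynomial.derivative^[j] (p u)).eval t) _ t :=
      HasFDerivAt.comp_hasDerivAt t (f := fun t : ℝ => (u, t)) h1
        ((hasDerivAt_const t u).prodMk (hasDerivAt_id t))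
    have h3 := h2.unique (Polynomial.hasDerivAt _ t)
    rw [h3, Function.iterate_succ_apply']
  have hall : ∀ j, ContDiffOn ℝ ∞
      (fun z : E n × ℝ => (Polynomial.derivative^[j] (p z.1)).eval z.2) (U ×ˢ Set.univ) := by
    intro j
    induction j with
    | zero => exact hp
    | succ j ih =>
      refine ((ih.fderiv_of_isOpen hO (m := ∞) (by simp)).clm_apply
        (contDiffOn_const (c := ((0, 1) : E n × ℝ)))).congr fun z hz => ?_
      exact (hder j ih z hz).symm
  exact ⟨hall j, hder j (hall j)⟩

end ImplicitRoot

/-! ### Smoothness and local existence of fields of foci. -/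

section FocalParameter

variable {n : ℕ} {N : Type*} [TopologicalSpace N] [ChartedSpace (E n) N]
  [IsManifold 𝓘(ℝ, E n) ∞ N] {x y : N → ℙ ℝ (V n)} {W : Set N} {X Y : N → V n} {p : N}

/-- Near a point, the characteristic polynomials of a frame depend smoothly on the point. -/
theorem IsFrame.exists_charPolynomial_family (hx : IsLightlikeHypersurface x y)
    (hr : HasMaximalRank y) (h : IsFrame x y W X Y) (hp : p ∈ W) :
    ∃ (U : Set (E n)) (c : E n → Polynomial ℝ), IsOpen U ∧ chartAt (E n) p p ∈ U ∧
      U ⊆ coordSet p W ∧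
      ContDiffOn ℝ ∞ (fun z : E n × ℝ => (c z.1).eval z.2) (U ×ˢ Set.univ) ∧
      ∀ u ∈ U, c u ≠ 0 ∧ ∀ t, (c u).rootMultiplicity t + 1 =
        Module.finrank ℝ (frameKer X Y ((chartAt (E n) p).symm u) t) := by
  have hpp := mem_chart_source (E n) p
  have hO : IsOpen (coordSet (n := n) p W) := isOpen_coordSet h.1.1
  have hdX : ContDiffOn ℝ ∞ (fderiv ℝ (coord p X)) (coordSet (n := n) p W) :=
    (contDiffOn_coord h.1.2.1).fderiv_of_isOpen hO (by simp)
  have hdY : ContDiffOn ℝ ∞ (fderiv ℝ (coord p Y)) (coordSet (n := n) p W) :=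
    (contDiffOn_coord h.2.1.2.1).fderiv_of_isOpen hO (by simp)
  obtain ⟨v₀, hv₀⟩ := (h.isFramePoint hx hr hp).exists_gram_det_ne_zero
  -- The coordinate vectors are kept fixed, so the entries of g and λ are smooth; they stay an
  -- admissible choice wherever the Gram determinant is nonzero, which defines U.
  let v : Fin (n - 1) → E n := fun i => chartEquiv p hpp (v₀ i)
  let g : E n → Matrix (Fin (n - 1)) (Fin (n - 1)) ℝ := fun u => Matrix.of fun i j =>
    lor n (fderiv ℝ (coord p Y) u (v i)) (fderiv ℝ (coord p Y) u (v j))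
  let lam : E n → Matrix (Fin (n - 1)) (Fin (n - 1)) ℝ := fun u => Matrix.of fun i j =>
    -lor n (fderiv ℝ (coord p X) u (v i)) (fderiv ℝ (coord p Y) u (v j))
  have hg : ∀ i j, ContDiffOn ℝ ∞ (fun u => g u i j) (coordSet (n := n) p W) := fun i j =>
    contDiffOn_lor (hdY.clm_apply contDiffOn_const) (hdY.clm_apply contDiffOn_const)
  have hlam : ∀ i j, ContDiffOn ℝ ∞ (fun u => lam u i j) (coordSet (n := n) p W) := fun i j =>
    (contDiffOn_lor (hdX.clm_apply contDiffOn_const) (hdY.clm_apply contDiffOn_const)).neg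
  have hdet : ContDiffOn ℝ ∞ (fun u => (g u).det) (coordSet (n := n) p W) := by
    simp only [Matrix.det_apply]
    exact ContDiffOn.sum fun τ _ => (contDiffOn_prod fun i _ => hg _ _).const_smul _
  let U : Set (E n) := coordSet p W ∩ (fun u => (g u).det) ⁻¹' {0}ᶜ
  refine ⟨U, fun u => charPolynomial (g u) (lam u),
    hdet.continuousOn.isOpen_inter_preimage hO isOpen_compl_singleton,
    ⟨mem_coordSet hp hpp, ?_⟩, Set.inter_subset_left, ?_, fun u hu => ?_⟩
  · refine hv₀ _ fun i j => ?_
    change lor n _ _ = lor n (dif Y p (v₀ i)) (dif Y p (v₀ j))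
    rw [dif_eq_coord h.2.1.1 h.2.1.2.1 hp hpp, dif_eq_coord h.2.1.1 h.2.1.2.1 hp hpp]
  · have heval : ∀ z : E n × ℝ, (charPolynomial (g z.1) (lam z.1)).eval z.2 =
        (Matrix.of fun i j => lam z.1 i j - z.2 * g z.1 i j).det := by
      intro z
      rw [charPolynomial, ← Polynomial.coe_evalRingHom, RingHom.map_det]
      congr 1
      ext i j
      simp
      exact mul_comm _ _
    simp only [heval, Matrix.det_apply]
    refine ContDiffOn.sum fun τ _ => (contDiffOn_prod fun i _ => ?_).const_smul _
    have hsub : Set.MapsTo Prod.fst (U ×ˢ (Set.univ : Set ℝ)) (coordSet (n := n) p W) :=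
      fun z hz => hz.1.1
    exact ((hlam _ _).comp contDiffOn_fst hsub).sub
      (contDiffOn_snd.mul ((hg _ _).comp contDiffOn_fst hsub))
  · have hq : (chartAt (E n) p).symm u ∈ W := hu.1.2
    have hqp : (chartAt (E n) p).symm u ∈ (chartAt (E n) p).source :=
      (chartAt (E n) p).map_target hu.1.1
    have hf := h.isFramePoint hx hr hq
    have hX : ∀ i, dif X ((chartAt (E n) p).symm u) ((chartEquiv p hqp).symm (v i)) =
        fderiv ℝ (coord p X) u (v i) := fun i => by
      rw [dif_eq_coord h.1.1 h.1.2.1 hq hqp, ContinuousLinearEquiv.apply_symm_apply,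
        (chartAt (E n) p).right_inv hu.1.1]
    have hY : ∀ i, dif Y ((chartAt (E n) p).symm u) ((chartEquiv p hqp).symm (v i)) =
        fderiv ℝ (coord p Y) u (v i) := fun i => by
      rw [dif_eq_coord h.2.1.1 h.2.1.2.1 hq hqp, ContinuousLinearEquiv.apply_symm_apply,
        (chartAt (E n) p).right_inv hu.1.1]
    have hpair := hf.isPair_gram (g := g u) (lam := lam u)
      (fun i => (chartEquiv p hqp).symm (v i))
      (fun i j => by
        change _ = lor n (dif Y _ _) (dif Y _ _)
        rw [hY, hY]
        rfl)
      (fun i j => by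
        change _ = -lor n (dif X _ _) (dif Y _ _)
        rw [hX, hY]
        rfl) hu.2
    obtain ⟨e1, e2, e3, -⟩ := hf.pair_properties hpair
    exact ⟨charPolynomial_ne_zero e1 e2 e3, hf.multiplicity_eq hpair⟩

/-- A continuous field of foci of constant multiplicity is smooth. -/
theorem IsFrame.contMDiffOn_param (hx : IsLightlikeHypersurface x y)
    (hr : HasMaximalRank y) (h : IsFrame x y W X Y) (hp : p ∈ W) {s : N → ℝ} {m : ℕ} (hm : 1 ≤ m)
    (hs : ContinuousOn s W) (hmult : ∀ q ∈ W, Module.finrank ℝ (frameKer X Y q (s q)) = m + 1) :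
    ∃ W₁ ⊆ W, IsOpen W₁ ∧ p ∈ W₁ ∧ ContMDiffOn 𝓘(ℝ, E n) 𝓘(ℝ, ℝ) ∞ s W₁ := by
  obtain ⟨U, c, hU, hpU, hUW, hc, hcm⟩ := h.exists_charPolynomial_family hx hr hp
  -- A root of multiplicity exactly j + 1 is a simple zero of the j-th derivative, to which the
  -- implicit function theorem applies.
  obtain ⟨j, rfl⟩ : ∃ j, m = j + 1 := ⟨m - 1, by omega⟩
  have hpp := mem_chart_source (E n) p
  obtain ⟨hsm, hder⟩ := contDiffOn_iterate_derivative hU hc j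
  have hroot : ∀ u ∈ U, (c u).rootMultiplicity (coord p s u) = j + 1 := by
    intro u hu
    have h1 := (hcm u hu).2 (coord p s u)
    rw [coord, hmult _ (hUW hu).2] at h1
    exact Nat.succ_injective h1
  have hzero : ∀ u ∈ U, (Polynomial.derivative^[j] (c u)).eval (coord p s u) = 0 := fun u hu =>
    Polynomial.isRoot_iterate_derivative_of_lt_rootMultiplicity (by rw [hroot u hu]; omega)
  have hne : (Polynomial.derivative^[j + 1] (c (chartAt (E n) p p))).eval
      (coord p s (chartAt (E n) p p)) ≠ 0 := by
    rw [← hroot _ hpU, Polynomial.eval_iterate_derivative_rootMultiplicity]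
    exact smul_ne_zero (Nat.factorial_ne_zero _)
      (Polynomial.eval_divByMonic_pow_rootMultiplicity_ne_zero _ (hcm _ hpU).1)
  obtain ⟨σ, U', O, hU', hpU', hO, hpO, hOΩ, hσ, -, -, huniq⟩ :=
    exists_implicit_root (hU.prod isOpen_univ) hsm
      (u₀ := chartAt (E n) p p) (t₀ := coord p s (chartAt (E n) p p)) ⟨hpU, Set.mem_univ _⟩
      (hzero _ hpU) (by rw [hder _ ⟨hpU, Set.mem_univ _⟩]; exact hne)
  have hcs : ContinuousOn (coord (n := n) p s) U := by
    refine hs.comp ((chartAt (E n) p).continuousOn_symm.mono fun u hu => (hUW hu).1) ?_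
    exact fun u hu => (hUW hu).2
  -- Continuity of s is used here: its graph stays in the neighbourhood where the implicit solution
  -- is unique, so s coincides with the smooth σ.
  let U₁ : Set (E n) := U ∩ (fun u => (u, coord p s u)) ⁻¹' O
  have hU₁ : IsOpen U₁ := (continuousOn_id.prodMk hcs).isOpen_inter_preimage hU hO
  let W₁ : Set N := (chartAt (E n) p).source ∩ chartAt (E n) p ⁻¹' U₁
  have hW₁ : IsOpen W₁ := (chartAt (E n) p).isOpen_inter_preimage hU₁
  have hrec : ∀ q ∈ W₁, q ∈ W := by
    intro q hq
    have h1 := (hUW hq.2.1).2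
    rwa [Set.mem_preimage, (chartAt (E n) p).left_inv hq.1] at h1
  refine ⟨W₁, hrec, hW₁, ⟨hpp, hpU, hpO⟩, ?_⟩
  refine (contMDiffOn_of_coord (p := p) hσ Set.inter_subset_left fun q hq => ?_).congr
    fun q hq => ?_
  · exact (huniq _ _ hq.2.2 (hzero _ hq.2.1)).1
  · have h1 := (huniq _ _ hq.2.2 (hzero _ hq.2.1)).2
    rw [coord_chart s hq.1] at h1
    exact h1

/-- A simple focus belongs to a smooth field of simple foci. -/
theorem IsFrame.exists_simple_param (hx : IsLightlikeHypersurface x y)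
    (hr : HasMaximalRank y) (h : IsFrame x y W X Y) (hp : p ∈ W) {s₀ : ℝ}
    (hs₀ : Module.finrank ℝ (frameKer X Y p s₀) = 2) :
    ∃ (W₁ : Set N) (s : N → ℝ), W₁ ⊆ W ∧ IsOpen W₁ ∧ p ∈ W₁ ∧ ContinuousOn s W₁ ∧ s p = s₀ ∧
      ∀ q ∈ W₁, Module.finrank ℝ (frameKer X Y q (s q)) = 2 := by
  obtain ⟨U, c, hU, hpU, hUW, hc, hcm⟩ := h.exists_charPolynomial_family hx hr hp
  have hpp := mem_chart_source (E n) p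
  have hroot : (c (chartAt (E n) p p)).rootMultiplicity s₀ = 1 := by
    have h1 := (hcm _ hpU).2 s₀
    rw [(chartAt (E n) p).left_inv hpp, hs₀] at h1
    exact Nat.succ_injective h1
  have hderiv := (contDiffOn_iterate_derivative hU hc 0).2
  have hsm1 := (contDiffOn_iterate_derivative hU hc 1).1
  have hzero : (c (chartAt (E n) p p)).eval s₀ = 0 :=
    (Polynomial.rootMultiplicity_pos (hcm _ hpU).1).1 (by omega)
  have hne : (Polynomial.derivative (c (chartAt (E n) p p))).eval s₀ ≠ 0 := by
    intro h1
    have := (Polynomial.one_lt_rootMultiplicity_iff_isRoot (hcm _ hpU).1).2 ⟨hzero, h1⟩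
    omega
  -- Working where the derivative of the polynomial is nonzero forces the nearby roots to remain
  -- simple.
  let Ω : Set (E n × ℝ) := (U ×ˢ Set.univ) ∩
    (fun z : E n × ℝ => (Polynomial.derivative (c z.1)).eval z.2) ⁻¹' {0}ᶜ
  have hΩ : IsOpen Ω := hsm1.continuousOn.isOpen_inter_preimage (hU.prod isOpen_univ)
    isOpen_compl_singleton
  obtain ⟨σ, U', O, hU', hpU', hO, hpO, hOΩ, hσ, hσ0, hσz, -⟩ :=
    exists_implicit_root hΩ (hc.mono Set.inter_subset_left)
      (u₀ := chartAt (E n) p p) (t₀ := s₀) ⟨⟨hpU, Set.mem_univ _⟩, hne⟩ hzero (by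
        have := hderiv (chartAt (E n) p p, s₀) ⟨hpU, Set.mem_univ _⟩
        simp only [Function.iterate_zero, id] at this
        rw [this]
        exact hne)
  let W₁ : Set N := (chartAt (E n) p).source ∩ chartAt (E n) p ⁻¹' U'
  have hUU : ∀ u ∈ U', u ∈ U := fun u hu => (hOΩ (hσz u hu).1).1.1
  have hrec : ∀ q ∈ W₁, q ∈ W := by
    intro q hq
    have h1 := (hUW (hUU _ hq.2)).2
    rwa [Set.mem_preimage, (chartAt (E n) p).left_inv hq.1] at h1
  refine ⟨W₁, fun q => σ (chartAt (E n) p q), hrec, (chartAt (E n) p).isOpen_inter_preimage hU',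
    ⟨hpp, hpU'⟩, ?_, hσ0, fun q hq => ?_⟩
  · exact hσ.continuousOn.comp ((chartAt (E n) p).continuousOn.mono Set.inter_subset_left)
      fun q hq => hq.2
  · obtain ⟨h1, h2⟩ := hσz _ hq.2
    have h3 := hcm _ (hUU _ hq.2)
    have h4 := h3.2 (σ (chartAt (E n) p q))
    have h5 : 0 < (c (chartAt (E n) p q)).rootMultiplicity (σ (chartAt (E n) p q)) :=
      (Polynomial.rootMultiplicity_pos h3.1).2 h2
    have h6 : ¬ 1 < (c (chartAt (E n) p q)).rootMultiplicity (σ (chartAt (E n) p q)) :=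
      fun h7 => (hOΩ h1).2 ((Polynomial.one_lt_rootMultiplicity_iff_isRoot h3.1).1 h7).2
    rw [(chartAt (E n) p).left_inv hq.1] at h4
    change Module.finrank ℝ (frameKer X Y q (σ (chartAt (E n) p q))) = 2
    omega

/-- A simple focus belongs to a local continuous field of simple foci. -/
theorem exists_isFocalField (hx : IsLightlikeHypersurface x y) (hr : HasMaximalRank y)
    {z : ℙ ℝ (V n)} (hz : HasMultiplicity x y p z 1) :
    ∃ (O : Set N) (b : N → ℙ ℝ (V n)), p ∈ O ∧ IsFocalField x y O b 1 ∧ b p = z := by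
  classical
  obtain ⟨W, X, Y, hp, h⟩ := exists_isFrame hx hr p
  obtain ⟨s₀, hzs, hs₀⟩ := (hasMultiplicity_iff hx hr h hp).1 hz
  obtain ⟨W₁, s, hsub, hW₁, hp₁, hs, hsp, hmult⟩ := h.exists_simple_param hx hr hp hs₀
  let b : N → ℙ ℝ (V n) := fun q =>
    if h0 : X q + s q • Y q ≠ 0 then Projectivization.mk ℝ (X q + s q • Y q) h0 else z
  have hb : ∀ q ∈ W₁, (b q).submodule = Submodule.span ℝ {X q + s q • Y q} := by
    intro q hq
    have h0 : X q + s q • Y q ≠ 0 := (h.isFramePoint hx hr (hsub hq)).focus_ne_zero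
    simp only [b, dif_pos h0, Projectivization.submodule_mk]
  refine ⟨W₁, b, hp₁, ⟨hW₁, fun q hq => ?_, fun q hq => ?_⟩, ?_⟩
  · exact (hasMultiplicity_iff hx hr h (hsub hq)).2 ⟨s q, hb q hq, hmult q hq⟩
  · exact ⟨W₁, X, Y, s, hq, subset_rfl, h.mono hW₁ hsub, hs, hb⟩
  · refine Projectivization.submodule_injective ?_
    rw [hb p hp₁, hzs, hsp]

end FocalParameter

/-! ### The focus as a map: conic or fold. -/

section FocalFrame

variable {n : ℕ} {N : Type*} [TopologicalSpace N] [ChartedSpace (E n) N]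
  [IsManifold 𝓘(ℝ, E n) ∞ N] {x y b : N → ℙ ℝ (V n)} {m : ℕ} {W O : Set N} {X Y : N → V n}
  {s : N → ℝ} {p q : N}

/-- A moving frame together with the smooth parameter of a field of foci of multiplicity `m`. -/
structure IsFocalFrame (x y b : N → ℙ ℝ (V n)) (m : ℕ) (W : Set N) (X Y : N → V n) (s : N → ℝ) :
    Prop where
  frame : IsFrame x y W X Y
  smooth : ContMDiffOn 𝓘(ℝ, E n) 𝓘(ℝ, ℝ) ∞ s W
  submodule_eq : ∀ q ∈ W, (b q).submodule = Submodule.span ℝ {X q + s q • Y q}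
  finrank_eq : ∀ q ∈ W, Module.finrank ℝ (frameKer X Y q (s q)) = m + 1

/-- The homogeneous coordinates of the focus with parameter `s`. -/
def focus (X Y : N → V n) (s : N → ℝ) : N → V n := fun q => X q + s q • Y q

/-- The parameter of a point of the generator is unique in a given frame, so the field has kernels
of dimension m + 1 and its continuous parameter is smooth. -/
theorem IsFocalField.exists_isFocalFrame (hx : IsLightlikeHypersurface x y)
    (hr : HasMaximalRank y) (h : IsFocalField x y O b m) (hm : 1 ≤ m) (hp : p ∈ O) :
    ∃ (W : Set N) (X Y : N → V n) (s : N → ℝ), p ∈ W ∧ W ⊆ O ∧ IsFocalFrame x y b m W X Y s := by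
  obtain ⟨W, X, Y, s, hpW, hWO, hf, hs, hb⟩ := h.2.2 p hp
  have hmult : ∀ q ∈ W, Module.finrank ℝ (frameKer X Y q (s q)) = m + 1 := by
    intro q hq
    obtain ⟨t, ht, hmt⟩ := (hasMultiplicity_iff hx hr hf hq).1 (h.2.1 q (hWO hq))
    have := (hf.isFramePoint hx hr hq).param_injective ((hb q hq).symm.trans ht)
    rw [this, hmt]
  obtain ⟨W₁, hsub, hW₁, hp₁, hs₁⟩ := hf.contMDiffOn_param hx hr hpW hm hs hmult
  exact ⟨W₁, X, Y, s, hp₁, hsub.trans hWO, hf.mono hW₁ hsub, hs₁, fun q hq => hb q (hsub hq),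
    fun q hq => hmult q (hsub hq)⟩

namespace IsFocalFrame

theorem isFramePoint (hx : IsLightlikeHypersurface x y) (hr : HasMaximalRank y)
    (h : IsFocalFrame x y b m W X Y s) (hq : q ∈ W) :
    IsFramePoint (X q) (Y q) (dif X q : TangentSpace 𝓘(ℝ, E n) q →ₗ[ℝ] V n)
      (dif Y q : TangentSpace 𝓘(ℝ, E n) q →ₗ[ℝ] V n) := h.frame.isFramePoint hx hr hq

theorem isOpen (h : IsFocalFrame x y b m W X Y s) : IsOpen W := h.frame.1.1

theorem contMDiffOn_focus (h : IsFocalFrame x y b m W X Y s) :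
    ContMDiffOn 𝓘(ℝ, E n) 𝓘(ℝ, V n) ∞ (focus X Y s) W :=
  h.frame.1.2.1.add (h.smooth.smul h.frame.2.1.2.1)

theorem isLift (hx : IsLightlikeHypersurface x y) (hr : HasMaximalRank y)
    (h : IsFocalFrame x y b m W X Y s) : IsLift b W (focus X Y s) := by
  refine ⟨h.isOpen, h.contMDiffOn_focus, fun q hq => ?_⟩
  have h0 : focus X Y s q ≠ 0 := (h.isFramePoint hx hr hq).focus_ne_zero
  refine ⟨h0, Projectivization.submodule_injective ?_⟩
  rw [h.submodule_eq q hq, Projectivization.submodule_mk]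
  rfl

/-- By the Leibniz rule the only other term is ds·Y. Hence the linear algebra of a focus applies
with L = dB. -/
theorem dif_focus (h : IsFocalFrame x y b m W X Y s) (hq : q ∈ W)
    (v : TangentSpace 𝓘(ℝ, E n) q) :
    (dif (focus X Y s) q : TangentSpace 𝓘(ℝ, E n) q →ₗ[ℝ] V n) v -
      ((dif X q : TangentSpace 𝓘(ℝ, E n) q →ₗ[ℝ] V n) v +
        s q • (dif Y q : TangentSpace 𝓘(ℝ, E n) q →ₗ[ℝ] V n) v) ∈ Submodule.span ℝ {Y q} := by
  have hqp := mem_chart_source (E n) q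
  have hX := differentiableAt_coord hqp h.isOpen hq h.frame.1.2.1
  have hY := differentiableAt_coord hqp h.isOpen hq h.frame.2.1.2.1
  have hs := differentiableAt_coord hqp h.isOpen hq h.smooth
  change dif (focus X Y s) q v - (dif X q v + s q • dif Y q v) ∈ _
  rw [dif_eq_coord h.isOpen h.contMDiffOn_focus hq hqp,
    dif_eq_coord h.isOpen h.frame.1.2.1 hq hqp, dif_eq_coord h.isOpen h.frame.2.1.2.1 hq hqp]
  have h1 : HasFDerivAt (coord q (focus X Y s)) _ (chartAt (E n) q q) :=
    hX.hasFDerivAt.add (hs.hasFDerivAt.smul hY.hasFDerivAt)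
  rw [h1.fderiv]
  simp only [add_apply, smul_apply, ContinuousLinearMap.smulRight_apply, coord_chart s hqp,
    add_sub_add_left_eq_sub, add_sub_cancel_left]
  rw [(chartAt (E n) q).left_inv hqp]
  exact Submodule.smul_mem _ _ (Submodule.mem_span_singleton_self _)

theorem generator_eq (h : IsFocalFrame x y b m W X Y s) (hq : q ∈ W) :
    generator x y q = Submodule.span ℝ {X q, Y q} := by
  rw [generator, h.frame.1.submodule_eq hq, h.frame.2.1.submodule_eq hq, Submodule.span_insert]

theorem generator_eq_focus (h : IsFocalFrame x y b m W X Y s) (hq : q ∈ W) :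
    generator x y q = Submodule.span ℝ {focus X Y s q, Y q} := by
  rw [h.generator_eq hq, Submodule.span_insert, Submodule.span_insert]
  apply le_antisymm
  · refine sup_le ?_ le_sup_right
    rw [Submodule.span_singleton_le_iff_mem]
    have : X q = focus X Y s q + (-s q) • Y q := by simp [focus]
    rw [this]
    exact add_mem (Submodule.mem_sup_left (Submodule.mem_span_singleton_self _))
      (Submodule.mem_sup_right (Submodule.smul_mem _ _ (Submodule.mem_span_singleton_self _)))
  · refine sup_le ?_ le_sup_right
    rw [Submodule.span_singleton_le_iff_mem]
    exact add_mem (Submodule.mem_sup_left (Submodule.mem_span_singleton_self _))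
      (Submodule.mem_sup_right (Submodule.smul_mem _ _ (Submodule.mem_span_singleton_self _)))

theorem tangentSubspace_eq (hx : IsLightlikeHypersurface x y) (hr : HasMaximalRank y)
    (h : IsFocalFrame x y b m W X Y s) (hq : q ∈ W) :
    tangentSubspace b q = Submodule.span ℝ {X q + s q • Y q} ⊔
      LinearMap.range (dif (focus X Y s) q : TangentSpace 𝓘(ℝ, E n) q →ₗ[ℝ] V n) :=
  (h.isLift hx hr).tangentSubspace_eq hq

theorem finrank_tangent (hx : IsLightlikeHypersurface x y) (hr : HasMaximalRank y)
    (h : IsFocalFrame x y b m W X Y s) (hq : q ∈ W) :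
    Module.finrank ℝ (tangentSubspace b q) = 1 + Module.finrank ℝ
      (LinearMap.range (dif (focus X Y s) q : TangentSpace 𝓘(ℝ, E n) q →ₗ[ℝ] V n)) := by
  rw [h.tangentSubspace_eq hx hr hq]
  exact (h.isFramePoint hx hr hq).finrank_tangent_focus (h.dif_focus hq)

/-- K is a subspace of the n-dimensional tangent space; this keeps n - m and n - m - 1 free of
truncation. -/
theorem succ_le (h : IsFocalFrame x y b m W X Y s) (hq : q ∈ W) : m + 1 ≤ n := by
  rw [← h.finrank_eq q hq]
  exact (Submodule.finrank_le _).trans (finrank_tangentSpace q).le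

/-- The alternative between conic foci and foci with a tangent subspace through the generator. -/
theorem conic_or (hx : IsLightlikeHypersurface x y) (hr : HasMaximalRank y)
    (h : IsFocalFrame x y b m W X Y s) (hq : q ∈ W) :
    (LinearMap.ker (dif (focus X Y s) q : TangentSpace 𝓘(ℝ, E n) q →ₗ[ℝ] V n) =
        frameKer X Y q (s q) ∧ IsConic b m q ∧
      Module.finrank ℝ (LinearMap.range (dif (focus X Y s) q :
        TangentSpace 𝓘(ℝ, E n) q →ₗ[ℝ] V n)) = n - m - 1) ∨
    (Y q ∈ LinearMap.range (dif (focus X Y s) q : TangentSpace 𝓘(ℝ, E n) q →ₗ[ℝ] V n) ∧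
      ¬ IsConic b m q ∧ (m = 1 → IsFold x y b q) ∧
      Module.finrank ℝ (LinearMap.range (dif (focus X Y s) q :
        TangentSpace 𝓘(ℝ, E n) q →ₗ[ℝ] V n)) = n - m) := by
  have hf := h.isFramePoint hx hr hq
  have hd := h.dif_focus hq
  have hfin := h.finrank_eq q hq
  have hle := h.succ_le hq
  have htan := h.finrank_tangent hx hr hq
  have hsm : SmoothAt b q := ⟨W, _, hq, h.isLift hx hr⟩
  rw [frameKer] at hfin
  -- The alternative is whether dB vanishes on K, which it always maps into the line of Y.
  by_cases hK : ∀ v ∈ frameKer X Y q (s q),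
      (dif (focus X Y s) q : TangentSpace 𝓘(ℝ, E n) q →ₗ[ℝ] V n) v = 0
  · left
    have h1 := hf.finrank_range_of_conic hd hK
    refine ⟨IsFramePoint.ker_eq_of_conic hd hK, ⟨hsm, by omega, ?_⟩, by omega⟩
    rw [h.tangentSubspace_eq hx hr hq]
    exact hf.isSpacelike_of_conic hd hK
  · right
    push Not at hK
    obtain ⟨v, hv, hv0⟩ := hK
    have hY := IsFramePoint.y_mem_range_of_not_conic hd hv hv0
    have h1 := hf.finrank_range_of_y_mem hd hY
    refine ⟨hY, fun hc => ?_, fun hm1 => ⟨hsm, by omega, ?_⟩, by omega⟩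
    · have := hc.2.1
      omega
    · rw [h.generator_eq_focus hq, h.tangentSubspace_eq hx hr hq, Submodule.span_insert]
      refine sup_le_sup le_rfl ?_
      rwa [Submodule.span_singleton_le_iff_mem]

/-- The two dimensions n and n - 1 exclude each other, and `conic_or` leaves no third case. -/
theorem fold_iff (hx : IsLightlikeHypersurface x y) (hr : HasMaximalRank y)
    (h : IsFocalFrame x y b 1 W X Y s) (hq : q ∈ W) : IsFold x y b q ↔ ¬ IsConic b 1 q := by
  have hle := h.succ_le hq
  constructor
  · intro h1 h2
    have h3 := h1.2.1
    rw [h2.2.1] at h3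
    omega
  · intro h1
    rcases h.conic_or hx hr hq with h2 | h2
    · exact absurd h2.2.1 h1
    · exact h2.2.2.1 rfl

theorem range_eq_coord (h : IsFocalFrame x y b m W X Y s) (hq : q ∈ W)
    (hqp : q ∈ (chartAt (E n) p).source) :
    LinearMap.range (dif (focus X Y s) q : TangentSpace 𝓘(ℝ, E n) q →ₗ[ℝ] V n) =
      LinearMap.range (fderiv ℝ (coord p (focus X Y s)) (chartAt (E n) p q) : E n →ₗ[ℝ] V n) := by
  ext w
  constructor
  · rintro ⟨v, rfl⟩
    exact ⟨chartEquiv p hqp v, (dif_eq_coord h.isOpen h.contMDiffOn_focus hq hqp v).symm⟩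
  · rintro ⟨v, rfl⟩
    refine ⟨(chartEquiv p hqp).symm v, ?_⟩
    change dif (focus X Y s) q ((chartEquiv p hqp).symm v) = _
    rw [dif_eq_coord h.isOpen h.contMDiffOn_focus hq hqp, ContinuousLinearEquiv.apply_symm_apply]
    rfl

/-- Foci that are not conic are not conic nearby. -/
theorem exists_nhds_not_conic (hx : IsLightlikeHypersurface x y) (hr : HasMaximalRank y)
    (h : IsFocalFrame x y b m W X Y s) (hp : p ∈ W) (hc : ¬ IsConic b m p) :
    ∃ W₁ ⊆ W, IsOpen W₁ ∧ p ∈ W₁ ∧ ∀ q ∈ W₁, ¬ IsConic b m q := by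
  have hpp := mem_chart_source (E n) p
  have hle := h.succ_le hp
  have hU : IsOpen (coordSet (n := n) p W) := isOpen_coordSet h.isOpen
  have hcont := (contDiffOn_coord (p := p) h.contMDiffOn_focus).continuousOn_fderiv_of_isOpen hU
    (by simp)
  -- By `conic_or` the rank of dB is n - m - 1 or n - m, so failing to be conic means rank at least
  -- n - m, an open condition.
  have hfin : ∀ q ∈ W, q ∈ (chartAt (E n) p).source → (¬ IsConic b m q ↔
      ((n - m : ℕ) : Cardinal) ≤ LinearMap.rank
        (fderiv ℝ (coord p (focus X Y s)) (chartAt (E n) p q) : E n →ₗ[ℝ] V n)) := by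
    intro q hq hqp
    rw [LinearMap.rank, ← Module.finrank_eq_rank, Nat.cast_le, ← h.range_eq_coord hq hqp]
    rcases h.conic_or hx hr hq with h2 | h2
    · rw [h2.2.2]
      simp only [h2.2.1, not_true, false_iff]
      omega
    · rw [h2.2.2.2]
      simp only [h2.2.1, not_false_eq_true, le_refl]
  let U : Set (E n) := coordSet p W ∩ fderiv ℝ (coord p (focus X Y s)) ⁻¹'
    {L : E n →L[ℝ] V n | ((n - m : ℕ) : Cardinal) ≤ LinearMap.rank (L : E n →ₗ[ℝ] V n)}
  have hUo : IsOpen U := hcont.isOpen_inter_preimage hU (isOpen_setOfPred_nat_le_rank _)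
  let W₁ : Set N := (chartAt (E n) p).source ∩ chartAt (E n) p ⁻¹' U
  have hrec : ∀ q ∈ W₁, q ∈ W := by
    intro q hq
    have h1 := hq.2.1.2
    rwa [Set.mem_preimage, (chartAt (E n) p).left_inv hq.1] at h1
  exact ⟨W₁, hrec, (chartAt (E n) p).isOpen_inter_preimage hUo,
    ⟨hpp, mem_coordSet hp hpp, (hfin p hp hpp).1 hc⟩,
    fun q hq => (hfin q (hrec q hq) hq.1).2 hq.2.2⟩

theorem mono {W₁ : Set N} (h : IsFocalFrame x y b m W X Y s) (hW₁ : IsOpen W₁) (hsub : W₁ ⊆ W) :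
    IsFocalFrame x y b m W₁ X Y s :=
  ⟨h.frame.mono hW₁ hsub, h.smooth.mono hsub, fun q hq => h.submodule_eq q (hsub hq),
    fun q hq => h.finrank_eq q (hsub hq)⟩

end IsFocalFrame

/-- The directions in which the focus `b q` is displaced along the generator. -/
def focalDir (x y b : N → ℙ ℝ (V n)) (q : N) : Submodule ℝ (TangentSpace 𝓘(ℝ, E n) q) :=
  ⨆ (W : Set N) (B : N → V n) (_ : q ∈ W ∧ IsLift b W B),
    (generator x y q).comap (dif B q : TangentSpace 𝓘(ℝ, E n) q →ₗ[ℝ] V n)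

/-- `focalDir` is defined without a frame, because `IsFoliated` asks for one field of directions
common to all charts; any frame computes it. -/
theorem IsFocalFrame.focalDir_eq (hx : IsLightlikeHypersurface x y) (hr : HasMaximalRank y)
    (h : IsFocalFrame x y b m W X Y s) (hq : q ∈ W) :
    focalDir x y b q = frameKer X Y q (s q) := by
  have hf := h.isFramePoint hx hr hq
  rw [frameKer, ← hf.comap_span_pair_focus (h.dif_focus hq), ← h.generator_eq hq]
  apply le_antisymm
  · refine iSup_le fun W' => iSup_le fun B' => iSup_le fun h' v hv => ?_
    obtain ⟨a, ha0, -, hd⟩ := (h.isLift hx hr).exists_proportional h'.2 hq h'.1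
    have h1 : a • dif (focus X Y s) q v = dif B' q v - (dif B' q v - a • dif (focus X Y s) q v) := by
      abel
    have h2 : Submodule.span ℝ {focus X Y s q} ≤ generator x y q := by
      rw [h.generator_eq_focus hq]
      exact Submodule.span_mono (by simp)
    have h3 : a • dif (focus X Y s) q v ∈ generator x y q := by
      rw [h1]
      exact sub_mem hv (h2 (hd v))
    have h4 : dif (focus X Y s) q v ∈ generator x y q := (Submodule.smul_mem_iff _ ha0).1 h3
    exact h4
  · exact le_iSup_of_le W (le_iSup_of_le _ (le_iSup_of_le ⟨hq, h.isLift hx hr⟩ le_rfl))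

/-- Foliated charts may be constructed in coordinates. -/
theorem isFoliated_of_coord {d k : ℕ}
    {P : ((q : N) → Submodule ℝ (TangentSpace 𝓘(ℝ, E n) q)) → Set N → Prop}
    (D : (q : N) → Submodule ℝ (TangentSpace 𝓘(ℝ, E n) q))
    (h : ∀ p ∈ O, ∃ φ : OpenPartialHomeomorph (E n) (E d × E k),
      chartAt (E n) p p ∈ φ.source ∧ φ.source ⊆ coordSet p O ∧
      ContDiffOn ℝ ∞ φ φ.source ∧ ContDiffOn ℝ ∞ φ.symm φ.target ∧
      (∃ (A : Set (E d)) (B : Set (E k)), IsPreconnected A ∧ IsPreconnected B ∧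
        φ.target = A ×ˢ B) ∧
      (∀ (q : N) (hqp : q ∈ (chartAt (E n) p).source), chartAt (E n) p q ∈ φ.source →
        ∀ v, v ∈ D q ↔ fderiv ℝ (fun w => (φ w).2) (chartAt (E n) p q) (chartEquiv p hqp v) = 0) ∧
      ∀ q ∈ (chartAt (E n) p).source, chartAt (E n) p q ∈ φ.source →
        P D {r | r ∈ (chartAt (E n) p).source ∧ chartAt (E n) p r ∈ φ.source ∧
          (φ (chartAt (E n) p r)).2 = (φ (chartAt (E n) p q)).2}) :
    IsFoliated O d k P := by
  refine ⟨D, fun p hp => ?_⟩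
  obtain ⟨φ, hpφ, hsub, hφ, hφs, ⟨A, B, hA, hB, htar⟩, hD, hP⟩ := h p hp
  have hpp := mem_chart_source (E n) p
  let Φ := (chartAt (E n) p).trans φ
  have hsrc : Φ.source = (chartAt (E n) p).source ∩ chartAt (E n) p ⁻¹' φ.source :=
    OpenPartialHomeomorph.trans_source _ _
  have htarget : Φ.target = φ.target := by
    rw [OpenPartialHomeomorph.trans_target, Set.inter_eq_left]
    intro w hw
    exact (hsub (φ.map_target hw)).1
  have hΦ : ∀ r, Φ r = φ (chartAt (E n) p r) := fun r => rfl
  refine ⟨Φ, hsrc ▸ ⟨hpp, hpφ⟩, ?_, ?_, ?_, ⟨A, B, hA, hB, htarget.trans htar⟩, ?_, ?_⟩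
  · intro q hq
    rw [hsrc] at hq
    have h1 := (hsub hq.2).2
    rwa [Set.mem_preimage, (chartAt (E n) p).left_inv hq.1] at h1
  · rw [hsrc]
    exact contMDiffOn_of_coord hφ Set.inter_subset_left fun q hq => hq.2
  · rw [htarget]
    exact (contMDiffOn_chart_symm (I := 𝓘(ℝ, E n)) (x := p)).comp hφs.contMDiffOn
      fun w hw => (hsub (φ.map_target hw)).1
  · intro q hq
    rw [hsrc] at hq
    ext v
    have hd : DifferentiableAt ℝ (fun w => (φ w).2) (chartAt (E n) p q) :=
      ((hφ.contDiffAt (φ.open_source.mem_nhds hq.2)).differentiableAt (by simp)).snd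
    have heq : coord p (fun r => (Φ r).2) =ᶠ[nhds (chartAt (E n) p q)] fun w => (φ w).2 := by
      filter_upwards [(chartAt (E n) p).open_target.mem_nhds
        ((chartAt (E n) p).map_source hq.1)] with w hw
      rw [coord, hΦ, (chartAt (E n) p).right_inv hw]
    rw [hD q hq.1 hq.2, ← heq.fderiv_eq, ← mfderiv_eq_coord hq.1 (hd.congr_of_eventuallyEq heq)]
    rfl
  · intro q hq
    rw [hsrc] at hq
    have h1 := hP q hq.1 hq.2
    convert h1 using 2
    ext r
    rw [hsrc]
    simp only [Set.mem_inter_iff, Set.mem_preimage, and_assoc, hΦ]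

end FocalFrame

/-! ### Multiple foci are conic; cones and canal hypersurfaces. -/

section ConicFoliation

/-- Test against the orthogonal complement: each inner product vanishes near t, hence so does its
derivative. -/
theorem hasDerivAt_mem {n : ℕ} {S : Submodule ℝ (V n)} {f : ℝ → V n} {f' : V n} {t : ℝ}
    (h : HasDerivAt f f' t) (hS : ∀ᶠ r in nhds t, f r ∈ S) : f' ∈ S := by
  rw [← Submodule.orthogonal_orthogonal S, Submodule.mem_orthogonal]
  intro v hv
  have h1 : HasDerivAt (fun r => inner ℝ v (f r)) (inner ℝ v f') t := by
    simpa using (hasDerivAt_const t v).inner ℝ h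
  refine h1.unique ((hasDerivAt_const t (0 : ℝ)).congr_of_eventuallyEq ?_)
  filter_upwards [hS] with r hr
  exact (Submodule.mem_orthogonal' S v).1 hv _ hr

theorem range_eq_of_eq_comp {n d k : ℕ} {L : E n →L[ℝ] V d} {M : E k →L[ℝ] V d}
    {K : E n →L[ℝ] E k} (h : L = M.comp K) (hK : Function.Surjective K) :
    LinearMap.range (L : E n →ₗ[ℝ] V d) = LinearMap.range (M : E k →ₗ[ℝ] V d) := by
  subst h
  exact LinearMap.range_comp_of_range_eq_top _ (LinearMap.range_eq_top.2 hK)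

variable {n : ℕ} {N : Type*} [TopologicalSpace N] [ChartedSpace (E n) N]
  [IsManifold 𝓘(ℝ, E n) ∞ N] {x y b : N → ℙ ℝ (V n)} {m : ℕ} {W O : Set N} {X Y : N → V n}
  {s : N → ℝ} {p q : N}

theorem exists_of_mem_coordSet {u : E n} (hu : u ∈ coordSet p W) :
    ∃ q ∈ W, q ∈ (chartAt (E n) p).source ∧ chartAt (E n) p q = u :=
  ⟨(chartAt (E n) p).symm u, hu.2, (chartAt (E n) p).map_target hu.1,
    (chartAt (E n) p).right_inv hu.1⟩

namespace IsFocalFrame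

/-- Multiple foci are conic. -/
theorem isConic (hx : IsLightlikeHypersurface x y) (hr : HasMaximalRank y)
    (h₀ : IsFocalFrame x y b m W X Y s) (hm : 2 ≤ m) (hp₀ : p ∈ W) : IsConic b m p := by
  -- A non-conic point has a neighbourhood of such points, where the rank of dB is constantly n - m
  -- and the fibres of B have dimension m.
  by_contra hc
  obtain ⟨W₁, hsub, hW₁, hp, hnc⟩ := h₀.exists_nhds_not_conic hx hr hp₀ hc
  have h := h₀.mono hW₁ hsub
  have hle := h.succ_le hp
  have hpp := mem_chart_source (E n) p
  have hfold : ∀ q ∈ W₁,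
      Y q ∈ LinearMap.range (dif (focus X Y s) q : TangentSpace 𝓘(ℝ, E n) q →ₗ[ℝ] V n) ∧
      Module.finrank ℝ (LinearMap.range (dif (focus X Y s) q :
        TangentSpace 𝓘(ℝ, E n) q →ₗ[ℝ] V n)) = n - m := by
    intro q hq
    rcases h.conic_or hx hr hq with h1 | h1
    · exact absurd h1.2.1 (hnc q hq)
    · exact ⟨h1.1, h1.2.2.2⟩
  have hrank : ∀ u ∈ coordSet (n := n) p W₁, Module.finrank ℝ (LinearMap.range
      ((fderiv ℝ (coord p (focus X Y s)) u : E n →L[ℝ] V n) : E n →ₗ[ℝ] V n)) = n - m := by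
    intro u hu
    obtain ⟨q, hq, hqp, rfl⟩ := exists_of_mem_coordSet hu
    rw [← h.range_eq_coord hq hqp]
    exact (hfold q hq).2
  obtain ⟨φ, r, G, hr0, hpφ, hφU, hφ, hφs, htar, -, -, -, hφd⟩ :=
    exists_constant_rank_chart (by omega : m + (n - m) = n) (isOpen_coordSet hW₁)
      (contDiffOn_coord (p := p) h.contMDiffOn_focus) hrank (mem_coordSet hp hpp)
  set u₀ := chartAt (E n) p p
  -- Along a fibre the range of dB is the range of dG at one point, hence fixed. It contains Y and
  -- lies in the polar hyperplane of Y(p), where the only null vectors are multiples of Y(p).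
  have hYspan : ∀ u ∈ φ.source, (φ u).2 = (φ u₀).2 →
      coord p Y u ∈ Submodule.span ℝ {Y p} := by
    intro u hu heq
    obtain ⟨q, hq, hqp, rfl⟩ := exists_of_mem_coordSet (hφU hu)
    rw [coord_chart Y hqp]
    have h1 := (hfold q hq).1
    rw [h.range_eq_coord hq hqp, range_eq_of_eq_comp (hφd _ hu).2.1 (hφd _ hu).1, heq,
      ← range_eq_of_eq_comp (hφd _ hpφ).2.1 (hφd _ hpφ).1, ← h.range_eq_coord hp hpp] at h1
    obtain ⟨v, hv⟩ := h1
    have hf := h.isFramePoint hx hr hp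
    exact hf.mem_span_of_null (hv ▸ hf.y_focus (h.dif_focus hp) v)
      (h.isFramePoint hx hr hq).yy
  have hker : LinearMap.ker (dif (focus X Y s) p : TangentSpace 𝓘(ℝ, E n) p →ₗ[ℝ] V n) ≤
      (Submodule.span ℝ {Y p}).comap
        (dif Y p : TangentSpace 𝓘(ℝ, E n) p →ₗ[ℝ] V n) := by
    intro v hv
    have hv' : dif (focus X Y s) p v = 0 := hv
    change dif Y p v ∈ Submodule.span ℝ {Y p}
    rw [dif_eq_coord h.isOpen h.contMDiffOn_focus hp hpp, (hφd _ hpφ).2.1] at hv'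
    rw [dif_eq_coord h.isOpen h.frame.2.1.2.1 hp hpp]
    set w := chartEquiv p hpp v
    have hw2 : fderiv ℝ (fun v => (φ v).2) u₀ w = 0 :=
      (hφd _ hpφ).2.2 (hv'.trans (map_zero _).symm)
    have hdφ : DifferentiableAt ℝ φ u₀ :=
      (hφ.contDiffAt (φ.open_source.mem_nhds hpφ)).differentiableAt (by simp)
    have hdφs : DifferentiableAt ℝ φ.symm (φ u₀) :=
      (hφs.contDiffAt (φ.open_target.mem_nhds (φ.map_source hpφ))).differentiableAt (by simp)
    have hsplit : fderiv ℝ φ u₀ w = ((fderiv ℝ φ u₀ w).1, 0) := by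
      have h2 : HasFDerivAt (fun v => (φ v).2) _ u₀ := hdφ.hasFDerivAt.snd
      rw [h2.fderiv] at hw2
      exact Prod.ext rfl hw2
    have hinv : fderiv ℝ φ.symm (φ u₀) (fderiv ℝ φ u₀ w) = w := by
      have h1 := hdφs.hasFDerivAt.comp u₀ hdφ.hasFDerivAt
      have h2 : φ.symm ∘ φ =ᶠ[nhds u₀] id := by
        filter_upwards [φ.open_source.mem_nhds hpφ] with u hu
        exact φ.left_inv hu
      exact congrArg (fun L : E n →L[ℝ] E n => L w)
        (h1.unique ((hasFDerivAt_id u₀).congr_of_eventuallyEq h2))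
    -- A straight segment of the chart inside the fibre, with initial velocity w in the original
    -- coordinates.
    let κ : ℝ → E m × E (n - m) := fun t => φ u₀ + t • fderiv ℝ φ u₀ w
    have hκ0 : κ 0 = φ u₀ := by simp [κ]
    have hκ : HasDerivAt κ (fderiv ℝ φ u₀ w) 0 := by
      have h1 := ((hasDerivAt_id (0 : ℝ)).smul_const (fderiv ℝ φ u₀ w)).const_add (φ u₀)
      rwa [one_smul] at h1
    have hφu : φ.symm (κ 0) = u₀ := by rw [hκ0, φ.left_inv hpφ]
    have h1 : HasDerivAt (fun t => φ.symm (κ t)) w 0 := by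
      rw [← hκ0] at hdφs hinv
      have := hdφs.hasFDerivAt.comp_hasDerivAt (0 : ℝ) hκ
      rwa [hinv] at this
    have hY := (differentiableAt_coord hpp h.isOpen hp h.frame.2.1.2.1).hasFDerivAt
    have h2 : HasDerivAt (fun t => coord p Y (φ.symm (κ t))) (fderiv ℝ (coord p Y) u₀ w) 0 := by
      have hY' : HasFDerivAt (coord p Y) (fderiv ℝ (coord p Y) u₀) (φ.symm (κ 0)) := by
        rw [hφu]
        exact hY
      exact hY'.comp_hasDerivAt (0 : ℝ) h1
    refine hasDerivAt_mem h2 ?_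
    have hκt : ∀ᶠ t in nhds (0 : ℝ), κ t ∈ φ.target :=
      hκ.continuousAt.eventually_mem (by
        rw [hκ0]
        exact φ.open_target.mem_nhds (φ.map_source hpφ))
    filter_upwards [hκt] with t ht
    refine hYspan _ (φ.map_target ht) ?_
    rw [φ.right_inv ht]
    simp only [κ]
    rw [hsplit]
    simp
  -- The kernel of dB has dimension m ≥ 2, while only a one-dimensional space of directions fixes
  -- the point y.
  have h1 := Submodule.finrank_mono hker
  rw [(h.isFramePoint hx hr hp).finrank_comap_Q] at h1
  have h2 := LinearMap.finrank_range_add_finrank_ker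
    (dif (focus X Y s) p : TangentSpace 𝓘(ℝ, E n) p →ₗ[ℝ] V n)
  rw [(hfold p hp).2, finrank_tangentSpace] at h2
  omega

theorem mem_deSitter (hx : IsLightlikeHypersurface x y) (hr : HasMaximalRank y)
    (h : IsFocalFrame x y b m W X Y s) (hq : q ∈ W) : b q ∈ deSitter n :=
  mem_deSitter_of_submodule_eq (h.submodule_eq q hq) (h.isFramePoint hx hr hq).lor_focus

/-- The tangent subspace of the focal submanifold is polar-conjugate to the contact point. -/
theorem y_mem_orthogonal (hx : IsLightlikeHypersurface x y) (hr : HasMaximalRank y)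
    (h : IsFocalFrame x y b m W X Y s) (hq : q ∈ W) :
    Y q ∈ (lor n).orthogonal (tangentSubspace b q) := by
  have hf := h.isFramePoint hx hr hq
  have h1 : tangentSubspace b q ≤ (lor n).orthogonal (Submodule.span ℝ {Y q}) := by
    have key : ∀ w, lor n (Y q) w = 0 → w ∈ (lor n).orthogonal (Submodule.span ℝ {Y q}) := by
      intro w hw v hv
      obtain ⟨c, rfl⟩ := Submodule.mem_span_singleton.1 hv
      change lor n (c • Y q) w = 0
      rw [map_smul, LinearMap.smul_apply, hw, smul_zero]
    rw [h.tangentSubspace_eq hx hr hq]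
    refine sup_le ?_ ?_
    · rw [Submodule.span_singleton_le_iff_mem]
      refine key _ ?_
      rw [map_add, map_smul, hf.yy, lor_comm, hf.xy, smul_zero, add_zero]
    · rintro _ ⟨v, rfl⟩
      exact key _ (hf.y_focus (h.dif_focus hq) v)
  intro w hw
  have h2 := h1 hw (Y q) (Submodule.mem_span_singleton_self _)
  change lor n w (Y q) = 0
  rw [lor_comm]
  exact h2

end IsFocalFrame

/-- The double orthogonal of T is T itself, and a vector common to T and T^⊥ is null, hence zero. -/
theorem IsSpacelike.inf_orthogonal {T : Submodule ℝ (V n)} (h : IsSpacelike T) :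
    (lor n).orthogonal T ⊓ (lor n).orthogonal ((lor n).orthogonal T) = ⊥ := by
  rw [LinearMap.BilinForm.orthogonal_orthogonal lor_nondegenerate lor_isRefl, Submodule.eq_bot_iff]
  rintro w ⟨h1, h2⟩
  by_contra h0
  exact (h w h2 h0).ne' (h1 w h2)

namespace IsFocalFrame

/-- The sphere that is polar-conjugate to the tangent subspace of a conic focal submanifold. -/
theorem isLorentzian (hx : IsLightlikeHypersurface x y) (hr : HasMaximalRank y)
    (h : IsFocalFrame x y b m W X Y s) (hq : q ∈ W) (hc : IsConic b m q) :
    (lor n).orthogonal (tangentSubspace b q) ≤ polar (b q) ∧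
      Module.finrank ℝ ((lor n).orthogonal (tangentSubspace b q)) = m + 2 ∧
      IsLorentzian ((lor n).orthogonal (tangentSubspace b q)) := by
  have hf := h.isFramePoint hx hr hq
  have hle := h.succ_le hq
  refine ⟨LinearMap.BilinForm.orthogonal_le ?_, ?_, hc.2.2.inf_orthogonal,
    Y q, h.y_mem_orthogonal hx hr hq, hf.y_ne, hf.yy⟩
  · rw [h.submodule_eq q hq, h.tangentSubspace_eq hx hr hq]
    exact le_sup_left
  · have := finrank_lor_orthogonal (tangentSubspace b q)
    rw [hc.2.1] at this
    omega

end IsFocalFrame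

/-- The foliation defined by a field of conic foci. -/
theorem IsFocalField.isFoliated_of_conic (hx : IsLightlikeHypersurface x y)
    (hr : HasMaximalRank y) (h₀ : IsFocalField x y O b m) (hm : 1 ≤ m)
    (hc : ∀ q ∈ O, IsConic b m q)
    {P : ((q : N) → Submodule ℝ (TangentSpace 𝓘(ℝ, E n) q)) → Set N → Prop}
    (hP : ∀ S ⊆ O, ∀ q ∈ S, (∀ r ∈ S, b r = b q ∧ tangentSubspace b r = tangentSubspace b q) →
      P (focalDir x y b) S) :
    IsFoliated O (m + 1) (n - m - 1) P := by
  refine isFoliated_of_coord (focalDir x y b) fun p hp => ?_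
  obtain ⟨W, X, Y, s, hpW, hWO, h⟩ := h₀.exists_isFocalFrame hx hr hm hp
  have hle := h.succ_le hpW
  have hpp := mem_chart_source (E n) p
  have hcon : ∀ q ∈ W,
      LinearMap.ker (dif (focus X Y s) q : TangentSpace 𝓘(ℝ, E n) q →ₗ[ℝ] V n) =
        frameKer X Y q (s q) ∧
      Module.finrank ℝ (LinearMap.range (dif (focus X Y s) q :
        TangentSpace 𝓘(ℝ, E n) q →ₗ[ℝ] V n)) = n - m - 1 := by
    intro q hq
    rcases h.conic_or hx hr hq with h1 | h1
    · exact ⟨h1.1, h1.2.2⟩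
    · exact absurd (hc q (hWO hq)) h1.2.1
  have hrank : ∀ u ∈ coordSet (n := n) p W, Module.finrank ℝ (LinearMap.range
      ((fderiv ℝ (coord p (focus X Y s)) u : E n →L[ℝ] V n) : E n →ₗ[ℝ] V n)) = n - m - 1 := by
    intro u hu
    obtain ⟨q, hq, hqp, rfl⟩ := exists_of_mem_coordSet hu
    rw [← h.range_eq_coord hq hqp]
    exact (hcon q hq).2
  -- The leaves are the fibres of B. In this chart B = G ∘ φ₂, with φ₂ the second component of φ, so
  -- both B and the range of dB depend on the second coordinate alone.
  obtain ⟨φ, r, G, hr0, hpφ, hφU, hφ, hφs, htar, -, hG, -, hφd⟩ :=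
    exists_constant_rank_chart (by omega : (m + 1) + (n - m - 1) = n) (isOpen_coordSet h.isOpen)
      (contDiffOn_coord (p := p) h.contMDiffOn_focus) hrank (mem_coordSet hpW hpp)
  have hmem : ∀ q ∈ (chartAt (E n) p).source, chartAt (E n) p q ∈ φ.source → q ∈ W := by
    intro q hqp hq
    have h1 := (hφU hq).2
    rwa [Set.mem_preimage, (chartAt (E n) p).left_inv hqp] at h1
  refine ⟨φ, hpφ, hφU.trans (Set.inter_subset_inter_right _ (Set.preimage_mono hWO)), hφ, hφs,
    ⟨_, _, (convex_ball _ _).isPreconnected, (convex_ball _ _).isPreconnected, htar⟩, ?_, ?_⟩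
  · intro q hqp hq v
    have hqW := hmem q hqp hq
    rw [h.focalDir_eq hx hr hqW, ← (hcon q hqW).1]
    change dif (focus X Y s) q v = 0 ↔ _
    rw [dif_eq_coord h.isOpen h.contMDiffOn_focus hqW hqp, (hφd _ hq).2.1]
    exact (injective_iff_map_eq_zero' _).1 (hφd _ hq).2.2 _
  · intro q hqp hq
    have hqW := hmem q hqp hq
    refine hP _ (fun r hr => hWO (hmem r hr.1 hr.2.1)) q ⟨hqp, hq, rfl⟩ fun r hrS => ?_
    obtain ⟨hrp, hrφ, heq⟩ := hrS
    have hrW := hmem r hrp hrφ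
    have h1 : focus X Y s r = focus X Y s q := by
      rw [← coord_chart (focus X Y s) hrp, ← coord_chart (focus X Y s) hqp, hG _ hrφ, hG _ hq, heq]
    constructor
    · apply Projectivization.submodule_injective
      rw [h.submodule_eq r hrW, h.submodule_eq q hqW]
      exact congrArg (fun w => Submodule.span ℝ {w}) h1
    · rw [(h.isLift hx hr).tangentSubspace_eq hrW, (h.isLift hx hr).tangentSubspace_eq hqW, h1,
        h.range_eq_coord hrW hrp, h.range_eq_coord hqW hqp,
        range_eq_of_eq_comp (hφd _ hrφ).2.1 (hφd _ hrφ).1,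
        range_eq_of_eq_comp (hφd _ hq).2.1 (hφd _ hq).1, heq]

/-- On a leaf the vertex B and the subspace T^⊥ are constant, and each generator joins B to a null
vector Y of T^⊥. -/
theorem IsFocalField.isFoliated_cone (hx : IsLightlikeHypersurface x y)
    (hr : HasMaximalRank y) (h₀ : IsFocalField x y O b m) (hm : 1 ≤ m)
    (hc : ∀ q ∈ O, IsConic b m q) :
    IsFoliated (n := n) O (m + 1) (n - m - 1) (fun _ S => IsConePiece x y b (m + 1) S) := by
  refine h₀.isFoliated_of_conic hx hr hm hc fun S hS q hq hrS => ?_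
  obtain ⟨W, X, Y, s, hqW, -, h⟩ := h₀.exists_isFocalFrame hx hr hm (hS hq)
  obtain ⟨h1, h2, h3⟩ := h.isLorentzian hx hr hqW (hc q (hS hq))
  refine ⟨b q, _, ⟨h.mem_deSitter hx hr hqW, _, h1, h2, h3, rfl⟩, fun r hrr => ⟨(hrS r hrr).1, ?_⟩⟩
  obtain ⟨W', X', Y', s', hrW, -, h'⟩ := h₀.exists_isFocalFrame hx hr hm (hS hrr)
  have hY := h'.y_mem_orthogonal hx hr hrW
  rw [(hrS r hrr).2] at hY
  intro w hw
  rw [SetLike.mem_coe, h'.generator_eq_focus hrW] at hw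
  obtain ⟨α, β, rfl⟩ := Submodule.mem_span_pair.1 hw
  refine ⟨α • focus X' Y' s' r, ?_, β • Y' r, Submodule.smul_mem _ _ hY, ?_, rfl⟩
  · rw [← (hrS r hrr).1, h'.submodule_eq r hrW]
    exact Submodule.smul_mem _ _ (Submodule.mem_span_singleton_self _)
  · rw [map_smul, map_smul, LinearMap.smul_apply, (h'.isFramePoint hx hr hrW).yy, smul_zero,
      smul_zero]

/-- Tangency of the hyperspheres is the pair of relations (B, y) = (B, dy) = 0. On a leaf y stays in
the fixed Lorentzian subspace T^⊥, and it moves with m parameters because K has dimension m + 1 and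
contains the generator direction. -/
theorem IsFocalField.isCanal (hx : IsLightlikeHypersurface x y)
    (hr : HasMaximalRank y) (h₀ : IsFocalField x y O b m) (hm : 1 ≤ m)
    (hc : ∀ q ∈ O, IsConic b m q) : IsCanal y b O m := by
  refine ⟨fun q hq => ?_, fun q hq => ?_,
    h₀.isFoliated_of_conic hx hr hm hc fun S hS q hq hrS => ⟨?_, fun r hrr => ?_⟩⟩
  · obtain ⟨W, X, Y, s, hqW, -, h⟩ := h₀.exists_isFocalFrame hx hr hm hq
    exact ⟨(hc q hq).1, h.mem_deSitter hx hr hqW, (hc q hq).2.1⟩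
  · obtain ⟨W, X, Y, s, hqW, -, h⟩ := h₀.exists_isFocalFrame hx hr hm hq
    have hf := h.isFramePoint hx hr hqW
    rw [h.frame.2.1.tangentSubspace_eq hqW]
    refine sup_le ?_ ?_
    · rw [Submodule.span_singleton_le_iff_mem, mem_polar_iff (h.isLift hx hr) hqW]
      simp [focus, hf.xy, hf.yy]
    · rintro _ ⟨v, rfl⟩
      rw [mem_polar_iff (h.isLift hx hr) hqW]
      have h1 : lor n (X q) (dif Y q v) = 0 := hf.xQ v
      have h2 : lor n (Y q) (dif Y q v) = 0 := hf.yQ v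
      simp [focus, h1, h2]
  · obtain ⟨W, X, Y, s, hqW, -, h⟩ := h₀.exists_isFocalFrame hx hr hm (hS hq)
    obtain ⟨h1, h2, h3⟩ := h.isLorentzian hx hr hqW (hc q (hS hq))
    refine ⟨b q, _, h1, h2, h3, fun r hrr => ⟨(hrS r hrr).1, ?_⟩⟩
    obtain ⟨W', X', Y', s', hrW, -, h'⟩ := h₀.exists_isFocalFrame hx hr hm (hS hrr)
    rw [h'.frame.2.1.submodule_eq hrW, Submodule.span_singleton_le_iff_mem, ← (hrS r hrr).2]
    exact h'.y_mem_orthogonal hx hr hrW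
  · obtain ⟨W, X, Y, s, hrW, -, h⟩ := h₀.exists_isFocalFrame hx hr hm (hS hrr)
    have hf := h.isFramePoint hx hr hrW
    rw [h.frame.2.1.tangentAlong_eq hrW, h.focalDir_eq hx hr hrW,
      hf.finrank_tangent_y (hf.comap_Q_le_focalKer _)]
    exact h.finrank_eq r hrW

end ConicFoliation

/-! ### Derivatives of inverse charts, and the chart for torses. -/

section InverseDerivative

variable {A B : Type*} [NormedAddCommGroup A] [NormedSpace ℝ A] [NormedAddCommGroup B]
  [NormedSpace ℝ B]

theorem surjective_fderiv_of_symm {φ : OpenPartialHomeomorph A B}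
    (hφ : ContDiffOn ℝ ∞ φ φ.source) (hφs : ContDiffOn ℝ ∞ φ.symm φ.target) {u : A}
    (hu : u ∈ φ.source) : Function.Surjective (fderiv ℝ φ u) := by
  have hd : DifferentiableAt ℝ φ u :=
    (hφ.contDiffAt (φ.open_source.mem_nhds hu)).differentiableAt (by simp)
  have hds : DifferentiableAt ℝ φ.symm (φ u) :=
    (hφs.contDiffAt (φ.open_target.mem_nhds (φ.map_source hu))).differentiableAt (by simp)
  intro w
  refine ⟨fderiv ℝ φ.symm (φ u) w, ?_⟩
  have hd' : HasFDerivAt φ (fderiv ℝ φ u) (φ.symm (φ u)) := by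
    rw [φ.left_inv hu]
    exact hd.hasFDerivAt
  have h1 := hd'.comp (φ u) hds.hasFDerivAt
  have h2 : φ ∘ φ.symm =ᶠ[nhds (φ u)] id := by
    filter_upwards [φ.open_target.mem_nhds (φ.map_source hu)] with z hz
    exact φ.right_inv hz
  exact congrArg (fun L : B →L[ℝ] B => L w)
    (h1.unique ((hasFDerivAt_id (φ u)).congr_of_eventuallyEq h2))

end InverseDerivative

/-- The lines through `B` with isotropic directions `Y` tangent to the hypersurface described by
`B` form, in a suitable chart, a family of torses. -/
theorem exists_torse_chart {n : ℕ} (hn : 2 ≤ n) {B Y : E n → V n} {U : Set (E n)} (hU : IsOpen U)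
    (hB : ContDiffOn ℝ ∞ B U) (hY : ContDiffOn ℝ ∞ Y U)
    (hrank : ∀ u ∈ U, Module.finrank ℝ (LinearMap.range (fderiv ℝ B u : E n →ₗ[ℝ] V n)) = n - 1)
    (hmem : ∀ u ∈ U, Y u ∈ LinearMap.range (fderiv ℝ B u : E n →ₗ[ℝ] V n))
    (hY0 : ∀ u ∈ U, Y u ≠ 0) (hYY : ∀ u ∈ U, lor n (Y u) (Y u) = 0)
    (hYB : ∀ u ∈ U, ∀ v, lor n (Y u) (fderiv ℝ B u v) = 0)
    (hli : ∀ u ∈ U, LinearIndependent ℝ ![B u, Y u]) {p : E n} (hp : p ∈ U) :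
    ∃ (φ : OpenPartialHomeomorph (E n) (E 2 × E (n - 2))) (r : ℝ), p ∈ φ.source ∧ φ.source ⊆ U ∧
      ContDiffOn ℝ ∞ φ φ.source ∧ ContDiffOn ℝ ∞ φ.symm φ.target ∧
      φ.target = Metric.ball 0 r ×ˢ Metric.ball 0 r ∧
      (∀ u ∈ φ.source, Function.Surjective (fderiv ℝ (fun w => (φ w).2) u) ∧
        ∀ v, fderiv ℝ (fun w => (φ w).2) u v = 0 →
          fderiv ℝ B u v ∈ Submodule.span ℝ {Y u}) ∧
      ∀ u ∈ φ.source, ∃ (γ : ℝ → V n) (J : Set ℝ) (τ : E n → ℝ), IsOpen J ∧ J.OrdConnected ∧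
        ContDiffOn ℝ ∞ γ J ∧ (∀ t ∈ J, LinearIndependent ℝ ![γ t, deriv γ t]) ∧
        ContinuousOn τ φ.source ∧ τ '' {w | w ∈ φ.source ∧ (φ w).2 = (φ u).2} = J ∧
        ∀ w ∈ φ.source, (φ w).2 = (φ u).2 → B w = γ (τ w) ∧
          Submodule.span ℝ {Y w} = Submodule.span ℝ {deriv γ (τ w)} := by
  obtain ⟨φ₁, r, G, hr0, hp₁, hφU, hφ, hφs, htar, hGs, hG, ⟨π, hπ⟩, hφd⟩ :=
    exists_constant_rank_chart (by omega : 1 + (n - 1) = n) hU hB hrank hp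
  set a₀ := (φ₁ p).1
  set c₀ := (φ₁ p).2
  have hsrc : ∀ c ∈ Metric.ball c₀ r, φ₁.symm (a₀, c) ∈ φ₁.source ∧
      φ₁ (φ₁.symm (a₀, c)) = (a₀, c) := by
    intro c hc
    have : (a₀, c) ∈ φ₁.target := htar ▸ ⟨Metric.mem_ball_self hr0, hc⟩
    exact ⟨φ₁.map_target this, φ₁.right_inv this⟩
  let Y' : E (n - 1) → V n := fun c => Y (φ₁.symm (a₀, c))
  have hY' : ContDiffOn ℝ ∞ Y' (Metric.ball c₀ r) :=
    (hY.comp hφs fun z hz => hφU (φ₁.map_target hz)).comp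
      (contDiff_const.prodMk contDiff_id).contDiffOn
      fun c hc => htar ▸ ⟨Metric.mem_ball_self hr0, hc⟩
  -- π ∘ G is the identity, so π inverts dG on its range: ξ is the vector field with dG(ξ) = Y'.
  let ξ : E (n - 1) → E (n - 1) := fun c => π (Y' c)
  have hξ : ContDiffOn ℝ ∞ ξ (Metric.ball c₀ r) := π.contDiff.comp_contDiffOn hY'
  have hGd : ∀ c ∈ Metric.ball c₀ r, HasFDerivAt G (fderiv ℝ G c) c := fun c hc =>
    ((hGs.contDiffAt (Metric.isOpen_ball.mem_nhds hc)).differentiableAt (by simp)).hasFDerivAt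
  have hGξ : ∀ c ∈ Metric.ball c₀ r, fderiv ℝ G c (ξ c) = Y' c := by
    intro c hc
    obtain ⟨h1, h2⟩ := hsrc c hc
    have h3 := hmem _ (hφU h1)
    rw [range_eq_of_eq_comp (hφd _ h1).2.1 (hφd _ h1).1, h2] at h3
    obtain ⟨η, hη⟩ := h3
    have hη' : fderiv ℝ G c η = Y' c := hη
    have h4 : ∀ c' ∈ Metric.ball c₀ r, π (G c') = c' := by
      intro c' hc'
      obtain ⟨h1, h2⟩ := hsrc c' hc'
      have h5 := hG _ h1
      have h6 := hπ (φ₁.symm (a₀, c'))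
      rw [h2] at h5 h6
      rw [← h5, ← h6]
    have h5 : HasFDerivAt (fun c' => π (G c')) (π.comp (fderiv ℝ G c)) c :=
      π.hasFDerivAt.comp c (hGd c hc)
    have h6 : (fun c' => π (G c')) =ᶠ[nhds c] id := by
      filter_upwards [Metric.isOpen_ball.mem_nhds hc] with c' hc'
      exact h4 c' hc'
    have h7 : π (fderiv ℝ G c η) = η := congrArg (fun L : E (n - 1) →L[ℝ] E (n - 1) => L η)
      (h5.unique ((hasFDerivAt_id c).congr_of_eventuallyEq h6))
    rw [hη'] at h7
    change fderiv ℝ G c (π (Y' c)) = Y' c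
    rw [h7, hη']
  -- The tangent subspace of the image of B is the same along a fibre and has a single isotropic
  -- direction, so the direction of Y depends only on the point of the image.
  have hspan : ∀ u ∈ φ₁.source, Submodule.span ℝ {Y u} = Submodule.span ℝ {Y' (φ₁ u).2} := by
    intro u hu
    have hc : (φ₁ u).2 ∈ Metric.ball c₀ r := by
      have := φ₁.map_source hu
      rw [htar] at this
      exact this.2
    obtain ⟨h1, h2⟩ := hsrc _ hc
    have h3 := hmem u (hφU hu)
    have h4 : LinearMap.range (fderiv ℝ B u : E n →ₗ[ℝ] V n) =
        LinearMap.range (fderiv ℝ B (φ₁.symm (a₀, (φ₁ u).2)) : E n →ₗ[ℝ] V n) := by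
      rw [range_eq_of_eq_comp (hφd _ hu).2.1 (hφd _ hu).1,
        range_eq_of_eq_comp (hφd _ h1).2.1 (hφd _ h1).1, h2]
    rw [h4] at h3
    obtain ⟨v, hv⟩ := h3
    have h5 : lor n (Y' (φ₁ u).2) (Y u) = 0 := hv ▸ hYB _ (hφU h1) v
    have h6 := mem_span_of_lor_self_eq_zero (hYY _ (hφU h1)) (hY0 _ (hφU h1)) h5 (hYY u (hφU hu))
    obtain ⟨k, hk⟩ := Submodule.mem_span_singleton.1 h6
    have hk0 : k ≠ 0 := by
      rintro rfl
      exact hY0 u (hφU hu) (by rw [← hk, zero_smul])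
    rw [← hk]
    exact Submodule.span_singleton_smul_eq hk0.isUnit _
  have hc₀ := Metric.mem_ball_self (x := c₀) hr0
  have hξ0 : ξ c₀ ≠ 0 := by
    intro h
    have h1 := hGξ c₀ hc₀
    rw [h, map_zero] at h1
    exact hY0 _ (hφU (hsrc c₀ hc₀).1) h1.symm
  obtain ⟨H, O, hO, h0O, hH, hH0, hHm, hHd, hHi⟩ :=
    exists_flow_box (by omega : (n - 2) + 1 = n - 1) Metric.isOpen_ball hξ hc₀ hξ0
  -- The two leaf coordinates are split into the position along the fibre of B and the flow time;
  -- the remaining n - 2 coordinates label the integral curves.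
  let θ : E 2 ≃L[ℝ] E 1 × ℝ := ContinuousLinearEquiv.ofFinrankEq (by simp)
  let α : E 2 × E (n - 2) →L[ℝ] E 1 := (ContinuousLinearMap.fst ℝ _ _).comp
    ((θ : E 2 →L[ℝ] E 1 × ℝ).comp (ContinuousLinearMap.fst ℝ _ _))
  let β : E 2 × E (n - 2) →L[ℝ] ℝ × E (n - 2) := ((ContinuousLinearMap.snd ℝ _ _).comp
    ((θ : E 2 →L[ℝ] E 1 × ℝ).comp (ContinuousLinearMap.fst ℝ _ _))).prod
      (ContinuousLinearMap.snd ℝ _ _)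
  have hβ : ∀ z, β z = ((θ z.1).2, z.2) := fun z => rfl
  let Ω : Set (E 2 × E (n - 2)) := α ⁻¹' Metric.ball 0 r ∩ β ⁻¹' O
  have hΩ : IsOpen Ω := (Metric.isOpen_ball.preimage α.continuous).inter (hO.preimage β.continuous)
  have h0Ω : 0 ∈ Ω := by
    constructor
    · rw [Set.mem_preimage, map_zero]
      exact Metric.mem_ball_self hr0
    · rw [Set.mem_preimage, map_zero]
      exact h0O
  -- K passes from these coordinates to the constant rank chart; the required chart is φ₁ followed
  -- by the inverse of K.
  let K : E 2 × E (n - 2) → E 1 × E (n - 1) := fun z => (a₀ + α z, H (β z))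
  have hK : ContDiffOn ℝ ∞ K Ω :=
    (contDiff_const.add α.contDiff).contDiffOn.prodMk
      (hH.comp β.contDiff.contDiffOn fun z hz => hz.2)
  have hKt : ∀ z ∈ Ω, K z ∈ φ₁.target := by
    intro z hz
    rw [htar]
    refine ⟨?_, hHm hz.2⟩
    have := hz.1
    simpa [K] using this
  have hHd0 : ∀ w ∈ O, HasFDerivAt H (fderiv ℝ H w) w := fun w hw =>
    ((hH.contDiffAt (hO.mem_nhds hw)).differentiableAt (by simp)).hasFDerivAt
  have hKd : ∀ z ∈ Ω, HasFDerivAt K (α.prod ((fderiv ℝ H (β z)).comp β)) z := fun z hz =>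
    (α.hasFDerivAt.const_add a₀).prodMk ((hHd0 _ hz.2).comp z β.hasFDerivAt)
  have hinj : Function.Injective (α.prod ((fderiv ℝ H (β 0)).comp β)) := by
    rw [map_zero, injective_iff_map_eq_zero]
    intro z hz
    have h1 : α z = 0 := congrArg Prod.fst hz
    have h2 : fderiv ℝ H 0 (β z) = 0 := congrArg Prod.snd hz
    have h3 : β z = 0 := hHi (h2.trans (map_zero _).symm)
    have h4 : (θ z.1).2 = 0 := congrArg Prod.fst h3
    have h5 : z.2 = 0 := congrArg Prod.snd h3
    have h6 : θ z.1 = 0 := Prod.ext h1 h4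
    exact Prod.ext (θ.map_eq_zero_iff.1 h6) h5
  let e : (E 2 × E (n - 2)) ≃L[ℝ] E 1 × E (n - 1) :=
    (LinearEquiv.ofInjectiveOfFinrankEq
      (α.prod ((fderiv ℝ H (β 0)).comp β) : E 2 × E (n - 2) →ₗ[ℝ] E 1 × E (n - 1)) hinj
      (by simp; omega)).toContinuousLinearEquiv
  have he : (e : E 2 × E (n - 2) →L[ℝ] E 1 × E (n - 1)) =
      α.prod ((fderiv ℝ H (β 0)).comp β) := ContinuousLinearMap.ext fun z => rfl
  obtain ⟨ϑ, h0ϑ, hϑΩ, hϑK, hϑs, -⟩ := exists_smooth_inverse hΩ h0Ω hK (f' := e)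
    (he ▸ hKd 0 h0Ω)
  let φ₂ := φ₁.trans ϑ.symm
  have hφ₂t : φ₂.target = ϑ.source := by
    rw [OpenPartialHomeomorph.trans_target]
    refine Set.inter_eq_left.2 fun z hz => ?_
    change ϑ z ∈ φ₁.target
    rw [hϑK]
    exact hKt z (hϑΩ hz)
  have hK0 : K 0 = φ₁ p := by
    simp only [K, map_zero, add_zero, hH0]
    rfl
  have hp₂ : p ∈ φ₂.source ∧ φ₂ p = 0 := by
    have h1 : ϑ 0 = φ₁ p := by rw [hϑK, hK0]
    constructor
    · rw [OpenPartialHomeomorph.trans_source]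
      refine ⟨hp₁, ?_⟩
      change φ₁ p ∈ ϑ.target
      rw [← h1]
      exact ϑ.map_source h0ϑ
    · change ϑ.symm (φ₁ p) = 0
      rw [← h1, ϑ.left_inv h0ϑ]
  obtain ⟨ρ, hρ, hball⟩ := Metric.isOpen_iff.1 ϑ.open_source 0 h0ϑ
  have hprod : Metric.ball (0 : E 2) ρ ×ˢ Metric.ball (0 : E (n - 2)) ρ ⊆ φ₂.target := by
    rw [hφ₂t, ball_prod_same]
    exact hball
  obtain ⟨φ, hφt, hφS, hφe, hφse⟩ := exists_restr_target φ₂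
    (Metric.isOpen_ball.prod Metric.isOpen_ball) hprod
  have hfun : ∀ u, φ u = ϑ.symm (φ₁ u) := hφe
  have hsym : ∀ z, φ.symm z = φ₁.symm (K z) := fun z => by
    rw [hφse, ← hϑK]
    rfl
  have hs₂ : ∀ u ∈ φ.source, u ∈ φ₁.source ∧ φ u ∈ Ω ∧ φ₁ u = K (φ u) ∧ φ₁ u ∈ ϑ.target := by
    intro u hu
    rw [hφS] at hu
    have h1 := hu.1
    rw [OpenPartialHomeomorph.trans_source] at h1
    refine ⟨h1.1, ?_, ?_, h1.2⟩
    · rw [hfun]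
      exact hϑΩ (ϑ.map_target h1.2)
    · rw [hfun, ← hϑK, ϑ.right_inv h1.2]
  have hφsm : ContDiffOn ℝ ∞ φ φ.source := by
    have h1 := hϑs.comp (hφ.mono fun u hu => (hs₂ u hu).1) fun u hu => (hs₂ u hu).2.2.2
    exact h1.congr fun u _ => hfun u
  have hφssm : ContDiffOn ℝ ∞ φ.symm φ.target := by
    have hsub : φ.target ⊆ Ω := by
      rw [hφt]
      exact hprod.trans (hφ₂t ▸ hϑΩ)
    have h1 := hφs.comp (hK.mono hsub) fun z hz => hKt z (hsub hz)
    exact h1.congr fun z _ => hsym z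
  refine ⟨φ, ρ, ?_, fun u hu => hφU (hs₂ u hu).1, hφsm, hφssm, hφt, fun u hu => ⟨?_, ?_⟩, ?_⟩
  · rw [hφS]
    refine ⟨hp₂.1, ?_⟩
    rw [Set.mem_preimage, hp₂.2]
    exact ⟨Metric.mem_ball_self hρ, Metric.mem_ball_self hρ⟩
  · have hd : DifferentiableAt ℝ φ u :=
      (hφsm.contDiffAt (φ.open_source.mem_nhds hu)).differentiableAt (by simp)
    have h2 : HasFDerivAt (fun w => (φ w).2) _ u := hd.hasFDerivAt.snd
    rw [h2.fderiv]
    intro c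
    obtain ⟨v, hv⟩ := surjective_fderiv_of_symm hφsm hφssm hu (0, c)
    exact ⟨v, congrArg Prod.snd hv⟩
  · intro v hv
    obtain ⟨hu₁, huΩ, huK, -⟩ := hs₂ u hu
    have hd : DifferentiableAt ℝ φ u :=
      (hφsm.contDiffAt (φ.open_source.mem_nhds hu)).differentiableAt (by simp)
    have h2 : HasFDerivAt (fun w => (φ w).2) _ u := hd.hasFDerivAt.snd
    rw [h2.fderiv] at hv
    have hv2 : (fderiv ℝ φ u v).2 = 0 := hv
    have h3 : (fun w => (φ₁ w).2) =ᶠ[nhds u] fun w => H (β (φ w)) := by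
      filter_upwards [φ.open_source.mem_nhds hu] with w hw
      rw [(hs₂ w hw).2.2.1]
    have h4 : HasFDerivAt (fun w => H (β (φ w)))
        ((fderiv ℝ H (β (φ u))).comp (β.comp (fderiv ℝ φ u))) u :=
      (hHd0 _ huΩ.2).comp u (β.hasFDerivAt.comp u hd.hasFDerivAt)
    have h5 : HasDerivAt (fun t => H (t, (β (φ u)).2)) (fderiv ℝ H (β (φ u)) (1, 0))
        (β (φ u)).1 :=
      HasFDerivAt.comp_hasDerivAt (β (φ u)).1 (hHd0 (β (φ u)) huΩ.2)
        ((hasDerivAt_id _).prodMk (hasDerivAt_const _ _))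
    have h6 := h5.unique (hHd _ huΩ.2)
    have h7 : β (fderiv ℝ φ u v) = (θ (fderiv ℝ φ u v).1).2 • ((1 : ℝ), (0 : E (n - 2))) := by
      rw [hβ, hv2]
      simp
    have hH2 : (φ₁ u).2 = H (β (φ u)) := by rw [huK]
    rw [(hφd u hu₁).2.1, ContinuousLinearMap.comp_apply, h3.fderiv_eq, h4.fderiv,
      ContinuousLinearMap.comp_apply, ContinuousLinearMap.comp_apply, h7, map_smul, h6, map_smul,
      hH2, hGξ _ (hHm huΩ.2), hspan u hu₁, hH2]
    exact Submodule.smul_mem _ _ (Submodule.mem_span_singleton_self _)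
  · intro u hu
    let c := (φ u).2
    have hc : c ∈ Metric.ball (0 : E (n - 2)) ρ := by
      have := φ.map_source hu
      rw [hφt] at this
      exact this.2
    let ℓ : E 2 →L[ℝ] ℝ := (ContinuousLinearMap.snd ℝ (E 1) ℝ).comp (θ : E 2 →L[ℝ] E 1 × ℝ)
    -- The edge of regression is the image under G of an integral curve of ξ, so its velocity is Y'.
    let γ : ℝ → V n := fun t => G (H (t, c))
    let J : Set ℝ := ℓ '' Metric.ball 0 ρ
    let τ : E n → ℝ := fun w => ℓ (φ w).1
    have hτ : ∀ w ∈ φ.source, (φ w).2 = c → β (φ w) = (τ w, c) := by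
      intro w hw hwc
      rw [hβ, hwc]
      rfl
    have himage : τ '' {w | w ∈ φ.source ∧ (φ w).2 = c} = J := by
      ext t
      constructor
      · rintro ⟨w, ⟨hw, -⟩, rfl⟩
        have := φ.map_source hw
        rw [hφt] at this
        exact ⟨_, this.1, rfl⟩
      · rintro ⟨a, ha, rfl⟩
        have hac : (a, c) ∈ φ.target := hφt ▸ ⟨ha, hc⟩
        refine ⟨φ.symm (a, c), ⟨φ.map_target hac, ?_⟩, ?_⟩
        · rw [φ.right_inv hac]
        · simp only [τ]
          rw [φ.right_inv hac]
    have hOt : ∀ t ∈ J, ∃ w ∈ φ.source, (φ w).2 = c ∧ τ w = t ∧ (t, c) ∈ O := by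
      intro t ht
      rw [← himage] at ht
      obtain ⟨w, ⟨hw, hwc⟩, rfl⟩ := ht
      refine ⟨w, hw, hwc, rfl, ?_⟩
      rw [← hτ w hw hwc]
      exact (hs₂ w hw).2.1.2
    have hder : ∀ t ∈ J, deriv γ t = Y' (H (t, c)) := by
      intro t ht
      obtain ⟨w, -, -, -, hO⟩ := hOt t ht
      have h1 := (hGd _ (hHm hO)).comp_hasDerivAt t (hHd _ hO)
      rw [hGξ _ (hHm hO)] at h1
      exact h1.deriv
    have hval : ∀ w ∈ φ.source, (φ w).2 = c → B w = γ (τ w) ∧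
        Submodule.span ℝ {Y w} = Submodule.span ℝ {deriv γ (τ w)} := by
      intro w hw hwc
      have h1 : (φ₁ w).2 = H (τ w, c) := by rw [(hs₂ w hw).2.2.1, ← hτ w hw hwc]
      constructor
      · rw [hG w (hs₂ w hw).1, h1]
      · rw [hder (τ w) (himage ▸ ⟨w, ⟨hw, hwc⟩, rfl⟩), hspan w (hs₂ w hw).1, h1]
    have hℓo : IsOpenMap ℓ := isOpenMap_snd.comp θ.toHomeomorph.isOpenMap
    refine ⟨γ, J, τ, hℓo _ Metric.isOpen_ball,
      ((convex_ball _ _).is_linear_image ℓ.isLinear).ordConnected, ?_, fun t ht => ?_, ?_, himage,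
      hval⟩
    · exact hGs.comp (hH.comp (contDiff_id.prodMk contDiff_const).contDiffOn
        fun t ht => (hOt t ht).choose_spec.2.2.2) fun t ht => hHm (hOt t ht).choose_spec.2.2.2
    · obtain ⟨w, hw, hwc, rfl, -⟩ := hOt t ht
      obtain ⟨h1, h2⟩ := hval w hw hwc
      have h3 := hli w (hφU (hs₂ w hw).1)
      have h4 : Y w ∈ Submodule.span ℝ {deriv γ (τ w)} :=
        h2 ▸ Submodule.mem_span_singleton_self _
      obtain ⟨k, hk⟩ := Submodule.mem_span_singleton.1 h4
      have hk0 : k ≠ 0 := by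
        rintro rfl
        exact hY0 w (hφU (hs₂ w hw).1) (by rw [← hk, zero_smul])
      rw [LinearIndependent.pair_iff] at h3 ⊢
      intro s t hst
      have h5 : s • B w + (t * k⁻¹) • Y w = 0 := by
        rw [← hk, smul_smul, mul_assoc, inv_mul_cancel₀ hk0, mul_one, h1]
        exact hst
      obtain ⟨h6, h7⟩ := h3 _ _ h5
      exact ⟨h6, (mul_eq_zero.1 h7).resolve_right (inv_ne_zero hk0)⟩
    · exact ℓ.continuous.comp_continuousOn (continuous_fst.comp_continuousOn hφsm.continuousOn)

/-! ### Folds: openness and the foliation by torses. -/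

section TorseFoliation

variable {n : ℕ} {N : Type*} [TopologicalSpace N] [ChartedSpace (E n) N]
  [IsManifold 𝓘(ℝ, E n) ∞ N] {x y b : N → ℙ ℝ (V n)} {m : ℕ} {W O : Set N} {X Y : N → V n}
  {s : N → ℝ} {p q : N}

/-- For simple foci fold means not conic, and that is an open condition. -/
theorem IsFocalField.isOpen_fold (hx : IsLightlikeHypersurface x y)
    (hr : HasMaximalRank y) (h₀ : IsFocalField x y O b 1) :
    IsOpen {q | q ∈ O ∧ IsFold x y b q} := by
  rw [isOpen_iff_mem_nhds]
  rintro p ⟨hp, hpf⟩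
  obtain ⟨W, X, Y, s, hpW, hWO, h⟩ := h₀.exists_isFocalFrame hx hr le_rfl hp
  obtain ⟨W₁, hsub, hW₁, hp₁, hnc⟩ :=
    h.exists_nhds_not_conic hx hr hpW ((h.fold_iff hx hr hpW).1 hpf)
  filter_upwards [hW₁.mem_nhds hp₁] with q hq
  exact ⟨hWO (hsub hq), (h.fold_iff hx hr (hsub hq)).2 (hnc q hq)⟩

theorem IsFocalField.isFold_or_isConic (hx : IsLightlikeHypersurface x y)
    (hr : HasMaximalRank y) (h₀ : IsFocalField x y O b 1) (hq : q ∈ O) :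
    IsFold x y b q ∨ IsConic b 1 q := by
  obtain ⟨W, X, Y, s, hqW, -, h⟩ := h₀.exists_isFocalFrame hx hr le_rfl hq
  exact or_iff_not_imp_right.2 (h.fold_iff hx hr hqW).2

theorem IsFocalField.isFoliated_torse (hx : IsLightlikeHypersurface x y)
    (hr : HasMaximalRank y) (h₀ : IsFocalField x y O b 1) (hc : ∀ q ∈ O, IsFold x y b q) :
    IsFoliated (n := n) O 2 (n - 2) (fun _ S => IsTorse x y b S) := by
  refine isFoliated_of_coord (focalDir x y b) fun p hp => ?_
  obtain ⟨W, X, Y, s, hpW, hWO, h⟩ := h₀.exists_isFocalFrame hx hr le_rfl hp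
  have hle := h.succ_le hpW
  have hpp := mem_chart_source (E n) p
  have hfold : ∀ q ∈ W,
      Y q ∈ LinearMap.range (dif (focus X Y s) q : TangentSpace 𝓘(ℝ, E n) q →ₗ[ℝ] V n) ∧
      Module.finrank ℝ (LinearMap.range (dif (focus X Y s) q :
        TangentSpace 𝓘(ℝ, E n) q →ₗ[ℝ] V n)) = n - 1 := by
    intro q hq
    rcases h.conic_or hx hr hq with h1 | h1
    · exact absurd h1.2.1 ((h.fold_iff hx hr hq).1 (hc q (hWO hq)))
    · exact ⟨h1.1, h1.2.2.2⟩
  have hf := fun (q : N) (hq : q ∈ W) => h.isFramePoint hx hr hq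
  obtain ⟨φ, r, hpφ, hφU, hφ, hφs, htar, hφd, htorse⟩ :=
    exists_torse_chart hle (isOpen_coordSet h.isOpen)
      (contDiffOn_coord (p := p) h.contMDiffOn_focus)
      (contDiffOn_coord (p := p) h.frame.2.1.2.1)
      (fun u hu => by
        obtain ⟨q, hq, hqp, rfl⟩ := exists_of_mem_coordSet hu
        rw [← h.range_eq_coord hq hqp]
        exact (hfold q hq).2)
      (fun u hu => by
        obtain ⟨q, hq, hqp, rfl⟩ := exists_of_mem_coordSet hu
        rw [← h.range_eq_coord hq hqp, coord_chart Y hqp]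
        exact (hfold q hq).1)
      (fun u hu => (hf _ hu.2).y_ne) (fun u hu => (hf _ hu.2).yy)
      (fun u hu v => by
        obtain ⟨q, hq, hqp, rfl⟩ := exists_of_mem_coordSet hu
        have h1 := (hf q hq).y_focus (h.dif_focus hq) ((chartEquiv p hqp).symm v)
        change lor n (Y q) (dif (focus X Y s) q ((chartEquiv p hqp).symm v)) = 0 at h1
        rwa [dif_eq_coord h.isOpen h.contMDiffOn_focus hq hqp,
          ContinuousLinearEquiv.apply_symm_apply, ← coord_chart Y hqp] at h1)
      (fun u hu => (hf _ hu.2).linearIndependent_focus) (mem_coordSet hpW hpp)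
  have hmem : ∀ q ∈ (chartAt (E n) p).source, chartAt (E n) p q ∈ φ.source → q ∈ W := by
    intro q hqp hq
    have h1 := (hφU hq).2
    rwa [Set.mem_preimage, (chartAt (E n) p).left_inv hqp] at h1
  refine ⟨φ, hpφ, hφU.trans (Set.inter_subset_inter_right _ (Set.preimage_mono hWO)), hφ, hφs,
    ⟨_, _, (convex_ball _ _).isPreconnected, (convex_ball _ _).isPreconnected, htar⟩, ?_, ?_⟩
  · intro q hqp hq v
    have hqW := hmem q hqp hq
    obtain ⟨hsurj, hker⟩ := hφd _ hq
    let L : TangentSpace 𝓘(ℝ, E n) q →ₗ[ℝ] E (n - 2) :=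
      (fderiv ℝ (fun w => (φ w).2) (chartAt (E n) p q) : E n →ₗ[ℝ] E (n - 2)) ∘ₗ
        (chartEquiv p hqp).toLinearEquiv.toLinearMap
    have hLs : Function.Surjective L := hsurj.comp (chartEquiv p hqp).surjective
    have hLker : LinearMap.ker L ≤ frameKer X Y q (s q) := by
      intro w hw
      have h1 := hker (chartEquiv p hqp w) hw
      rw [← dif_eq_coord h.isOpen h.contMDiffOn_focus hqW hqp, coord_chart Y hqp] at h1
      rw [frameKer, ← IsFramePoint.comap_span_y (h.dif_focus hqW)]
      exact h1
    have hfin := LinearMap.finrank_range_add_finrank_ker L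
    rw [LinearMap.range_eq_top.2 hLs, finrank_top, finrank_euclideanSpace_fin,
      finrank_tangentSpace] at hfin
    -- The tangent space of a leaf has dimension n - (n - 2) = 2, and so has K for a simple focus;
    -- inclusion is therefore equality.
    have heq := Submodule.eq_of_le_of_finrank_eq hLker (by
      rw [h.finrank_eq q hqW]
      omega)
    rw [h.focalDir_eq hx hr hqW, ← heq]
    rfl
  · intro q hqp hq
    obtain ⟨γ, J, τ, hJ, hJc, hγ, hli, hτ, himage, hval⟩ := htorse _ hq
    refine ⟨γ, J, fun r => τ (chartAt (E n) p r), hJ, hJc, hγ, hli, ?_, ?_, fun r hr => ?_⟩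
    · exact hτ.comp ((chartAt (E n) p).continuousOn.mono fun r hr => hr.1) fun r hr => hr.2.1
    · rw [← himage]
      ext t
      constructor
      · rintro ⟨r, ⟨-, h1, h2⟩, rfl⟩
        exact ⟨_, ⟨h1, h2⟩, rfl⟩
      · rintro ⟨w, ⟨h1, h2⟩, rfl⟩
        have h3 := (chartAt (E n) p).right_inv (hφU h1).1
        refine ⟨(chartAt (E n) p).symm w, ⟨(chartAt (E n) p).map_target (hφU h1).1, ?_⟩, ?_⟩
        · rw [h3]
          exact ⟨h1, h2⟩
        · exact congrArg τ h3
    · obtain ⟨hrp, hrφ, hrq⟩ := hr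
      have hrW := hmem r hrp hrφ
      obtain ⟨h1, h2⟩ := hval _ hrφ hrq
      rw [coord_chart _ hrp] at h1 h2
      constructor
      · rw [h.submodule_eq r hrW, ← h1]
        rfl
      · rw [h.generator_eq_focus hrW, Submodule.span_insert, h2, h1, ← Submodule.span_insert]

end TorseFoliation

end DeSitter

end

theorem theorem7 {n : ℕ} (hn : 1 ≤ n) {N : Type*} [TopologicalSpace N]
    [ChartedSpace (DeSitter.E n) N] [IsManifold 𝓘(ℝ, DeSitter.E n) ∞ N]
    (x y : N → ℙ ℝ (DeSitter.V n))
    (hx : DeSitter.IsLightlikeHypersurface x y) (hr : DeSitter.HasMaximalRank y) :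
    -- each generator carries `n - 1` real singular points, counted with multiplicity
    (∀ q : N, ∃ (S : Finset (ℙ ℝ (DeSitter.V n))) (μ : ℙ ℝ (DeSitter.V n) → ℕ),
      (∀ z, z ∈ S ↔ DeSitter.IsSingularPoint x y q z) ∧
      (∀ z ∈ S, z ∈ DeSitter.deSitter n ∧ DeSitter.HasMultiplicity x y q z (μ z) ∧ 1 ≤ μ z) ∧
      ∑ z ∈ S, μ z = n - 1) ∧
    -- a simple focus belongs to a local field of simple foci
    (∀ (p : N) (z : ℙ ℝ (DeSitter.V n)), DeSitter.HasMultiplicity x y p z 1 →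
      ∃ (O : Set N) (b : N → ℙ ℝ (DeSitter.V n)),
        p ∈ O ∧ DeSitter.IsFocalField x y O b 1 ∧ b p = z) ∧
    -- simple foci: folds and conic points
    (∀ (O : Set N) (b : N → ℙ ℝ (DeSitter.V n)), DeSitter.IsFocalField x y O b 1 →
      (∀ q ∈ O, DeSitter.IsFold x y b q ∨ DeSitter.IsConic b 1 q) ∧
      IsOpen {q | q ∈ O ∧ DeSitter.IsFold x y b q} ∧
      ((∀ q ∈ O, DeSitter.IsFold x y b q) →
        DeSitter.IsFoliated (n := n) O 2 (n - 2) (fun _ S => DeSitter.IsTorse x y b S)) ∧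
      ((∀ q ∈ O, DeSitter.IsConic b 1 q) →
        DeSitter.IsFoliated (n := n) O 2 (n - 2) (fun _ S => DeSitter.IsConePiece x y b 2 S) ∧
        DeSitter.IsCanal y b O 1)) ∧
    -- multiple foci are conic
    (∀ (O : Set N) (b : N → ℙ ℝ (DeSitter.V n)) (m : ℕ), 2 ≤ m →
      DeSitter.IsFocalField x y O b m →
      (∀ q ∈ O, DeSitter.IsConic b m q) ∧
      DeSitter.IsFoliated (n := n) O (m + 1) (n - m - 1)
        (fun _ S => DeSitter.IsConePiece x y b (m + 1) S) ∧
      DeSitter.IsCanal y b O m) := by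
  refine ⟨DeSitter.exists_singular_points hx hr,
    fun p z hz => DeSitter.exists_isFocalField hx hr hz, fun O b h => ⟨?_, ?_, ?_, ?_⟩,
    fun O b m hm h => ?_⟩
  · exact fun q hq => h.isFold_or_isConic hx hr hq
  · exact h.isOpen_fold hx hr
  · exact h.isFoliated_torse hx hr
  · exact fun hc => ⟨h.isFoliated_cone hx hr le_rfl hc, h.isCanal hx hr le_rfl hc⟩
  · have hc : ∀ q ∈ O, DeSitter.IsConic b m q := by
      intro q hq
      obtain ⟨W, X, Y, s, hqW, -, hf⟩ := h.exists_isFocalFrame hx hr (by omega) hq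
      exact hf.isConic hx hr hm hqW
    exact ⟨hc, h.isFoliated_cone hx hr (by omega) hc, h.isCanal hx hr (by omega) hc⟩
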